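/- Let $d,n\ge 1$. For a real $d\times n$ matrix $a$ and $b\in\mathbf R^n$ put $f_j(a,b,x)=\sum_{i=1}^d a_{ij}x_i+b_j$ ($1\le j\le n$). Let $(\tilde a,\tilde b)$ be such that the half-spaces $H_j=\{x\in\mathbf R^d: f_j(\tilde a,\tilde b,x)\ge 0\}$ are the bounding half-spaces of the polyhedron $P=\bigcap_j H_j$; that is, the sets $F_j=P\cap\{f_j(\tilde a,\tilde b,\cdot)=0\}$ are, without repetition, all the facets of $P$ (nonempty faces of dimension $\dim P-1$). Assume that $P$ is in general position: in $\mathbf R^{d+1}$ put $\hat f_0(x_0,x)=x_0$ and $\hat f_j(x_0,x)=\tilde b_jx_0+\sum_i\tilde a_{ij}x_i$; then for every $J\subset\{0,1,\dots,n\}$ the cone $\{\hat f_k\ge 0\ (0\le k\le n),\ \hat f_k=0\ (k\in J)\}$ is $\{0\}$ or has dimension $d+1-|J|$. Let $\mathcal F=\{J\subset[n]: P\cap\bigcap_{j\in J}F_j\ne\emptyset\}$ be the nerve of the facets. With the Heaviside function $H$ put $$\varphi(a,b)=\int_{\mathbf R^d}\frac{e^{-\frac12\sum x_i^2}}{(2\pi)^{d/2}}\prod_{j=1}^nH(f_j(a,b,x))\,dx,\qquad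 \varphi_F(a,b)=\int_{\mathbf R^d}\frac{e^{-\frac12\sum x_i^2}}{(2\pi)^{d/2}}\prod_{j\in F}\bigl(H(f_j(a,b,x))-1\bigr)\,dx .$$ Let $\alpha_F(a)=(\sum_k a_{ki}a_{kj})_{i,j\in F}$ and $U_F=\{(a,b):\det\alpha_F(a)\ne0\}$ (with real or complex $(a,b)$). (1) Let $F\in\mathcal F$. Then $(\tilde a,\tilde b)\in U_F$. Choose an injection $e:F\to\{1,\dots,d\}$ and a real $d\times d$ matrix $u$ whose column $e(j)$ is the column $\tilde a_j$ for $j\in F$ and whose other columns form an orthonormal basis of the orthogonal complement of the span of these; such $e,u$ exist, and $u$ is always invertible. Let $\varepsilon:\mathbf R\to\mathbf R$ be any smooth function with $\inf\varepsilon>0$, $\sup\varepsilon<\infty$ and $\varepsilon'$ bounded. For $\lambda\in\{\pm1\}^{F}$ let $\gamma_\lambda:\mathbf R^d\to\mathbf C^d$ be the smooth map $$\gamma_{\lambda,i}(t)=\sum_{k=1}^d (u^{-1})_{ki}\bigl(\lambda_kt_k+\sqrt{-1}\,\lambda_k\,\varepsilon(\lambda_kt_k)\bigr),$$ where $\lambda_k$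 means $\lambda_j$ if $k=e(j)$, and $1$ if $k$ is not in the image of $e$. Then there is a connected open neighborhood $V\subset U_F$ of $(\tilde a,\tilde b)$ in the space of real parameters such that, for all $(a,b)\in V$, the values $f_j(a,b,\gamma_\lambda(t))$ ($j\in F$) avoid the branch cut $(-\infty,0]$ of the principal logarithm, the following integrals converge absolutely, and $$\varphi_F(a,b)=\operatorname{sgn}(\det u)\sum_{\lambda\in\{\pm1\}^{F}}\int_{\gamma_\lambda}\frac{1}{(2\pi)^{d/2}}e^{-\frac12\sum_i z_i^2}\prod_{j\in F}\left(-\frac{\log f_j(a,b,z)}{2\pi\sqrt{-1}}\right)dz_1\wedge\dots\wedge dz_d .$$ (2) There is a connected open neighborhood $W\subset\bigcap_{F\in\mathcal F}U_F$ of $(\tilde a,\tilde b)$ in the space of real parameters on which $\varphi$ is real analytic, and $\varphi$ continues analytically along every continuous path in the complex set $\bigcap_{F\in\mathcal F}U_F\subset\mathbf C^{d\times n}\times\mathbf C^n$ that starts at a point of $W$. -/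

import Mathlib

open Topology

namespace GaussPolyhedron

noncomputable section

/-- The parameter `(a, b)`: a `d × n` matrix `a` and a vector `b` of length `n`. -/
abbrev Params (𝕜 : Type) (d n : ℕ) : Type := (Fin d → Fin n → 𝕜) × (Fin n → 𝕜)

/-- `f_j(a, b, x) = ∑ i, a i j * x i + b j`. -/
def linForm {𝕜 : Type} [CommRing 𝕜] {d n : ℕ} (p : Params 𝕜 d n) (x : Fin d → 𝕜) (j : Fin n) : 𝕜 :=
  ∑ i, p.1 i j * x i + p.2 j

/-- A real parameter regarded as a complex one. -/
def toComplex {d n : ℕ} (p : Params ℝ d n) : Params ℂ d n :=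
  (fun i j => (p.1 i j : ℂ), fun j => (p.2 j : ℂ))

/-! ### Polyhedra, faces, nerves, general position -/

/-- The half-space `H_j = {x | f_j(a, b, x) ≥ 0}`; the polyhedron is the intersection of these. -/
def polyhedron {d n : ℕ} (p : Params ℝ d n) : Set (Fin d → ℝ) :=
  {x | ∀ j, 0 ≤ linForm p x j}

/-- The set cut out of the polyhedron by the hyperplane `f_j(a, b, x) = 0`. -/
def facet {d n : ℕ} (p : Params ℝ d n) (j : Fin n) : Set (Fin d → ℝ) :=
  {x | x ∈ polyhedron p ∧ linForm p x j = 0}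

/-- `G` is a face of `P`: it is cut out of `P` by the hyperplane of equality of an affine
inequality that is valid on `P`. -/
def IsFace {d : ℕ} (P G : Set (Fin d → ℝ)) : Prop :=
  ∃ (c : Fin d → ℝ) (c₀ : ℝ), (∀ x ∈ P, 0 ≤ ∑ i, c i * x i + c₀) ∧
    G = {x | x ∈ P ∧ ∑ i, c i * x i + c₀ = 0}

/-- `G` is a facet of `P`: a (nonempty) face of dimension `dim P - 1`. -/
def IsFacet {d : ℕ} (P G : Set (Fin d → ℝ)) : Prop :=
  IsFace P G ∧ G.Nonempty ∧
    Module.finrank ℝ (vectorSpan ℝ G) + 1 = Module.finrank ℝ (vectorSpan ℝ P)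

/-- The half-spaces `H_1, …, H_n` given by `p` are the family of bounding half-spaces of their
intersection: the sets `∂H_j ∩ P` are, without repetition, all the facets of `P`. -/
def IsBoundingFamily {d n : ℕ} (p : Params ℝ d n) : Prop :=
  (∀ j, IsFacet (polyhedron p) (facet p j)) ∧ Function.Injective (facet p) ∧
    ∀ G, IsFacet (polyhedron p) G → ∃ j, facet p j = G

/-- The abstract simplicial complex of the polyhedron: the nerve of its facets. -/
def nerve {d n : ℕ} (p : Params ℝ d n) : Set (Finset (Fin n)) :=
  {J | ∃ x ∈ polyhedron p, ∀ j ∈ J, x ∈ facet p j}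

/-- The linear forms of the homogenization on `ℝ × ℝ^d`: the index `none` is the additional form
`x₀`, and `some j` is `b j * x₀ + ∑ i, a i j * x i`. -/
def homForm {d n : ℕ} (p : Params ℝ d n) : Option (Fin n) → ℝ × (Fin d → ℝ) → ℝ
  | none, y => y.1
  | some j, y => p.2 j * y.1 + ∑ i, p.1 i j * y.2 i

/-- The face of the homogenized cone on which the forms with index in `J` vanish. -/
def homFace {d n : ℕ} (p : Params ℝ d n) (J : Finset (Option (Fin n))) :
    Set (ℝ × (Fin d → ℝ)) :=
  {y | (∀ k, 0 ≤ homForm p k y) ∧ ∀ k ∈ J, homForm p k y = 0}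

/-- General position: for every `J ⊆ {0, 1, …, n}` the cone `homFace p J` is `{0}` or has
dimension `d + 1 - |J|`. -/
def InGeneralPosition {d n : ℕ} (p : Params ℝ d n) : Prop :=
  ∀ J : Finset (Option (Fin n)), homFace p J = {0} ∨
    Module.finrank ℝ (vectorSpan ℝ (homFace p J)) + J.card = d + 1

/-! ### The Gaussian integrals -/

/-- The Heaviside function. -/
def heaviside (y : ℝ) : ℝ := if 0 ≤ y then 1 else 0

/-- The normalizing constant `(2π)^(-d/2)`. -/
def gaussConst (d : ℕ) : ℝ := (2 * Real.pi) ^ (-(d : ℝ) / 2)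

/-- `φ(a, b)`: the Gaussian probability of the polyhedron. -/
def phi {d n : ℕ} (p : Params ℝ d n) : ℝ :=
  ∫ x : Fin d → ℝ, gaussConst d * Real.exp (-(1 / 2) * ∑ i, x i ^ 2) *
    ∏ j, heaviside (linForm p x j)

/-- `φ_F(a, b)`. -/
def phiF {d n : ℕ} (F : Finset (Fin n)) (p : Params ℝ d n) : ℝ :=
  ∫ x : Fin d → ℝ, gaussConst d * Real.exp (-(1 / 2) * ∑ i, x i ^ 2) *
    ∏ j ∈ F, (heaviside (linForm p x j) - 1)

/-- The matrix `α_F(a) = (∑ k, a k i * a k j)_{i, j ∈ F}` (no complex conjugation). -/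
def gram {𝕜 : Type} [CommRing 𝕜] {d n : ℕ} (a : Fin d → Fin n → 𝕜) (F : Finset (Fin n)) :
    Matrix F F 𝕜 :=
  Matrix.of fun i j => ∑ k, a k i * a k j

/-- The set `U_F = {(a, b) | det α_F(a) ≠ 0}` of real (`𝕜 = ℝ`) or complex (`𝕜 = ℂ`)
parameters. -/
def regularSet (𝕜 : Type) [CommRing 𝕜] {d n : ℕ} (F : Finset (Fin n)) : Set (Params 𝕜 d n) :=
  {p | (gram p.1 F).det ≠ 0}

/-! ### The contour integrals -/

/-- The columns of `u` with index in the range of `e` are the columns `a_j`, `j ∈ F`, and the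
other columns are an orthonormal basis of the orthogonal complement of their span
(when the `a_j`, `j ∈ F`, are linearly independent). -/
structure IsAdaptedFrame {d n : ℕ} (a : Fin d → Fin n → ℝ) (F : Finset (Fin n))
    (e : F ↪ Fin d) (u : Matrix (Fin d) (Fin d) ℝ) : Prop where
  col_eq : ∀ (j : F) (i : Fin d), u i (e j) = a i j
  orthogonal : ∀ k, k ∉ Set.range e → ∀ j : F, ∑ i, u i k * a i j = 0
  orthonormal : ∀ k, k ∉ Set.range e → ∀ l, l ∉ Set.range e →
    ∑ i, u i k * u i l = if k = l then 1 else 0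

/-- The smooth height functions allowed in the contours: bounded, bounded away from `0`, and with
bounded derivative. -/
structure IsHeight (ε : ℝ → ℝ) : Prop where
  smooth : ContDiff ℝ (⊤ : ℕ∞) ε
  lower : ∃ c > 0, ∀ t, c ≤ ε t
  upper : ∃ C, ∀ t, ε t ≤ C
  deriv_bounded : ∃ C, ∀ t, |deriv ε t| ≤ C

/-- The signs `λ_j`, `j ∈ F`, moved to the coordinates `e j` and extended by `1`. -/
def signs {d n : ℕ} {F : Finset (Fin n)} (e : F ↪ Fin d) (lam : F → ℤˣ) : Fin d → ℝ :=
  Function.extend e (fun j => ((lam j : ℤ) : ℝ)) (fun _ => 1)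

/-- The contour `γ^λ : ℝ^d → ℂ^d`,
`γ^λ_i(t) = ∑ k, (u⁻¹)_{k i} (λ_k t_k + λ_k √-1 ε(λ_k t_k))`. -/
def contour {d n : ℕ} {F : Finset (Fin n)} (e : F ↪ Fin d) (u : Matrix (Fin d) (Fin d) ℝ)
    (ε : ℝ → ℝ) (lam : F → ℤˣ) (t : Fin d → ℝ) : Fin d → ℂ := fun i =>
  ∑ k, ((u⁻¹ k i : ℝ) : ℂ) *
    (((signs e lam k * t k : ℝ) : ℂ) +
      ((signs e lam k * ε (signs e lam k * t k) : ℝ) : ℂ) * Complex.I)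

/-- The coefficient of `dt_1 ∧ ⋯ ∧ dt_d` in the pullback along `γ : ℝ^d → ℂ^d` of the form
`g dz_1 ∧ ⋯ ∧ dz_d`. -/
def pullback {d : ℕ} (γ : (Fin d → ℝ) → (Fin d → ℂ)) (g : (Fin d → ℂ) → ℂ) (t : Fin d → ℝ) : ℂ :=
  g (γ t) * (Matrix.of fun i k : Fin d => fderiv ℝ γ t (Pi.single k 1) i).det

/-- The contour integral `∫_γ g dz_1 ⋯ dz_d`. -/
def contourIntegral {d : ℕ} (γ : (Fin d → ℝ) → (Fin d → ℂ)) (g : (Fin d → ℂ) → ℂ) : ℂ :=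
  ∫ t, pullback γ g t

/-- `(2π)^(-d/2) exp(-½ ∑ z_i²) ∏_{j ∈ F} (-log f_j(a, b, z) / (2π√-1))`, with the principal
branch of the logarithm. -/
def logIntegrand {d n : ℕ} (F : Finset (Fin n)) (p : Params ℂ d n) (z : Fin d → ℂ) : ℂ :=
  (gaussConst d : ℂ) * Complex.exp (-(1 / 2) * ∑ i, z i ^ 2) *
    ∏ j ∈ F, (-(Complex.log (linForm p z j) / (2 * Real.pi * Complex.I)))

/-! ### Analytic continuation -/

/-- `g` is an analytic continuation along the path `γ`: every `g t` is analytic at `γ t`, and for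
`s` close to `t` the germs of `g s` and `g t` at `γ s` agree. -/
def IsContinuationAlong {E : Type} [NormedAddCommGroup E] [NormedSpace ℂ E]
    (γ : C(unitInterval, E)) (g : unitInterval → E → ℂ) : Prop :=
  (∀ t, AnalyticAt ℂ (g t) (γ t)) ∧ ∀ t, ∀ᶠ s in 𝓝 t, g s =ᶠ[𝓝 (γ s)] g t

end

end GaussPolyhedron

open GaussPolyhedron

/-! Everything rests on writing `φ` as the sum of the `φ_F` over the nerve. Pointwise, the product
of the Heaviside factors equals the sum over `F` in the nerve of `∏_{j ∈ F} (H(f_j) - 1)`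
(`prod_heaviside_eq_sum`). On the polyhedron only the empty set contributes. At a point `x` outside,
the right side is an alternating count of the `F` in the nerve whose constraints are all violated at
`x`. It cancels by toggling one index that depends only on the point of the face of `F` nearest to
`x`, and the toggle leaves that nearest point fixed. This needs independent normals along each face,
which general position provides (`mem_regularSet_of_mem_nerve`). General position also makes the
nerve locally constant (`eventually_nerve_eq`), so near the given parameter the index set of the sum
is fixed.

Continuation. Under the Gaussian weight the vector `(-f_j)_{j ∈ F}` is normal with covariance `α_F`,
so up to the sign `(-1)^|F|` the function `φ_F` is the integral of a quadratic exponential over an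
orthant divided by the integral over the whole space (`phiF_eq`), with quadratic part `β = α_F⁻¹`
and linear part `c = -α_F⁻¹ b`. In the parameters `(β, c)` such an integral `L` satisfies a heat
equation, and integration by parts gives a linear system for its `c`-derivatives. Together they
yield `dL = L ω + θ`, where `ω` is rational with poles only on `det β = 0` (`β` symmetrized). Both
integrals share `ω`. For the whole space `θ = 0`, and for the orthant `θ` is built from orthant
integrals in one variable less. Hence `d log(full) = ω` and `d(orthant / full) = θ / full`, and
induction on the dimension applies once it is known that a germ continues wherever its differential
does (`Continues.of_fderiv`): the Poincaré lemma gives primitives on balls, and constants match them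
along the path. The only obstructions are zeros of principal minors of `β`. These correspond to
complementary minors of `α_F`, that is, to `det α_S` with `S ⊆ F` (`quadParam_mem_minorDomain`).

Contour formula. Scale the imaginary displacement of the contour by `τ`. The `τ`-derivative of the
integrand is a divergence, so the integral does not depend on `τ` (`integral_shift_eq`). Near the
parameter of the frame, the imaginary part of `f_j` on the contour has the sign `λ_j` and is at
least a constant times `τ`, so the branch cut is avoided. As `τ → 0` the logarithm tends to `log
|f_j|`, plus `λ_j π √-1` where `f_j < 0`. Dominated convergence applies because products of
logarithms of independent affine forms are integrable against a Gaussian. The orientations weight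
the limits by `∏ λ_j`; the weighted sum cancels `log |f_j|` and leaves `H(f_j) - 1`
(`sum_units_boundaryLog`). The Jacobian of the frame leaves `sgn det u`. -/

namespace GaussPolyhedron
noncomputable section

/-! ### Primitives of analytic 1-forms and gluing of increments -/

section Continuation

variable {E : Type} [NormedAddCommGroup E] [NormedSpace ℂ E]
variable {F : Type} [NormedAddCommGroup F] [NormedSpace ℂ F]

/-- The formal antiderivative, with constant term `z`, of a formal series of `1`-forms. -/
def primSeries (p : FormalMultilinearSeries ℂ E (E →L[ℂ] F)) (z : F) :
    FormalMultilinearSeries ℂ E F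
  | 0 => (continuousMultilinearCurryFin0 ℂ E F).symm z
  | n + 1 => ((n : ℂ) + 1)⁻¹ • ContinuousMultilinearMap.uncurryRight (p n)

theorem primSeries_succ_apply (p : FormalMultilinearSeries ℂ E (E →L[ℂ] F)) (z : F) (n : ℕ)
    (y : E) : primSeries p z (n + 1) (fun _ => y) = ((n : ℂ) + 1)⁻¹ • p n (fun _ => y) y := rfl

theorem norm_primSeries_succ_le (p : FormalMultilinearSeries ℂ E (E →L[ℂ] F)) (z : F) (n : ℕ) :
    ‖primSeries p z (n + 1)‖ ≤ ‖p n‖ := by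
  refine ContinuousMultilinearMap.opNorm_le_bound (norm_nonneg (p n)) fun m => ?_
  have h1 : ‖((n : ℂ) + 1)⁻¹‖ ≤ 1 := by
    rw [norm_inv]
    have : ‖(n : ℂ) + 1‖ = n + 1 := by
      rw [← Nat.cast_succ, Complex.norm_natCast]; push_cast; ring
    rw [this]
    exact inv_le_one_of_one_le₀ (by linarith [Nat.cast_nonneg (α := ℝ) n])
  have h2 : primSeries p z (n + 1) m = ((n : ℂ) + 1)⁻¹ • p n (Fin.init m) (m (Fin.last n)) := rfl
  rw [h2, norm_smul]
  refine (mul_le_of_le_one_left (norm_nonneg _) h1).trans ?_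
  exact (p n).norm_map_init_le m

theorem radius_le_radius_primSeries (p : FormalMultilinearSeries ℂ E (E →L[ℂ] F)) (z : F) :
    p.radius ≤ (primSeries p z).radius := by
  refine ENNReal.le_of_forall_nnreal_lt fun s hs => ?_
  have h1 := p.summable_norm_mul_pow hs
  refine (primSeries p z).le_radius_of_summable_norm ?_
  rw [← summable_nat_add_iff 1]
  refine Summable.of_nonneg_of_le (fun n => mul_nonneg (norm_nonneg _) (by positivity))
    (fun n => ?_) (h1.mul_right (s : ℝ))
  rw [pow_succ, ← mul_assoc]
  have := norm_primSeries_succ_le p z n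
  gcongr

/-- Termwise integration along the segment: the `n`-th term is homogeneous of degree `n` in `t`, and
`∫ tⁿ = 1 / (n + 1)` is the factor built into `primSeries`. -/
theorem hasSum_integral_segment [CompleteSpace F] {ω : E → E →L[ℂ] F} {x y : E}
    {p : FormalMultilinearSeries ℂ E (E →L[ℂ] F)} {R : ENNReal}
    (hp : HasFPowerSeriesOnBall ω p x R) (hy : y ∈ Metric.eball (0 : E) R)
    (hy' : ∀ t ∈ Set.Icc (0 : ℝ) 1, (t : ℂ) • y ∈ Metric.eball (0 : E) R) (z : F) :
    HasSum (fun n => primSeries p z (n + 1) (fun _ => y))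
      (∫ t in (0 : ℝ)..1, ω (x + (t : ℂ) • y) y) := by
  have hlt : (‖y‖₊ : ENNReal) < p.radius := by
    refine lt_of_lt_of_le ?_ hp.r_le
    simpa [Metric.mem_eball, edist_zero_right, enorm_eq_nnnorm] using hy
  have hsummable : Summable fun n => ‖p n (fun _ => y)‖ :=
    Summable.of_nonneg_of_le (fun n => norm_nonneg _)
      (fun n => ((p n).le_opNorm _).trans (le_of_eq (by simp))) (p.summable_norm_mul_pow hlt)
  have hbd : ∀ n, ‖p n (fun _ => y) y‖ ≤ ‖p n (fun _ => y)‖ * ‖y‖ := fun n =>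
    ContinuousLinearMap.le_opNorm _ _
  have key : HasSum (fun n => ∫ t in (0 : ℝ)..1, ((t : ℂ) ^ n) • (p n (fun _ => y) y))
      (∫ t in (0 : ℝ)..1, ω (x + (t : ℂ) • y) y) := by
    refine intervalIntegral.hasSum_integral_of_dominated_convergence
      (fun n _ => ‖p n (fun _ => y)‖ * ‖y‖) ?_ ?_ ?_ ?_ ?_
    · intro n
      refine Continuous.aestronglyMeasurable ?_
      fun_prop
    · intro n
      filter_upwards with t ht
      rw [Set.uIoc_of_le zero_le_one] at ht
      rw [norm_smul]
      refine (mul_le_of_le_one_left (norm_nonneg _) ?_).trans (hbd n)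
      rw [norm_pow, Complex.norm_real, Real.norm_eq_abs, abs_of_nonneg ht.1.le]
      exact pow_le_one₀ ht.1.le ht.2
    · filter_upwards with t ht
      exact hsummable.mul_right _
    · simp
    · filter_upwards with t ht
      rw [Set.uIoc_of_le zero_le_one] at ht
      have h2 := hp.hasSum (hy' t ⟨ht.1.le, ht.2⟩)
      have h3 := (ContinuousLinearMap.apply ℂ F y).hasSum h2
      have h4 : ∀ n, (p n fun _ => (t : ℂ) • y) y = ((t : ℂ) ^ n) • (p n (fun _ => y) y) := by
        intro n
        have := (p n).map_smul_univ (fun _ => (t : ℂ)) (fun _ => y)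
        simp only [Finset.prod_const, Finset.card_univ, Fintype.card_fin] at this
        rw [this]; rfl
      rw [show (fun n => ((t : ℂ) ^ n) • (p n (fun _ => y) y)) =
        fun n => (p n fun _ => (t : ℂ) • y) y from funext fun n => (h4 n).symm]
      exact h3
  have h5 : ∀ n : ℕ, ∫ t in (0 : ℝ)..1, ((t : ℂ) ^ n) • (p n (fun _ => y) y)
      = primSeries p z (n + 1) (fun _ => y) := by
    intro n
    rw [primSeries_succ_apply, intervalIntegral.integral_smul_const]
    congr 1
    have : ∫ t in (0 : ℝ)..1, (t : ℂ) ^ n = ((∫ t in (0 : ℝ)..1, t ^ n : ℝ) : ℂ) := by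
      rw [← intervalIntegral.integral_ofReal]; simp
    rw [this, integral_pow]
    simp
  simpa only [h5] using key

/-- A function with an analytic derivative is analytic. -/
theorem analyticAt_of_hasFDerivAt [CompleteSpace F] {f : E → F} {ω : E → E →L[ℂ] F} {x : E}
    (hω : AnalyticAt ℂ ω x) (hf : ∀ᶠ z in 𝓝 x, HasFDerivAt f (ω z) z) : AnalyticAt ℂ f x := by
  obtain ⟨p, r, hp⟩ := hω
  obtain ⟨ρ, hρ, hfρ⟩ := Metric.eventually_nhds_iff_ball.1 hf
  have hr' : 0 < min r (ENNReal.ofReal ρ) := lt_min hp.r_pos (by simpa using hρ)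
  replace hp := hp.mono hr' (min_le_left _ _)
  set R := min r (ENNReal.ofReal ρ) with hR
  have hball : ∀ z ∈ Metric.eball x R, HasFDerivAt f (ω z) z := by
    intro z hz
    apply hfρ
    have : edist z x < ENNReal.ofReal ρ := lt_of_lt_of_le hz (min_le_right _ _)
    rw [edist_dist] at this
    exact (ENNReal.ofReal_lt_ofReal_iff hρ).1 this
  refine ⟨primSeries p (f x), R, hp.r_le.trans (radius_le_radius_primSeries p (f x)), hr', ?_⟩
  intro y hy
  have hy' : ∀ t ∈ Set.Icc (0 : ℝ) 1, (t : ℂ) • y ∈ Metric.eball (0 : E) R := by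
    intro t ht
    have : ‖(t : ℂ) • y‖ ≤ ‖y‖ := by
      rw [norm_smul]
      refine mul_le_of_le_one_left (norm_nonneg _) ?_
      rw [Complex.norm_real, Real.norm_eq_abs, abs_of_nonneg ht.1]; exact ht.2
    simp only [Metric.mem_eball, edist_zero_right] at hy ⊢
    refine lt_of_le_of_lt ?_ hy
    rw [← ofReal_norm, ← ofReal_norm]
    exact ENNReal.ofReal_le_ofReal this
  have hy'' : ∀ t ∈ Set.Icc (0 : ℝ) 1, x + (t : ℂ) • y ∈ Metric.eball x R := by
    intro t ht
    have := hy' t ht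
    simpa [Metric.mem_eball, edist_zero_right, edist_eq_enorm_sub] using this
  have key := hasSum_integral_segment hp hy hy' (f x)
  have hint : ∫ t in (0 : ℝ)..1, ω (x + (t : ℂ) • y) y = f (x + y) - f x := by
    have h4 : ∀ t ∈ Set.uIcc (0 : ℝ) 1, HasDerivAt (fun t : ℝ => f (x + (t : ℂ) • y))
        (ω (x + (t : ℂ) • y) y) t := by
      intro t ht
      rw [Set.uIcc_of_le zero_le_one] at ht
      have h5 := hball (x + (t : ℂ) • y) (hy'' t ht)
      have h6 : HasDerivAt (fun t : ℝ => x + (t : ℂ) • y) y t := by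
        have := ((Complex.ofRealCLM.hasDerivAt (x := t)).smul_const y).const_add x
        simpa using this
      exact (h5.restrictScalars ℝ).comp_hasDerivAt t h6
    rw [intervalIntegral.integral_eq_sub_of_hasDerivAt h4]
    · simp
    · refine ContinuousOn.intervalIntegrable ?_
      rw [Set.uIcc_of_le zero_le_one]
      intro t ht
      refine ContinuousAt.continuousWithinAt ?_
      have h7 : ContinuousAt ω (x + (t : ℂ) • y) :=
        (hp.analyticAt_of_mem (hy'' t ht)).continuousAt
      have h8 : ContinuousAt (fun t : ℝ => x + (t : ℂ) • y) t := by fun_prop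
      exact (ContinuousAt.comp (g := ω) (f := fun t : ℝ => x + (t : ℂ) • y) h7 h8).clm_apply
        continuousAt_const
  rw [hint] at key
  -- The integral accounts for all terms of positive degree; the term of degree `0` is the value `f
  -- x`.
  refine (hasSum_nat_add_iff' 1).1 ?_
  have h9 : f (x + y) - ∑ i ∈ Finset.range 1, primSeries p (f x) i (fun _ => y)
      = f (x + y) - f x := by
    simp [primSeries]
  rw [h9]
  exact key

/-- A family of local increments along the unit interval which is a cocycle comes from a function
on the interval. -/
theorem exists_of_local_increments {F : Type} [AddCommGroup F] (δ : unitInterval → unitInterval → F)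
    (h : ∀ t, ∀ᶠ s in 𝓝 t, ∀ᶠ s' in 𝓝 s, δ s s' = δ t s' - δ t s) (c₀ : F) :
    ∃ c : unitInterval → F, c 0 = c₀ ∧ ∀ t, ∀ᶠ s in 𝓝 t, c s = c t + δ t s := by
  have hself : ∀ t, δ t t = 0 := by
    intro t
    have := (h t).self_of_nhds.self_of_nhds
    simpa using this
  choose U hU hUo htU using fun t => eventually_nhds_iff.1 (h t)
  obtain ⟨T, hT0, hTm, ⟨N, hN⟩, hTc⟩ := exists_monotone_Icc_subset_open_cover_unitInterval
    (c := U) hUo (fun t _ => Set.mem_iUnion.2 ⟨t, htU t⟩)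
  -- The intervals between consecutive `T k` each lie in one set on which the cocycle identity holds
  -- around a single base point. The function is built on `[0, T k]` by induction, and the local
  -- relation is claimed only for `s ≤ T k`, since nothing is fixed beyond that point yet.
  have key : ∀ k, ∃ c : unitInterval → F, c 0 = c₀ ∧
      ∀ t ≤ T k, ∀ᶠ s in 𝓝 t, s ≤ T k → c s = c t + δ t s := by
    intro k
    induction k with
    | zero =>
      refine ⟨fun _ => c₀, rfl, fun t ht => Filter.Eventually.of_forall fun s hs => ?_⟩
      rw [hT0] at ht hs
      have h1 : t = 0 := le_antisymm ht unitInterval.nonneg'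
      have h2 : s = 0 := le_antisymm hs unitInterval.nonneg'
      rw [h1, h2, hself, add_zero]
    | succ k ih =>
      obtain ⟨c, hc0, hc⟩ := ih
      obtain ⟨τ, hτ⟩ := hTc k
      classical
      -- Past `T k` the increments are measured from the base point `τ` of the next interval,
      -- corrected so that the value at `T k` is kept.
      refine ⟨fun s => if s ≤ T k then c s else c (T k) + δ τ s - δ τ (T k), ?_, ?_⟩
      · simpa only [if_pos (show (0 : unitInterval) ≤ T k from unitInterval.nonneg')] using hc0
      intro t ht
      rcases lt_trichotomy t (T k) with h1 | h1 | h1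
      · filter_upwards [hc t h1.le, eventually_lt_nhds h1] with s hs hs' _
        simp only [if_pos h1.le, if_pos hs'.le]
        exact hs hs'.le
      · subst h1
        filter_upwards [hc (T k) le_rfl, hU τ (T k) (hτ ⟨le_rfl, ht⟩)] with s hs hs' _
        by_cases h2 : s ≤ T k
        · simp only [if_pos h2, le_refl, if_true]
          exact hs h2
        · simp only [if_neg h2, le_refl, if_true]
          rw [hs']; abel
      · filter_upwards [hU τ t (hτ ⟨h1.le, ht⟩), eventually_gt_nhds h1] with s hs hs' _
        simp only [if_neg h1.not_ge, if_neg hs'.not_ge]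
        rw [hs]; abel
  obtain ⟨c, hc0, hc⟩ := key N
  refine ⟨c, hc0, fun t => ?_⟩
  have h1 : T N = 1 := hN N le_rfl
  rw [h1] at hc
  filter_upwards [hc t unitInterval.le_one'] with s hs using hs unitInterval.le_one'

end Continuation
end
end GaussPolyhedron

namespace GaussPolyhedron
noncomputable section

/-! ### Calculus of analytic continuation along paths -/

section Continuation

variable {E : Type} [NormedAddCommGroup E] [NormedSpace ℂ E]
variable {F : Type} [NormedAddCommGroup F] [NormedSpace ℂ F]
variable {G : Type} [NormedAddCommGroup G] [NormedSpace ℂ G]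

/-- `g` is an analytic continuation along the path `γ`, for functions with values in a normed
space. -/
def IsContinuation (γ : C(unitInterval, E)) (g : unitInterval → E → F) : Prop :=
  (∀ t, AnalyticAt ℂ (g t) (γ t)) ∧ ∀ t, ∀ᶠ s in 𝓝 t, g s =ᶠ[𝓝 (γ s)] g t

/-- The germ of `f` at `z` continues analytically along every path in `N` that starts at `z`. -/
def Continues (N : Set E) (z : E) (f : E → F) : Prop :=
  ∀ γ : C(unitInterval, E), γ 0 = z → (∀ t, γ t ∈ N) →
    ∃ g : unitInterval → E → F, IsContinuation γ g ∧ g 0 =ᶠ[𝓝 z] f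

/-- Agreement of the germs is needed only for `z ∈ N`: no path in `N` starts at a point outside it,
so the conclusion is then vacuous. -/
theorem Continues.congr {N : Set E} {z : E} {f f' : E → F} (h : Continues N z f)
    (hff' : z ∈ N → f =ᶠ[𝓝 z] f') : Continues N z f' := fun γ h0 hγ => by
  obtain ⟨g, hg, hgf⟩ := h γ h0 hγ
  exact ⟨g, hg, hgf.trans (hff' (h0 ▸ hγ 0))⟩

theorem Continues.mono {N N' : Set E} {z : E} {f : E → F} (h : Continues N z f) (hN : N' ⊆ N) :
    Continues N' z f := fun γ h0 hγ => h γ h0 fun t => hN (hγ t)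

theorem AnalyticOnNhd.continues {N : Set E} {z : E} {f : E → F} (h : AnalyticOnNhd ℂ f N) :
    Continues N z f := fun _ _ hγ =>
  ⟨fun _ => f, ⟨fun t => h _ (hγ t), fun _ => Filter.Eventually.of_forall fun _ => .rfl⟩, .rfl⟩

theorem continues_const {N : Set E} {z : E} (c : F) : Continues N z (fun _ : E => c) :=
  AnalyticOnNhd.continues fun _ _ => analyticAt_const

theorem Continues.map {N : Set E} {z : E} {f : E → F} (h : Continues N z f)
    {φ : F → G} (hφ : AnalyticOnNhd ℂ φ Set.univ) : Continues N z (fun x => φ (f x)) :=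
  fun γ h0 hγ => by
  obtain ⟨g, ⟨hg1, hg2⟩, hgf⟩ := h γ h0 hγ
  refine ⟨fun t x => φ (g t x), ⟨fun t => (hφ _ trivial).comp (hg1 t), fun t => ?_⟩, hgf.fun_comp φ⟩
  filter_upwards [hg2 t] with s hs using hs.fun_comp φ

theorem Continues.prodMk {N : Set E} {z : E} {f : E → F} {f' : E → G} (h : Continues N z f)
    (h' : Continues N z f') : Continues N z (fun x => (f x, f' x)) := fun γ h0 hγ => by
  obtain ⟨g, ⟨hg1, hg2⟩, hgf⟩ := h γ h0 hγ
  obtain ⟨g', ⟨hg1', hg2'⟩, hgf'⟩ := h' γ h0 hγ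
  refine ⟨fun t x => (g t x, g' t x), ⟨fun t => (hg1 t).prod (hg1' t), fun t => ?_⟩,
    hgf.prodMk hgf'⟩
  filter_upwards [hg2 t, hg2' t] with s hs hs' using hs.prodMk hs'

theorem Continues.add {N : Set E} {z : E} {f f' : E → F} (h : Continues N z f)
    (h' : Continues N z f') : Continues N z (fun x => f x + f' x) :=
  (h.prodMk h').map (φ := fun y => y.1 + y.2) fun _ _ => analyticAt_fst.add analyticAt_snd

theorem Continues.smul {N : Set E} {z : E} {f : E → ℂ} {f' : E → F} (h : Continues N z f)
    (h' : Continues N z f') : Continues N z (fun x => f x • f' x) :=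
  (h.prodMk h').map (φ := fun y => y.1 • y.2) fun _ _ => analyticAt_fst.smul analyticAt_snd

theorem Continues.mul {N : Set E} {z : E} {f f' : E → ℂ} (h : Continues N z f)
    (h' : Continues N z f') : Continues N z (fun x => f x * f' x) := h.smul h'

theorem Continues.sum {ι : Type*} {N : Set E} {z : E} {f : ι → E → F} (s : Finset ι)
    (h : ∀ i ∈ s, Continues N z (f i)) : Continues N z (fun x => ∑ i ∈ s, f i x) := by
  classical
  induction s using Finset.induction_on with
  | empty => simpa using continues_const (0 : F)
  | insert a s ha ih =>
    simp only [Finset.sum_insert ha]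
    exact (h a (Finset.mem_insert_self _ _)).add
      (ih fun i hi => h i (Finset.mem_insert_of_mem hi))

theorem Continues.cexp {N : Set E} {z : E} {f : E → ℂ} (h : Continues N z f) :
    Continues N z (fun x => Complex.exp (f x)) :=
  h.map fun _ _ => analyticAt_cexp

theorem Continues.comp {N : Set E} {N' : Set F} {z : E} {φ : E → F} {f : F → G}
    (h : Continues N' (φ z) f) (hφ : AnalyticOnNhd ℂ φ N) (hN : Set.MapsTo φ N N') :
    Continues N z (fun x => f (φ x)) := fun γ h0 hγ => by
  have hc : Continuous fun t => φ (γ t) :=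
    continuous_iff_continuousAt.2 fun t =>
      ContinuousAt.comp (hφ _ (hγ t)).continuousAt γ.continuous.continuousAt
  obtain ⟨g, ⟨hg1, hg2⟩, hgf⟩ := h ⟨fun t => φ (γ t), hc⟩ (by simp [h0]) fun t => hN (hγ t)
  refine ⟨fun t x => g t (φ x), ⟨fun t => AnalyticAt.comp (g := g t) (x := γ t) (hg1 t) (hφ _ (hγ t)),
    fun t => ?_⟩, ?_⟩
  · filter_upwards [hg2 t] with s hs
    exact hs.comp_tendsto (hφ _ (hγ s)).continuousAt
  · have : z ∈ N := h0 ▸ hγ 0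
    exact hgf.comp_tendsto (hφ _ this).continuousAt

theorem Continues.fderiv_apply [CompleteSpace F] {N : Set E} {z : E} {f : E → F}
    (h : Continues N z f) (v : E) : Continues N z (fun x => fderiv ℂ f x v) := fun γ h0 hγ => by
  obtain ⟨g, ⟨hg1, hg2⟩, hgf⟩ := h γ h0 hγ
  refine ⟨fun t x => fderiv ℂ (g t) x v, ⟨fun t => ?_, fun t => ?_⟩, ?_⟩
  · exact ((ContinuousLinearMap.apply ℂ F v).analyticAt _).comp (hg1 t).fderiv
  · filter_upwards [hg2 t] with s hs
    exact hs.fderiv.fun_comp fun L => L v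
  · exact hgf.fderiv.fun_comp fun L => L v

/-- Symmetry of the derivative propagates along a continuation. -/
theorem IsContinuation.symmetric [CompleteSpace F] {γ : C(unitInterval, E)}
    {ω : unitInterval → E → E →L[ℂ] F}
    (h : IsContinuation γ ω)
    (h0 : ∀ᶠ x in 𝓝 (γ 0), ∀ u v, fderiv ℂ (ω 0) x u v = fderiv ℂ (ω 0) x v u) (t : unitInterval) :
    ∀ᶠ x in 𝓝 (γ t), ∀ u v, fderiv ℂ (ω t) x u v = fderiv ℂ (ω t) x v u := by
  let S : Set unitInterval :=
    {t | ∀ᶠ x in 𝓝 (γ t), ∀ u v, fderiv ℂ (ω t) x u v = fderiv ℂ (ω t) x v u}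
  -- By the identity theorem on a ball around `γ t`, symmetry near one point of the ball is
  -- equivalent to symmetry on the whole ball. So `S` and its complement are open, and connectedness
  -- of the interval concludes.
  have key : ∀ t, ∀ᶠ s in 𝓝 t, (s ∈ S ↔ t ∈ S) := by
    intro t
    obtain ⟨r, hr, hball⟩ := Metric.eventually_nhds_iff_ball.1
      (h.1 t).eventually_analyticAt
    have h1 : ∀ᶠ s in 𝓝 t, γ s ∈ Metric.ball (γ t) r :=
      γ.continuous.continuousAt.eventually (Metric.ball_mem_nhds _ hr)
    filter_upwards [h.2 t, h1] with s hs hsr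
    have h2 : s ∈ S ↔ ∀ᶠ x in 𝓝 (γ s), ∀ u v, fderiv ℂ (ω t) x u v = fderiv ℂ (ω t) x v u := by
      refine Filter.eventually_congr ?_
      have h3 : fderiv ℂ (ω s) =ᶠ[𝓝 (γ s)] fderiv ℂ (ω t) := hs.fderiv
      filter_upwards [h3] with x hx
      rw [hx]
    rw [h2]
    have han : ∀ u v, AnalyticOnNhd ℂ (fun x => fderiv ℂ (ω t) x u v) (Metric.ball (γ t) r) := by
      intro u v x hx
      have h3 := (hball x hx).fderiv
      have h4 := ((ContinuousLinearMap.apply ℂ (E →L[ℂ] F) u).analyticAt _).comp h3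
      exact ((ContinuousLinearMap.apply ℂ F v).analyticAt _).comp h4
    have hiff : ∀ y ∈ Metric.ball (γ t) r,
        (∀ᶠ x in 𝓝 y, ∀ u v, fderiv ℂ (ω t) x u v = fderiv ℂ (ω t) x v u) ↔
        ∀ x ∈ Metric.ball (γ t) r, ∀ u v, fderiv ℂ (ω t) x u v = fderiv ℂ (ω t) x v u := by
      intro y hy
      constructor
      · intro hy' x hx u v
        refine (han u v).eqOn_of_preconnected_of_eventuallyEq (han v u)
          (convex_ball _ _).isPreconnected hy ?_ hx
        filter_upwards [hy'] with x hx using hx u v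
      · intro hall
        filter_upwards [Metric.isOpen_ball.mem_nhds hy] with x hx using hall x hx
    rw [hiff _ hsr]
    exact (hiff _ (Metric.mem_ball_self hr)).symm
  have hclopen : IsClopen S := by
    constructor
    · rw [← isOpen_compl_iff, isOpen_iff_mem_nhds]
      intro t ht
      filter_upwards [key t] with s hs
      exact fun h => ht (hs.1 h)
    · rw [isOpen_iff_mem_nhds]
      intro t ht
      filter_upwards [key t] with s hs using hs.2 ht
  have := hclopen.eq_univ ⟨0, h0⟩
  exact (this ▸ Set.mem_univ t : t ∈ S)

theorem eventuallyEq_add_const_of_hasFDerivAt {f g : E → F} {f' g' : E → E →L[ℂ] F} {x : E}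
    (hf : ∀ᶠ y in 𝓝 x, HasFDerivAt f (f' y) y) (hg : ∀ᶠ y in 𝓝 x, HasFDerivAt g (g' y) y)
    (h : f' =ᶠ[𝓝 x] g') : f =ᶠ[𝓝 x] fun y => g y + (f x - g x) := by
  obtain ⟨ρ, hρ, hball⟩ := Metric.eventually_nhds_iff_ball.1 (hf.and (hg.and h))
  let : NormedSpace ℝ E := NormedSpace.restrictScalars ℝ ℂ E
  have h2 : ∀ y ∈ Metric.ball x ρ, HasFDerivAt (fun x => f x - g x) (0 : E →L[ℂ] F) y := by
    intro y hy
    obtain ⟨a1, a2, a3⟩ := hball y hy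
    have := a1.sub a2
    rwa [a3, sub_self] at this
  filter_upwards [Metric.ball_mem_nhds x hρ] with y hy
  have h3 := (convex_ball x ρ).is_const_of_fderivWithin_eq_zero (𝕜 := ℂ)
    (f := fun x => f x - g x)
    (fun y hy => (h2 y hy).differentiableAt.differentiableWithinAt)
    (fun y hy => by
      rw [fderivWithin_of_isOpen Metric.isOpen_ball hy]; exact (h2 y hy).fderiv) hy
    (Metric.mem_ball_self hρ)
  rw [← h3]; abel

/-- If the derivative of a germ continues along every path, so does the germ. -/
theorem Continues.of_fderiv [CompleteSpace F] {N : Set E} {z : E} {f : E → F}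
    {ω : E → E →L[ℂ] F} (hω : Continues N z ω) (hf : z ∈ N → AnalyticAt ℂ f z)
    (hfω : z ∈ N → fderiv ℂ f =ᶠ[𝓝 z] ω) :
    Continues N z f := fun γ h0 hγ => by
  have hz : z ∈ N := h0 ▸ hγ 0
  specialize hf hz
  specialize hfω hz
  obtain ⟨w, hw, hwω⟩ := hω γ h0 hγ
  subst h0
  have hsymm := hw.symmetric (by
    have h1 : w 0 =ᶠ[𝓝 (γ 0)] fderiv ℂ f := hwω.trans hfω.symm
    have h2 : fderiv ℂ (w 0) =ᶠ[𝓝 (γ 0)] fderiv ℂ (fderiv ℂ f) := h1.fderiv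
    filter_upwards [h2, hf.eventually_analyticAt] with x hx hx' u v
    rw [hx]
    have h2 : IsSymmSndFDerivAt ℂ f x :=
      (hx'.contDiffAt (n := ⊤)).isSymmSndFDerivAt (by simp)
    exact h2 u v)
  -- Symmetry of the derivative says that the continued 1-form is closed, so the Poincaré lemma on a
  -- ball gives a primitive, normalized to vanish at the centre.
  have hprim : ∀ t, ∃ r > 0, ∃ P : E → F, P (γ t) = 0 ∧
      (∀ x ∈ Metric.ball (γ t) r, HasFDerivAt P (w t x) x) ∧
      ∀ x ∈ Metric.ball (γ t) r, AnalyticAt ℂ (w t) x := by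
    intro t
    obtain ⟨r, hr, hball⟩ := Metric.eventually_nhds_iff_ball.1
      ((hw.1 t).eventually_analyticAt.and (hsymm t))
    let : NormedSpace ℝ E := NormedSpace.restrictScalars ℝ ℂ E
    let : NormedSpace ℝ F := NormedSpace.restrictScalars ℝ ℂ F
    obtain ⟨P, hP⟩ := (convex_ball (γ t) r).exists_forall_hasFDerivAt_of_fderiv_symmetric
      Metric.isOpen_ball (ω := w t)
      (fun x hx => ((hball x hx).1.differentiableAt.restrictScalars ℝ).differentiableWithinAt)
      (fun x hx u v => by
        have := (hball x hx).1.differentiableAt.hasFDerivAt.restrictScalars ℝ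
        rw [this.fderiv]
        exact (hball x hx).2 u v)
    refine ⟨r, hr, fun x => P x - P (γ t), sub_self _, fun x hx => ?_, fun x hx => (hball x hx).1⟩
    exact (hP x hx).sub_const _
  choose r hr P hP0 hPd hwan using hprim
  have hPan : ∀ t, ∀ x ∈ Metric.ball (γ t) (r t), AnalyticAt ℂ (P t) x := by
    intro t x hx
    refine analyticAt_of_hasFDerivAt (hwan t x hx) ?_
    filter_upwards [Metric.isOpen_ball.mem_nhds hx] with y hy using hPd t y hy
  have hball : ∀ t, ∀ᶠ x in 𝓝 (γ t), HasFDerivAt (P t) (w t x) x := fun t =>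
    (Metric.isOpen_ball.eventually_mem (Metric.mem_ball_self (hr t))).mono (hPd t)
  -- Two primitives of the same form differ by a constant, determined here by the normalization at
  -- `γ s`.
  have hnear : ∀ t, ∀ᶠ s in 𝓝 t, P s =ᶠ[𝓝 (γ s)] fun x => P t x - P t (γ s) := by
    intro t
    have h1 : ∀ᶠ s in 𝓝 t, γ s ∈ Metric.ball (γ t) (r t) :=
      γ.continuous.continuousAt.eventually (Metric.ball_mem_nhds _ (hr t))
    filter_upwards [h1, hw.2 t] with s hs hs'
    have h2 := eventuallyEq_add_const_of_hasFDerivAt (hball s) ((Metric.isOpen_ball.eventually_mem hs).mono (hPd t)) hs'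
    filter_upwards [h2] with x hx
    rw [hx, hP0]; abel
  -- The increments `P t (γ s)` form a cocycle by `hnear`. The resulting constants turn the
  -- normalized primitives into one continuation, starting from the value of `f`.
  obtain ⟨c, hc0, hc⟩ := exists_of_local_increments (fun t s => P t (γ s)) (by
    intro t
    filter_upwards [hnear t] with s hs
    exact γ.continuous.continuousAt.eventually hs) (f (γ 0))
  refine ⟨fun t x => P t x + c t, ⟨fun t => ?_, fun t => ?_⟩, ?_⟩
  · exact (hPan t _ (Metric.mem_ball_self (hr t))).add analyticAt_const
  · filter_upwards [hnear t, hc t] with s hs hcs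
    filter_upwards [hs] with x hx
    rw [hx, hcs]; abel
  · have h2 := eventuallyEq_add_const_of_hasFDerivAt (hball 0)
      (hf.eventually_analyticAt.mono fun x hx => hx.differentiableAt.hasFDerivAt)
      (hwω.trans hfω.symm)
    filter_upwards [h2] with x hx
    rw [hx, hP0, hc0]; abel

end Continuation
end
end GaussPolyhedron

namespace GaussPolyhedron
noncomputable section

/-! ### Analyticity and differentiation of integrals of exponentials -/

section ExponentialIntegral

open MeasureTheory

variable {E : Type} [NormedAddCommGroup E] [NormedSpace ℂ E]
variable {α : Type} [MeasurableSpace α] {μ : Measure α}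

/-- The `n`-th power of a linear form as a multilinear map. -/
def powForm (n : ℕ) (L : E →L[ℂ] ℂ) : ContinuousMultilinearMap ℂ (fun _ : Fin n => E) ℂ :=
  (ContinuousMultilinearMap.mkPiAlgebraFin ℂ n ℂ).compContinuousLinearMap fun _ => L

theorem powForm_apply (n : ℕ) (L : E →L[ℂ] ℂ) (v : E) : powForm n L (fun _ => v) = L v ^ n := by
  simp [powForm]

theorem norm_powForm_le (n : ℕ) (L : E →L[ℂ] ℂ) : ‖powForm n L‖ ≤ ‖L‖ ^ n := by
  refine (ContinuousMultilinearMap.norm_compContinuousLinearMap_le _ _).trans ?_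
  simp

theorem continuous_powForm (n : ℕ) : Continuous (powForm (E := E) n) := by
  have h := (ContinuousMultilinearMap.compContinuousLinearMapContinuousMultilinear ℂ
    (fun _ : Fin n => E) (fun _ => ℂ) ℂ).cont
  have h2 : Continuous fun L : E →L[ℂ] ℂ => (fun _ : Fin n => L) := by fun_prop
  exact (h.comp h2).clm_apply continuous_const

theorem norm_cexp_mul_pow_le (z : ℂ) (a r : ℝ) (ha : 0 ≤ a) (hr : 0 < r) (n : ℕ) :
    ‖Complex.exp z * ((n.factorial : ℂ)⁻¹)‖ * a ^ n * r ^ n ≤ Real.exp (z.re + r * a) := by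
  rw [norm_mul, Complex.norm_exp, norm_inv, Complex.norm_natCast, Real.exp_add]
  have := Real.pow_div_factorial_le_exp (x := r * a) (by positivity) n
  calc _ = Real.exp z.re * ((r * a) ^ n / n.factorial) := by rw [mul_pow]; ring
    _ ≤ _ := by gcongr

/-- An integral of exponentials of linear forms is analytic where it converges well. -/
theorem analyticAt_integral_cexp (ℓ : α → E →L[ℂ] ℂ) (hℓ : AEStronglyMeasurable ℓ μ) (q : E)
    {r : ℝ} (hr : 0 < r) (h : Integrable (fun y => Real.exp ((ℓ y q).re + r * ‖ℓ y‖)) μ) :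
    AnalyticAt ℂ (fun q => ∫ y, Complex.exp (ℓ y q) ∂μ) q := by
  have hℓv : ∀ v, AEStronglyMeasurable (fun y => ℓ y v) μ := fun v =>
    (ContinuousLinearMap.apply ℂ ℂ v).continuous.comp_aestronglyMeasurable hℓ
  let T : (n : ℕ) → α → ContinuousMultilinearMap ℂ (fun _ : Fin n => E) ℂ := fun n y =>
    (Complex.exp (ℓ y q) * ((n.factorial : ℂ)⁻¹)) • powForm n (ℓ y)
  have hTm : ∀ n, AEStronglyMeasurable (T n) μ := fun n =>
    ((Complex.continuous_exp.comp_aestronglyMeasurable (hℓv q)).mul_const _).smul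
      ((continuous_powForm n).comp_aestronglyMeasurable hℓ)
  -- A single term `(r ‖ℓ‖)ⁿ / n!` is at most `exp (r ‖ℓ‖)`, so the assumed integrability bounds all
  -- Taylor coefficients at once.
  have hTb : ∀ n y, ‖T n y‖ * r ^ n ≤ Real.exp ((ℓ y q).re + r * ‖ℓ y‖) := by
    intro n y
    refine le_trans ?_ (norm_cexp_mul_pow_le (ℓ y q) ‖ℓ y‖ r (norm_nonneg _) hr n)
    rw [norm_smul]
    have := norm_powForm_le n (ℓ y)
    gcongr
  have hTi : ∀ n, Integrable (T n) μ := by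
    intro n
    refine Integrable.mono' (h.mul_const ((r ^ n)⁻¹)) (hTm n) ?_
    filter_upwards with y
    rw [← div_eq_mul_inv, le_div_iff₀ (by positivity)]
    exact hTb n y
  let P : FormalMultilinearSeries ℂ E ℂ := fun n => ∫ y, T n y ∂μ
  have hrad : ENNReal.ofReal r ≤ P.radius := by
    refine FormalMultilinearSeries.le_radius_of_bound P
      (∫ y, Real.exp ((ℓ y q).re + r * ‖ℓ y‖) ∂μ) fun n => ?_
    have h1 : ‖P n‖ ≤ ∫ y, ‖T n y‖ ∂μ := norm_integral_le_integral_norm _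
    rw [Real.coe_toNNReal _ hr.le]
    calc ‖P n‖ * r ^ n ≤ (∫ y, ‖T n y‖ ∂μ) * r ^ n := by gcongr
      _ = ∫ y, ‖T n y‖ * r ^ n ∂μ := (integral_mul_const _ _).symm
      _ ≤ _ := integral_mono ((hTi n).norm.mul_const _) h (hTb n)
  refine ⟨P, ENNReal.ofReal r, hrad, by simpa using hr, fun {v} hv => ?_⟩
  have hv' : ‖v‖ < r := by
    rw [Metric.mem_eball, edist_zero_right, ← ofReal_norm] at hv
    exact (ENNReal.ofReal_lt_ofReal_iff hr).1 hv
  have hPv : ∀ n, P n (fun _ => v)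
      = ∫ y, Complex.exp (ℓ y q) * ((ℓ y v) ^ n * (n.factorial : ℂ)⁻¹) ∂μ := by
    intro n
    have := (ContinuousMultilinearMap.apply ℂ (fun _ : Fin n => E) ℂ
      (fun _ => v)).integral_comp_comm (hTi n)
    refine this.symm.trans (integral_congr_ae ?_)
    filter_upwards with y
    change (Complex.exp (ℓ y q) * ((n.factorial : ℂ)⁻¹)) * powForm n (ℓ y) (fun _ => v) = _
    rw [powForm_apply]; ring
  simp only [hPv]
  have hlv : ∀ y, ‖ℓ y v‖ ≤ r * ‖ℓ y‖ := fun y => by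
    refine ((ℓ y).le_opNorm v).trans ?_
    rw [mul_comm]; gcongr
  have hexp : ∀ z : ℂ, HasSum (fun n : ℕ => z ^ n * (n.factorial : ℂ)⁻¹) (Complex.exp z) := by
    intro z
    have := NormedSpace.expSeries_div_hasSum_exp z
    rw [← Complex.exp_eq_exp_ℂ] at this
    simpa [div_eq_mul_inv] using this
  have hexpr : ∀ z : ℝ, HasSum (fun n : ℕ => z ^ n * (n.factorial : ℝ)⁻¹) (Real.exp z) := by
    intro z
    have := NormedSpace.expSeries_div_hasSum_exp z
    rw [← Real.exp_eq_exp_ℝ] at this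
    simpa [div_eq_mul_inv] using this
  refine hasSum_integral_of_dominated_convergence
    (fun n y => Real.exp (ℓ y q).re * ((r * ‖ℓ y‖) ^ n * (n.factorial : ℝ)⁻¹)) ?_ ?_ ?_ ?_ ?_
  · intro n
    exact (Complex.continuous_exp.comp_aestronglyMeasurable (hℓv q)).mul
      (((hℓv v).pow n).mul_const _)
  · intro n
    filter_upwards with y
    rw [norm_mul, Complex.norm_exp, norm_mul, norm_pow, norm_inv, Complex.norm_natCast]
    have := hlv y
    gcongr
  · filter_upwards with y
    exact ((hexpr _).mul_left _).summable
  · refine h.congr ?_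
    filter_upwards with y
    rw [((hexpr _).mul_left _).tsum_eq, Real.exp_add]
  · filter_upwards with y
    rw [map_add, Complex.exp_add]
    exact (hexp _).mul_left _

/-- Differentiation under the integral sign for exponentials of linear forms. -/
theorem hasFDerivAt_integral_mul_cexp (ℓ : α → E →L[ℂ] ℂ) (hℓ : AEStronglyMeasurable ℓ μ)
    (w : α → ℂ) (hw : AEStronglyMeasurable w μ) (q : E) {r : ℝ} (hr : 0 < r)
    (h : Integrable (fun y => ‖w y‖ * Real.exp ((ℓ y q).re + r * ‖ℓ y‖)) μ) :
    HasFDerivAt (fun q => ∫ y, w y * Complex.exp (ℓ y q) ∂μ)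
      (∫ y, (w y * Complex.exp (ℓ y q)) • ℓ y ∂μ) q ∧
      Integrable (fun y => (w y * Complex.exp (ℓ y q)) • ℓ y) μ := by
  have hℓv : ∀ v, AEStronglyMeasurable (fun y => ℓ y v) μ := fun v =>
    (ContinuousLinearMap.apply ℂ ℂ v).continuous.comp_aestronglyMeasurable hℓ
  have hm : ∀ v, AEStronglyMeasurable (fun y => w y * Complex.exp (ℓ y v)) μ := fun v =>
    hw.mul (Complex.continuous_exp.comp_aestronglyMeasurable (hℓv v))
  -- Half of the exponent `r ‖ℓ y‖` pays for moving from `q` to `x`, the other half for the factor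
  -- `‖ℓ y‖` produced by differentiation.
  have hbd : ∀ y, ∀ x ∈ Metric.ball q (r / 2), ‖(w y * Complex.exp (ℓ y x)) • ℓ y‖ ≤
      (2 / r) * (‖w y‖ * Real.exp ((ℓ y q).re + r * ‖ℓ y‖)) := by
    intro y x hx
    rw [norm_smul, norm_mul, Complex.norm_exp]
    have h1 : (ℓ y x).re ≤ (ℓ y q).re + r / 2 * ‖ℓ y‖ := by
      have h2 : (ℓ y x).re - (ℓ y q).re ≤ ‖ℓ y (x - q)‖ := by
        rw [map_sub, ← Complex.sub_re]; exact Complex.re_le_norm _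
      have h3 := (ℓ y).le_opNorm (x - q)
      have h4 : ‖x - q‖ ≤ r / 2 := by
        rw [← dist_eq_norm]; exact (Metric.mem_ball.1 hx).le
      nlinarith [norm_nonneg (ℓ y)]
    have h5 : ‖ℓ y‖ ≤ 2 / r * Real.exp (r / 2 * ‖ℓ y‖) := by
      have := Real.add_one_le_exp (r / 2 * ‖ℓ y‖)
      rw [div_mul_eq_mul_div, le_div_iff₀ hr]
      linarith
    calc ‖w y‖ * Real.exp (ℓ y x).re * ‖ℓ y‖
        ≤ ‖w y‖ * Real.exp ((ℓ y q).re + r / 2 * ‖ℓ y‖) *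
          (2 / r * Real.exp (r / 2 * ‖ℓ y‖)) := by gcongr
      _ = 2 / r * (‖w y‖ * (Real.exp ((ℓ y q).re + r / 2 * ‖ℓ y‖) *
          Real.exp (r / 2 * ‖ℓ y‖))) := by ring
      _ = _ := by rw [← Real.exp_add]; congr 3; ring
  have hm' : AEStronglyMeasurable (fun y => (w y * Complex.exp (ℓ y q)) • ℓ y) μ :=
    (hm q).smul hℓ
  refine ⟨hasFDerivAt_integral_of_dominated_of_fderiv_le
    (F' := fun x y => (w y * Complex.exp (ℓ y x)) • ℓ y)
    (bound := fun y => (2 / r) * (‖w y‖ * Real.exp ((ℓ y q).re + r * ‖ℓ y‖)))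
    (Metric.ball_mem_nhds q (half_pos hr)) (Filter.Eventually.of_forall hm) ?_ hm' ?_
    (h.const_mul _) ?_, ?_⟩
  · refine h.mono' (hm q) ?_
    filter_upwards with y
    rw [norm_mul, Complex.norm_exp]
    gcongr
    have := norm_nonneg (ℓ y)
    nlinarith
  · filter_upwards with y x hx using hbd y x hx
  · filter_upwards with y x hx
    have h1 := ((ℓ y).hasFDerivAt (x := x)).cexp.const_mul (w y)
    rw [smul_smul] at h1
    exact h1
  · refine (h.const_mul (2 / r)).mono' hm' ?_
    filter_upwards with y
    exact hbd y q (Metric.mem_ball_self (half_pos hr))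

end ExponentialIntegral
end
end GaussPolyhedron

namespace GaussPolyhedron
noncomputable section

/-! ### Moments of quadratic exponentials and the heat equation -/

section QuadraticExponential

open MeasureTheory

variable {m : ℕ}

/-- For `q = (β, c)` the value `phase y q` is `∑ c i y i - ½ ∑ β i j y i y j`, as a linear form
in `q`. -/
def phase (y : Fin m → ℝ) : Params ℂ m m →L[ℂ] ℂ :=
  ∑ i, (y i : ℂ) • ((ContinuousLinearMap.proj i).comp (ContinuousLinearMap.snd ℂ _ _)) +
  ∑ i, ∑ j, (-(1 / 2) * (y i * y j) : ℂ) • ((ContinuousLinearMap.proj j).comp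
    ((ContinuousLinearMap.proj i).comp (ContinuousLinearMap.fst ℂ (Fin m → Fin m → ℂ) _)))

theorem phase_apply (y : Fin m → ℝ) (q : Params ℂ m m) :
    phase y q = ∑ i, y i * q.2 i + ∑ i, ∑ j, (-(1 / 2) * (y i * y j) : ℂ) * q.1 i j := by
  simp [phase]

theorem continuous_phase : Continuous (phase (m := m)) := by
  unfold phase
  fun_prop

/-- The parameters for which the real part of the quadratic form is positive definite. -/
def posDomain (m : ℕ) : Set (Params ℂ m m) :=
  {q | ∃ δ > 0, ∀ y : Fin m → ℝ, δ * ∑ i, y i ^ 2 ≤ ∑ i, ∑ j, (q.1 i j).re * (y i * y j)}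

theorem sq_sum_abs_le (y : Fin m → ℝ) : (∑ i, |y i|) ^ 2 ≤ m * ∑ i, y i ^ 2 := by
  have := sq_sum_le_card_mul_sum_sq (s := Finset.univ) (f := fun i => |y i|)
  simpa using this

theorem sum_sum_abs (y : Fin m → ℝ) : ∑ i, ∑ j, |y i| * |y j| = (∑ i, |y i|) ^ 2 := by
  rw [sq, Finset.sum_mul_sum]

theorem norm_phase_le (y : Fin m → ℝ) : ‖phase y‖ ≤ ∑ i, |y i| + m / 2 * ∑ i, y i ^ 2 := by
  refine ContinuousLinearMap.opNorm_le_bound _ (by positivity) fun q => ?_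
  have h1 : ∀ i, ‖q.2 i‖ ≤ ‖q‖ := fun i => (norm_le_pi_norm _ _).trans (norm_snd_le q)
  have h2 : ∀ i j, ‖q.1 i j‖ ≤ ‖q‖ := fun i j =>
    (norm_le_pi_norm _ _).trans ((norm_le_pi_norm _ _).trans (norm_fst_le q))
  rw [phase_apply, add_mul]
  refine (norm_add_le _ _).trans (add_le_add ?_ ?_)
  · rw [Finset.sum_mul]
    refine norm_sum_le_of_le _ fun i _ => ?_
    rw [norm_mul, Complex.norm_real, Real.norm_eq_abs]
    gcongr
    exact h1 i
  · calc ‖∑ i, ∑ j, (-(1 / 2) * (y i * y j) : ℂ) * q.1 i j‖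
        ≤ ∑ i, ∑ j, 1 / 2 * (|y i| * |y j|) * ‖q‖ := by
          refine norm_sum_le_of_le _ fun i _ => norm_sum_le_of_le _ fun j _ => ?_
          rw [norm_mul, norm_mul, norm_mul, Complex.norm_real, Complex.norm_real,
            Real.norm_eq_abs, Real.norm_eq_abs]
          have := h2 i j
          rw [norm_neg, norm_div, norm_one, Complex.norm_ofNat]
          gcongr
      _ = 1 / 2 * (∑ i, |y i|) ^ 2 * ‖q‖ := by
          rw [← sum_sum_abs]; simp only [Finset.mul_sum, Finset.sum_mul]
      _ ≤ _ := by
          have := sq_sum_abs_le y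
          refine mul_le_mul_of_nonneg_right ?_ (norm_nonneg _)
          linarith

theorem re_phase_le {q : Params ℂ m m} {δ : ℝ}
    (hδ : ∀ y : Fin m → ℝ, δ * ∑ i, y i ^ 2 ≤ ∑ i, ∑ j, (q.1 i j).re * (y i * y j))
    (y : Fin m → ℝ) : (phase y q).re ≤ ‖q‖ * ∑ i, |y i| - δ / 2 * ∑ i, y i ^ 2 := by
  rw [phase_apply, Complex.add_re, sub_eq_add_neg]
  refine add_le_add ?_ ?_
  · rw [Complex.re_sum, Finset.mul_sum]
    refine Finset.sum_le_sum fun i _ => ?_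
    rw [Complex.re_ofReal_mul]
    refine (le_abs_self _).trans ?_
    rw [abs_mul, mul_comm]
    gcongr
    exact (Complex.abs_re_le_norm _).trans ((norm_le_pi_norm _ _).trans (norm_snd_le q))
  · have h := hδ y
    have h2 : (∑ i, ∑ j, (-(1 / 2) * (y i * y j) : ℂ) * q.1 i j).re
        = -(1 / 2) * ∑ i, ∑ j, (q.1 i j).re * (y i * y j) := by
      rw [Complex.re_sum, Finset.mul_sum]
      refine Finset.sum_congr rfl fun i _ => ?_
      rw [Complex.re_sum, Finset.mul_sum]
      refine Finset.sum_congr rfl fun j _ => ?_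
      rw [show (-(1 / 2) * (y i * y j) : ℂ) = ((-(1 / 2) * (y i * y j) : ℝ) : ℂ) by push_cast; ring,
        Complex.re_ofReal_mul]
      ring
    rw [h2]; linarith

theorem integrable_exp_neg_sq_add_abs {a : ℝ} (ha : 0 < a) (K : ℝ) :
    Integrable fun y : ℝ => Real.exp (K * |y| - a * y ^ 2) := by
  have h1 : Integrable fun y : ℝ => Real.exp (K ^ 2 / (2 * a)) * Real.exp (-(a / 2) * y ^ 2) :=
    (integrable_exp_neg_mul_sq (half_pos ha)).const_mul _
  refine h1.mono' (by fun_prop) ?_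
  filter_upwards with y
  rw [Real.norm_eq_abs, Real.abs_exp, ← Real.exp_add, Real.exp_le_exp]
  have h2 : 0 ≤ (K - a * |y|) ^ 2 / (2 * a) := by positivity
  have h3 : (K - a * |y|) ^ 2 / (2 * a) = K ^ 2 / (2 * a) - K * |y| + a / 2 * |y| ^ 2 := by
    field_simp; ring
  rw [h3, sq_abs] at h2
  linarith

theorem integrable_exp_sum_abs_sub_sum_sq {a : ℝ} (ha : 0 < a) (K : ℝ) :
    Integrable fun y : Fin m → ℝ => Real.exp (K * ∑ i, |y i| - a * ∑ i, y i ^ 2) := by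
  have := Integrable.fintype_prod (ι := Fin m) (𝕜 := ℝ) (f := fun _ y =>
    Real.exp (K * |y| - a * y ^ 2)) (μ := fun _ => volume)
    fun _ => integrable_exp_neg_sq_add_abs ha K
  refine this.congr (Filter.Eventually.of_forall fun y => ?_)
  simp only
  rw [← Real.exp_sum, Finset.sum_sub_distrib, Finset.mul_sum, Finset.mul_sum]

/-- The margin `r ‖phase y‖`, which the two theorems on exponential integrals require, grows
quadratically in `y`. It must be paid for by the Gaussian decay. -/
theorem exists_integrable_phase {q : Params ℂ m m} (hq : q ∈ posDomain m) {w : (Fin m → ℝ) → ℂ}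
    (hw : Continuous w) {s : ℝ} (hws : ∀ y, ‖w y‖ ≤ Real.exp (s * ∑ i, |y i|)) :
    ∃ r > 0, Integrable fun y : Fin m → ℝ => ‖w y‖ * Real.exp ((phase y q).re + r * ‖phase y‖) := by
  obtain ⟨δ, hδ, hq⟩ := hq
  -- With this `r` the quadratic part of `r ‖phase y‖` takes at most `δ / 4` of the decay rate `δ /
  -- 2`.
  refine ⟨δ / (2 * (m + 1)), by positivity, ?_⟩
  set r := δ / (2 * (m + 1)) with hr
  have hr0 : 0 < r := by positivity
  refine (integrable_exp_sum_abs_sub_sum_sq (a := δ / 4) (by positivity)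
    (s + ‖q‖ + r)).mono' ?_ ?_
  · refine (hw.norm.mul (Real.continuous_exp.comp ((Complex.continuous_re.comp ?_).add
      (continuous_const.mul continuous_phase.norm)))).aestronglyMeasurable
    exact continuous_phase.clm_apply continuous_const
  · filter_upwards with y
    rw [Real.norm_eq_abs, abs_of_nonneg (by positivity)]
    refine (mul_le_mul_of_nonneg_right (hws y) (Real.exp_pos _).le).trans ?_
    rw [← Real.exp_add, Real.exp_le_exp]
    have h1 := re_phase_le hq y
    have h2 := mul_le_mul_of_nonneg_left (norm_phase_le y) hr0.le
    have h3 : r * (m / 2) ≤ δ / 4 := by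
      rw [hr, div_mul_div_comm, div_le_div_iff₀ (by positivity) (by positivity)]
      nlinarith
    have h4 : 0 ≤ ∑ i, y i ^ 2 := by positivity
    nlinarith

theorem isOpen_posDomain : IsOpen (posDomain m) := by
  rw [Metric.isOpen_iff]
  rintro q ⟨δ, hδ, hq⟩
  -- By Cauchy-Schwarz, changing each entry by at most `δ / (2 (m + 1))` changes the form by at most
  -- `δ / 2` times the sum of squares.
  refine ⟨δ / (2 * (m + 1)), by positivity, fun q' hq' => ⟨δ / 2, by positivity, fun y => ?_⟩⟩
  have h1 : ∀ i j, |(q.1 i j).re - (q'.1 i j).re| ≤ δ / (2 * (m + 1)) := by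
    intro i j
    rw [← Complex.sub_re]
    refine (Complex.abs_re_le_norm _).trans ?_
    rw [mem_ball_iff_norm', ] at hq'
    exact ((norm_le_pi_norm ((q - q').1 i) j).trans ((norm_le_pi_norm (q - q').1 i).trans
      (norm_fst_le (q - q')))).trans hq'.le
  have h2 : ∑ i, ∑ j, (q.1 i j).re * (y i * y j) - ∑ i, ∑ j, (q'.1 i j).re * (y i * y j)
      ≤ ∑ i, ∑ j, δ / (2 * (m + 1)) * (|y i| * |y j|) := by
    rw [← Finset.sum_sub_distrib]
    refine Finset.sum_le_sum fun i _ => ?_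
    rw [← Finset.sum_sub_distrib]
    refine Finset.sum_le_sum fun j _ => ?_
    rw [← sub_mul]
    refine (le_abs_self _).trans ?_
    rw [abs_mul, abs_mul]
    gcongr
    exact h1 i j
  simp only [← Finset.mul_sum] at h2
  simp only [← Finset.sum_mul] at h2
  rw [← sq] at h2
  have h3 := sq_sum_abs_le y
  have h4 := hq y
  have h5 : δ / (2 * (m + 1)) * (∑ i, |y i|) ^ 2 ≤ δ / 2 * ∑ i, y i ^ 2 := by
    calc _ ≤ δ / (2 * (m + 1)) * ((m + 1) * ∑ i, y i ^ 2) := by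
          have : 0 ≤ ∑ i, y i ^ 2 := by positivity
          gcongr; linarith
      _ = _ := by field_simp
  linarith

/-- The integral of `w` against the quadratic exponential with parameter `q` over `D`. -/
def moment (D : Set (Fin m → ℝ)) (w : (Fin m → ℝ) → ℂ) (q : Params ℂ m m) : ℂ :=
  ∫ y in D, w y * Complex.exp (phase y q)

/-- Weights of at most exponential growth. -/
def IsWeight (w : (Fin m → ℝ) → ℂ) : Prop :=
  Continuous w ∧ ∃ s : ℝ, ∀ y, ‖w y‖ ≤ Real.exp (s * ∑ i, |y i|)

theorem isWeight_one : IsWeight (fun _ : Fin m → ℝ => (1 : ℂ)) :=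
  ⟨continuous_const, 0, fun y => by simp⟩

theorem IsWeight.mul_coord {w : (Fin m → ℝ) → ℂ} (hw : IsWeight w) (i : Fin m) :
    IsWeight fun y => w y * y i := by
  obtain ⟨h1, s, h2⟩ := hw
  refine ⟨by fun_prop, s + 1, fun y => ?_⟩
  rw [norm_mul, Complex.norm_real, Real.norm_eq_abs, add_mul, Real.exp_add, one_mul]
  have h3 : |y i| ≤ Real.exp (∑ i, |y i|) := by
    have h4 : |y i| ≤ ∑ i, |y i| :=
      Finset.single_le_sum (f := fun i => |y i|) (fun _ _ => abs_nonneg _) (Finset.mem_univ i)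
    linarith [Real.add_one_le_exp (∑ i, |y i|)]
  have := h2 y
  gcongr

theorem integrable_weight_mul_cexp {q : Params ℂ m m} (hq : q ∈ posDomain m)
    {w : (Fin m → ℝ) → ℂ} (hw : IsWeight w) :
    Integrable fun y => w y * Complex.exp (phase y q) := by
  obtain ⟨h1, s, h2⟩ := hw
  obtain ⟨r, hr, h⟩ := exists_integrable_phase hq h1 h2
  have : Continuous fun y : Fin m → ℝ => phase y q := continuous_phase.clm_apply continuous_const
  refine h.mono' (by fun_prop) ?_
  filter_upwards with y
  rw [norm_mul, Complex.norm_exp]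
  gcongr
  have := norm_nonneg (phase y)
  nlinarith

theorem fderiv_moment {q : Params ℂ m m} (hq : q ∈ posDomain m) (D : Set (Fin m → ℝ))
    {w : (Fin m → ℝ) → ℂ} (hw : IsWeight w) :
    DifferentiableAt ℂ (moment D w) q ∧
      ∀ v, fderiv ℂ (moment D w) q v = moment D (fun y => w y * phase y v) q := by
  obtain ⟨h1, s, h2⟩ := hw
  obtain ⟨r, hr, h⟩ := exists_integrable_phase hq h1 h2
  obtain ⟨h3, h4⟩ := hasFDerivAt_integral_mul_cexp (μ := volume.restrict D) phase
    continuous_phase.aestronglyMeasurable w h1.aestronglyMeasurable q hr h.integrableOn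
  refine ⟨h3.differentiableAt, fun v => ?_⟩
  have h5 := h3.fderiv
  change fderiv ℂ (moment D w) q = _ at h5
  rw [h5]
  have h6 := (ContinuousLinearMap.apply ℂ ℂ v).integral_comp_comm h4
  refine h6.symm.trans (integral_congr_ae ?_)
  filter_upwards with y
  simp only [ContinuousLinearMap.apply_apply, smul_apply, smul_eq_mul]
  ring

theorem analyticAt_moment {q : Params ℂ m m} (hq : q ∈ posDomain m) (D : Set (Fin m → ℝ)) :
    AnalyticAt ℂ (moment D fun _ => 1) q := by
  obtain ⟨h1, s, h2⟩ := isWeight_one (m := m)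
  obtain ⟨r, hr, h⟩ := exists_integrable_phase hq h1 h2
  have h3 := analyticAt_integral_cexp (μ := volume.restrict D) phase
    continuous_phase.aestronglyMeasurable q hr
    (by simpa using h.restrict (s := D))
  unfold moment
  simpa using h3

/-- The direction of the parameter `c i`. -/
def dirC (i : Fin m) : Params ℂ m m := (0, Pi.single i 1)

/-- The direction of the parameter `β i j`. -/
def dirB (i j : Fin m) : Params ℂ m m := (Pi.single i (Pi.single j 1), 0)

theorem phase_dirC (y : Fin m → ℝ) (i : Fin m) : phase y (dirC i) = y i := by
  simp [phase_apply, dirC, Pi.single_apply]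

theorem phase_dirB (y : Fin m → ℝ) (i j : Fin m) :
    phase y (dirB i j) = -(1 / 2) * (y i * y j) := by
  rw [phase_apply, dirB, Finset.sum_eq_single (a := i) (s := Finset.univ)
    (f := fun i' => ∑ j', (-(1 / 2) * (y i' * y j') : ℂ) *
      (Pi.single i (Pi.single j 1) : Fin m → Fin m → ℂ) i' j')]
  · simp [Pi.single_apply]
  · intro b _ hb; simp [hb]
  · simp

theorem fderiv_moment_dirC {q : Params ℂ m m} (hq : q ∈ posDomain m) (D : Set (Fin m → ℝ))
    {w : (Fin m → ℝ) → ℂ} (hw : IsWeight w) (i : Fin m) :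
    fderiv ℂ (moment D w) q (dirC i) = moment D (fun y => w y * y i) q := by
  rw [(fderiv_moment hq D hw).2]; simp only [phase_dirC]

theorem fderiv_moment_dirC_dirC {q : Params ℂ m m} (hq : q ∈ posDomain m) (D : Set (Fin m → ℝ))
    {w : (Fin m → ℝ) → ℂ} (hw : IsWeight w) (i j : Fin m) :
    fderiv ℂ (fun q => fderiv ℂ (moment D w) q (dirC i)) q (dirC j) =
      moment D (fun y => w y * y i * y j) q := by
  have h : (fun q => fderiv ℂ (moment D w) q (dirC i)) =ᶠ[𝓝 q]
      moment D (fun y => w y * y i) := by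
    filter_upwards [isOpen_posDomain.mem_nhds hq] with q' hq' using fderiv_moment_dirC hq' D hw i
  rw [h.fderiv_eq, fderiv_moment_dirC hq D (hw.mul_coord i)]

/-- The heat equation. -/
theorem fderiv_moment_dirB {q : Params ℂ m m} (hq : q ∈ posDomain m) (D : Set (Fin m → ℝ))
    {w : (Fin m → ℝ) → ℂ} (hw : IsWeight w) (i j : Fin m) :
    fderiv ℂ (moment D w) q (dirB i j) =
      -(1 / 2) * fderiv ℂ (fun q => fderiv ℂ (moment D w) q (dirC i)) q (dirC j) := by
  rw [(fderiv_moment hq D hw).2, fderiv_moment_dirC_dirC hq D hw]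
  simp only [phase_dirB, moment]
  rw [← integral_const_mul]
  congr 1; ext y; ring

end QuadraticExponential
end
end GaussPolyhedron

namespace GaussPolyhedron
noncomputable section

/-! ### Integration by parts over the orthant and the whole space -/

section IntegrationByParts

open MeasureTheory

variable {m : ℕ}

/-- The open positive orthant. -/
def orthant (m : ℕ) : Set (Fin m → ℝ) := {y | ∀ i, 0 < y i}

/-- Forgetting the index `i`. -/
def deleteIndex (i : Fin (m + 1)) : Params ℂ (m + 1) (m + 1) →L[ℂ] Params ℂ m m :=
  (ContinuousLinearMap.pi fun a => ContinuousLinearMap.pi fun b =>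
    (ContinuousLinearMap.proj (i.succAbove b)).comp
      ((ContinuousLinearMap.proj (i.succAbove a)).comp (ContinuousLinearMap.fst ℂ
        (Fin (m + 1) → Fin (m + 1) → ℂ) _))).prod
  (ContinuousLinearMap.pi fun a =>
    (ContinuousLinearMap.proj (i.succAbove a)).comp (ContinuousLinearMap.snd ℂ _ _))

theorem deleteIndex_fst (i : Fin (m + 1)) (q : Params ℂ (m + 1) (m + 1)) (a b : Fin m) :
    (deleteIndex i q).1 a b = q.1 (i.succAbove a) (i.succAbove b) := rfl

theorem deleteIndex_snd (i : Fin (m + 1)) (q : Params ℂ (m + 1) (m + 1)) (a : Fin m) :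
    (deleteIndex i q).2 a = q.2 (i.succAbove a) := rfl

theorem deleteIndex_mem_posDomain (i : Fin (m + 1)) {q : Params ℂ (m + 1) (m + 1)}
    (hq : q ∈ posDomain (m + 1)) : deleteIndex i q ∈ posDomain m := by
  obtain ⟨δ, hδ, hq⟩ := hq
  refine ⟨δ, hδ, fun y => ?_⟩
  have := hq (i.insertNth 0 y)
  simpa [Fin.sum_univ_succAbove _ i, deleteIndex_fst] using this

theorem phase_insertNth_zero (i : Fin (m + 1)) (q : Params ℂ (m + 1) (m + 1)) (y : Fin m → ℝ) :
    phase (i.insertNth (α := fun _ => ℝ) 0 y) q = phase y (deleteIndex i q) := by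
  simp [phase_apply, Fin.sum_univ_succAbove _ i, deleteIndex_fst, deleteIndex_snd]

/-- The derivative of the exponent in the `i`-th coordinate. -/
theorem hasDerivAt_phase_insertNth (i : Fin (m + 1)) (q : Params ℂ (m + 1) (m + 1))
    (y : Fin m → ℝ) (t : ℝ) :
    HasDerivAt (fun t => phase (i.insertNth (α := fun _ => ℝ) t y) q)
      (q.2 i - ∑ j, 1 / 2 * (q.1 i j + q.1 j i) *
        ((i.insertNth (α := fun _ => ℝ) t y j : ℝ) : ℂ)) t := by
  have hc : ∀ j, HasDerivAt (fun t => ((i.insertNth (α := fun _ => ℝ) t y j : ℝ) : ℂ))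
      (if j = i then 1 else 0) t := by
    intro j
    rcases Fin.eq_self_or_eq_succAbove i j with rfl | ⟨k, rfl⟩
    · simpa using (hasDerivAt_id t).ofReal_comp
    · simpa [Fin.succAbove_ne] using hasDerivAt_const t ((y k : ℝ) : ℂ)
  simp only [phase_apply]
  have h1 : HasDerivAt (fun t => ∑ j, ((i.insertNth (α := fun _ => ℝ) t y j : ℝ) : ℂ) * q.2 j)
      (∑ j, (if j = i then 1 else 0) * q.2 j) t :=
    HasDerivAt.fun_sum fun j _ => (hc j).mul_const _
  have h2 := HasDerivAt.fun_sum (u := Finset.univ) fun j _ => HasDerivAt.fun_sum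
    (u := Finset.univ) fun k _ => (((hc j).mul (hc k)).const_mul (-(1 / 2) : ℂ)).mul_const (q.1 j k)
  refine (h1.add h2).congr_deriv ?_
  simp only [ite_mul, one_mul, zero_mul, mul_ite, mul_one, mul_zero, mul_add, add_mul,
    Finset.sum_add_distrib, Finset.sum_ite_eq', Finset.mem_univ, if_true, Finset.sum_ite_irrel,
    Finset.sum_const_zero]
  rw [sub_eq_add_neg, add_right_inj, ← Finset.sum_add_distrib, ← Finset.sum_add_distrib, ← Finset.sum_neg_distrib]
  refine Finset.sum_congr rfl fun j _ => ?_
  ring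

/-- Fubini with the `i`-th coordinate integrated first, as integration by parts in that coordinate
requires. -/
theorem setIntegral_insertNth (i : Fin (m + 1)) (S : Set ℝ) (D : Set (Fin m → ℝ))
    {f : (Fin (m + 1) → ℝ) → ℂ} (hf : Integrable f) :
    ∫ y in {y | y i ∈ S ∧ (fun k => y (i.succAbove k)) ∈ D}, f y =
      ∫ y in D, ∫ t in S, f (i.insertNth (α := fun _ => ℝ) t y) := by
  have hmp := (volume_preserving_piFinSuccAbove (fun _ : Fin (m + 1) => ℝ) i).symm
  have hpre : (MeasurableEquiv.piFinSuccAbove (fun _ : Fin (m + 1) => ℝ) i).symm ⁻¹'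
      {y | y i ∈ S ∧ (fun k => y (i.succAbove k)) ∈ D} = S ×ˢ D := by
    ext ⟨t, y⟩
    change (i.insertNth (α := fun _ => ℝ) t y i ∈ S ∧
      (fun k => i.insertNth (α := fun _ => ℝ) t y (i.succAbove k)) ∈ D) ↔ _
    simp
  rw [← hmp.setIntegral_preimage_emb (MeasurableEquiv.measurableEmbedding _), hpre]
  have hf' : Integrable (fun z : ℝ × (Fin m → ℝ) =>
      f ((MeasurableEquiv.piFinSuccAbove (fun _ : Fin (m + 1) => ℝ) i).symm z)) :=
    hmp.integrable_comp_of_integrable hf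
  rw [Measure.volume_eq_prod, ← Measure.prod_restrict, integral_prod_symm]
  · rfl
  · rw [Measure.prod_restrict]
    exact hf'.integrableOn

theorem ae_integrable_insertNth (i : Fin (m + 1))
    {f : (Fin (m + 1) → ℝ) → ℂ} (hf : Integrable f) :
    ∀ᵐ y : Fin m → ℝ, Integrable fun t => f (i.insertNth (α := fun _ => ℝ) t y) := by
  have hmp := (volume_preserving_piFinSuccAbove (fun _ : Fin (m + 1) => ℝ) i).symm
  have hf' : Integrable (fun z : ℝ × (Fin m → ℝ) =>
      f ((MeasurableEquiv.piFinSuccAbove (fun _ : Fin (m + 1) => ℝ) i).symm z)) :=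
    hmp.integrable_comp_of_integrable hf
  exact hf'.prod_left_ae

/-- The subtracted integrand is the `i`-th partial derivative of the exponential. This isolates the
total derivative whose integral is a boundary term. -/
theorem moment_sum_weight {q : Params ℂ m m} (hq : q ∈ posDomain m) (D : Set (Fin m → ℝ))
    (i : Fin m) :
    ∑ j, 1 / 2 * (q.1 i j + q.1 j i) * moment D (fun y => 1 * y j) q =
      q.2 i * moment D (fun _ => 1) q - ∫ y in D, (q.2 i - ∑ j, 1 / 2 * (q.1 i j + q.1 j i) *
        (y j : ℂ)) * Complex.exp (phase y q) := by
  have h1 := integrable_weight_mul_cexp hq isWeight_one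
  have h2 := fun j => integrable_weight_mul_cexp hq (isWeight_one.mul_coord j)
  have h3 : ∀ y, (q.2 i - ∑ j, 1 / 2 * (q.1 i j + q.1 j i) * (y j : ℂ)) *
      Complex.exp (phase y q) = q.2 i * (1 * Complex.exp (phase y q)) -
      ∑ j, 1 / 2 * (q.1 i j + q.1 j i) * (1 * (y j : ℂ) * Complex.exp (phase y q)) := by
    intro y
    rw [sub_mul, Finset.sum_mul]
    congr 1
    · ring
    · exact Finset.sum_congr rfl fun j _ => by ring
  simp only [h3]
  rw [integral_sub (h1.const_mul _).integrableOn
    (integrable_finsetSum _ fun j _ => ((h2 j).const_mul _)).integrableOn, integral_finsetSum _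
    fun j _ => ((h2 j).const_mul _).integrableOn, integral_const_mul]
  simp only [integral_const_mul, moment, sub_sub_cancel]

theorem integrable_deriv_cexp_phase {q : Params ℂ m m} (hq : q ∈ posDomain m) (i : Fin m) :
    Integrable fun y : Fin m → ℝ => (q.2 i - ∑ j, 1 / 2 * (q.1 i j + q.1 j i) * (y j : ℂ)) *
      Complex.exp (phase y q) := by
  have h1 := integrable_weight_mul_cexp hq isWeight_one
  have h2 := fun j => integrable_weight_mul_cexp hq (isWeight_one.mul_coord j)
  have := (h1.const_mul (q.2 i)).sub (integrable_finsetSum Finset.univ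
    fun j _ => ((h2 j).const_mul (1 / 2 * (q.1 i j + q.1 j i))))
  refine this.congr (Filter.Eventually.of_forall fun y => ?_)
  simp only [Pi.sub_apply]
  rw [sub_mul, Finset.sum_mul]
  congr 1
  · ring
  · exact Finset.sum_congr rfl fun j _ => by ring

/-- Integration by parts over the orthant. -/
theorem moment_orthant_ibp {q : Params ℂ (m + 1) (m + 1)} (hq : q ∈ posDomain (m + 1))
    (i : Fin (m + 1)) :
    ∑ j, 1 / 2 * (q.1 i j + q.1 j i) * moment (orthant (m + 1)) (fun y => 1 * y j) q =
      q.2 i * moment (orthant (m + 1)) (fun _ => 1) q +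
        moment (orthant m) (fun _ => 1) (deleteIndex i q) := by
  rw [moment_sum_weight hq, sub_eq_add_neg, add_right_inj]
  have hset : orthant (m + 1) = {y | y i ∈ Set.Ioi 0 ∧ (fun k => y (i.succAbove k)) ∈ orthant m} := by
    ext y
    simp only [orthant, Set.mem_ofPred_eq, Set.mem_Ioi]
    exact i.forall_iff_succAbove
  have hint := integrable_deriv_cexp_phase hq i
  rw [hset, setIntegral_insertNth i _ _ hint, moment,
    ← integral_neg]
  refine integral_congr_ae (ae_restrict_of_ae ?_)
  filter_upwards [ae_integrable_insertNth i hint, ae_integrable_insertNth i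
    (integrable_weight_mul_cexp hq isWeight_one)] with y hy hy'
  have hd : ∀ t, HasDerivAt (fun t => 1 * Complex.exp
      (phase (i.insertNth (α := fun _ => ℝ) t y) q)) _ t :=
    fun t => (hasDerivAt_phase_insertNth i q y t).cexp.const_mul 1
  simp only [one_mul, mul_comm (Complex.exp _)] at hd
  simp only [one_mul] at hy'
  -- On almost every line the exponential and its derivative are integrable, so the exponential
  -- tends to `0` at infinity. The boundary value at `0` is the exponential with the `i`-th variable
  -- deleted.
  have := integral_Ioi_of_hasDerivAt_of_tendsto (a := 0) (m := (0 : ℂ))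
    (hd 0).continuousAt.continuousWithinAt (fun t _ => hd t) hy.integrableOn
    (tendsto_zero_of_hasDerivAt_of_integrableOn_Ioi (a := 0) (fun t _ => hd t) hy.integrableOn
      hy'.integrableOn)
  rw [this, phase_insertNth_zero]
  ring

/-- Integration by parts over the whole space. -/
theorem moment_univ_ibp {q : Params ℂ m m} (hq : q ∈ posDomain m) (i : Fin m) :
    ∑ j, 1 / 2 * (q.1 i j + q.1 j i) * moment Set.univ (fun y => 1 * y j) q =
      q.2 i * moment Set.univ (fun _ => 1) q := by
  rw [moment_sum_weight hq, sub_eq_self]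
  obtain _ | m := m
  · exact i.elim0
  have hset : (Set.univ : Set (Fin (m + 1) → ℝ)) =
      {y | y i ∈ Set.univ ∧ (fun k => y (i.succAbove k)) ∈ Set.univ} := by simp
  have hint := integrable_deriv_cexp_phase hq i
  rw [hset, setIntegral_insertNth i _ _ hint]
  refine integral_eq_zero_of_ae (ae_restrict_of_ae ?_)
  filter_upwards [ae_integrable_insertNth i hint, ae_integrable_insertNth i
    (integrable_weight_mul_cexp hq isWeight_one)] with y hy hy'
  have hd : ∀ t, HasDerivAt (fun t => 1 * Complex.exp
      (phase (i.insertNth (α := fun _ => ℝ) t y) q)) _ t :=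
    fun t => (hasDerivAt_phase_insertNth i q y t).cexp.const_mul 1
  simp only [one_mul, mul_comm (Complex.exp _)] at hd
  simp only [one_mul] at hy'
  rw [Measure.restrict_univ]
  exact integral_eq_zero_of_hasDerivAt_of_integrable hd hy hy'

end IntegrationByParts
end
end GaussPolyhedron

namespace GaussPolyhedron
noncomputable section

/-! ### The linear differential system of a Gaussian integral -/

section LinearSystem

open MeasureTheory

variable {m : ℕ}

theorem params_eq_sum (v : Params ℂ m m) :
    v = ∑ i, v.2 i • dirC i + ∑ i, ∑ j, v.1 i j • dirB i j := by
  have h1 : (∑ i, v.2 i • (dirC i : Params ℂ m m)) = (0, v.2) := by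
    ext i
    · simp [Prod.fst_sum, dirC]
    · simp [Prod.snd_sum, dirC, Pi.single_apply]
  have h2 : (∑ i, ∑ j, v.1 i j • (dirB i j : Params ℂ m m)) = (v.1, 0) := by
    ext i j
    · simp only [Prod.fst_sum, dirB, Prod.smul_mk, Finset.sum_apply, Pi.smul_apply, smul_eq_mul]
      rw [Finset.sum_eq_single i]
      · simp [Pi.single_apply]
      · intro b _ hb
        simp [hb.symm]
      · simp
    · simp [Prod.snd_sum, dirB]
  rw [h1, h2]; simp

theorem clm_apply_params (T : Params ℂ m m →L[ℂ] ℂ) (v : Params ℂ m m) :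
    T v = ∑ i, v.2 i * T (dirC i) + ∑ i, ∑ j, v.1 i j * T (dirB i j) := by
  conv_lhs => rw [params_eq_sum v]
  simp [map_sum]

/-- The symmetrized quadratic form. -/
def symMatrix (q : Params ℂ m m) : Matrix (Fin m) (Fin m) ℂ :=
  Matrix.of fun i j => 1 / 2 * (q.1 i j + q.1 j i)

/-- The parameters for which all principal minors of the symmetrized form are nonzero. -/
def minorDomain (m : ℕ) : Set (Params ℂ m m) :=
  {q | ∀ (k : ℕ) (f : Fin k ↪ Fin m), ((symMatrix q).submatrix f f).det ≠ 0}

theorem det_symMatrix_ne_zero {q : Params ℂ m m} (hq : q ∈ minorDomain m) :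
    (symMatrix q).det ≠ 0 := hq m (Function.Embedding.refl _)

theorem deleteIndex_mem_minorDomain (i : Fin (m + 1)) {q : Params ℂ (m + 1) (m + 1)}
    (hq : q ∈ minorDomain (m + 1)) : deleteIndex i q ∈ minorDomain m := fun k f =>
  hq k (f.trans i.succAboveEmb)

theorem analyticAt_det {E ι : Type} [NormedAddCommGroup E] [NormedSpace ℂ E] [Fintype ι]
    [DecidableEq ι]
    {M : E → Matrix ι ι ℂ} {x : E} (h : ∀ i j, AnalyticAt ℂ (fun x => M x i j) x) :
    AnalyticAt ℂ (fun x => (M x).det) x := by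
  simp only [Matrix.det_apply']
  exact Finset.analyticAt_fun_sum _ fun σ _ => analyticAt_const.mul
    (Finset.analyticAt_fun_prod _ fun i _ => h _ _)

theorem analyticAt_inv {E ι : Type} [NormedAddCommGroup E] [NormedSpace ℂ E] [Fintype ι]
    [DecidableEq ι]
    {M : E → Matrix ι ι ℂ} {x : E} (h : ∀ i j, AnalyticAt ℂ (fun x => M x i j) x)
    (hx : (M x).det ≠ 0) (i j : ι) : AnalyticAt ℂ (fun x => (M x)⁻¹ i j) x := by
  simp only [Matrix.inv_def, Matrix.smul_apply, Ring.inverse_eq_inv', smul_eq_mul,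
    Matrix.adjugate_apply]
  refine ((analyticAt_det h).inv hx).mul (analyticAt_det fun a b => ?_)
  simp only [Matrix.updateRow_apply]
  split_ifs
  · exact analyticAt_const
  · exact h a b

theorem analyticAt_fst_apply (q : Params ℂ m m) (i j : Fin m) :
    AnalyticAt ℂ (fun q : Params ℂ m m => q.1 i j) q :=
  ((ContinuousLinearMap.proj (R := ℂ) (φ := fun _ : Fin m => ℂ) j).comp
    ((ContinuousLinearMap.proj (R := ℂ) (φ := fun _ : Fin m => Fin m → ℂ) i).comp
      (ContinuousLinearMap.fst ℂ (Fin m → Fin m → ℂ) (Fin m → ℂ)))).analyticAt q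

theorem analyticAt_snd_apply (q : Params ℂ m m) (i : Fin m) :
    AnalyticAt ℂ (fun q : Params ℂ m m => q.2 i) q :=
  ((ContinuousLinearMap.proj (R := ℂ) (φ := fun _ : Fin m => ℂ) i).comp
      (ContinuousLinearMap.snd ℂ (Fin m → Fin m → ℂ) (Fin m → ℂ))).analyticAt q

theorem analyticAt_symMatrix (q : Params ℂ m m) (i j : Fin m) :
    AnalyticAt ℂ (fun q : Params ℂ m m => symMatrix q i j) q :=
  analyticAt_const.mul ((analyticAt_fst_apply q i j).add (analyticAt_fst_apply q j i))

theorem analyticAt_symMatrix_inv {q : Params ℂ m m} (hq : (symMatrix q).det ≠ 0) (i j : Fin m) :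
    AnalyticAt ℂ (fun q : Params ℂ m m => (symMatrix q)⁻¹ i j) q :=
  analyticAt_inv (analyticAt_symMatrix q) hq i j

/-- The linear form with the given values on the coordinate directions. -/
def formOf (A : Fin m → ℂ) (B : Fin m → Fin m → ℂ) : Params ℂ m m →L[ℂ] ℂ :=
  ∑ i, A i • ((ContinuousLinearMap.proj i).comp (ContinuousLinearMap.snd ℂ _ _)) +
  ∑ i, ∑ j, B i j • ((ContinuousLinearMap.proj j).comp
    ((ContinuousLinearMap.proj i).comp (ContinuousLinearMap.fst ℂ (Fin m → Fin m → ℂ) _)))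

theorem formOf_apply (A : Fin m → ℂ) (B : Fin m → Fin m → ℂ) (v : Params ℂ m m) :
    formOf A B v = ∑ i, v.2 i * A i + ∑ i, ∑ j, v.1 i j * B i j := by
  simp [formOf, mul_comm]

theorem Continues.formOf {N : Set (Params ℂ m m)} {z : Params ℂ m m}
    {A : Params ℂ m m → Fin m → ℂ} {B : Params ℂ m m → Fin m → Fin m → ℂ}
    (hA : ∀ i, Continues N z fun q => A q i) (hB : ∀ i j, Continues N z fun q => B q i j) :
    Continues N z fun q => formOf (A q) (B q) :=
  (Continues.sum _ fun i _ => (hA i).smul (continues_const _)).add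
    (Continues.sum _ fun i _ => Continues.sum _ fun j _ => (hB i j).smul (continues_const _))

/-- The vector `(symMatrix q)⁻¹ c`. -/
def invC (q : Params ℂ m m) (i : Fin m) : ℂ := ∑ j, (symMatrix q)⁻¹ i j * q.2 j

/-- The logarithmic derivative of the Gaussian integral over the whole space. -/
def logForm (q : Params ℂ m m) : Params ℂ m m →L[ℂ] ℂ :=
  formOf (invC q) fun i k => -(1 / 2) * ((symMatrix q)⁻¹ i k + invC q i * invC q k)

/-- The inhomogeneous part of the derivative of a Gaussian integral with boundary terms `h`. -/
def boundaryForm (h : Fin m → Params ℂ m m → ℂ) (q : Params ℂ m m) : Params ℂ m m →L[ℂ] ℂ :=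
  formOf (fun i => ∑ j, (symMatrix q)⁻¹ i j * h j q) fun i k => -(1 / 2) *
    (invC q i * (∑ j, (symMatrix q)⁻¹ k j * h j q) +
      ∑ j, (symMatrix q)⁻¹ i j * fderiv ℂ (h j) q (dirC k))

theorem continues_logForm (z : Params ℂ m m) : Continues (minorDomain m) z logForm := by
  have hS : ∀ i j, Continues (minorDomain m) z fun q => (symMatrix q)⁻¹ i j := fun i j =>
    AnalyticOnNhd.continues fun q hq => analyticAt_symMatrix_inv (det_symMatrix_ne_zero hq) i j
  have hc : ∀ j, Continues (minorDomain m) z fun q => q.2 j := fun j =>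
    AnalyticOnNhd.continues fun q _ => analyticAt_snd_apply q j
  have hV : ∀ i, Continues (minorDomain m) z fun q => invC q i := fun i =>
    Continues.sum _ fun j _ => (hS i j).mul (hc j)
  exact Continues.formOf hV fun i k =>
    (continues_const _).mul ((hS i k).add ((hV i).mul (hV k)))

theorem continues_boundaryForm {z : Params ℂ m m} {h : Fin m → Params ℂ m m → ℂ}
    (hh : ∀ i, Continues (minorDomain m) z (h i)) :
    Continues (minorDomain m) z (boundaryForm h) := by
  have hS : ∀ i j, Continues (minorDomain m) z fun q => (symMatrix q)⁻¹ i j := fun i j =>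
    AnalyticOnNhd.continues fun q hq => analyticAt_symMatrix_inv (det_symMatrix_ne_zero hq) i j
  have hc : ∀ j, Continues (minorDomain m) z fun q => q.2 j := fun j =>
    AnalyticOnNhd.continues fun q _ => analyticAt_snd_apply q j
  have hV : ∀ i, Continues (minorDomain m) z fun q => invC q i := fun i =>
    Continues.sum _ fun j _ => (hS i j).mul (hc j)
  have hSh : ∀ i, Continues (minorDomain m) z fun q => ∑ j, (symMatrix q)⁻¹ i j * h j q :=
    fun i => Continues.sum _ fun j _ => (hS i j).mul (hh j)
  exact Continues.formOf hSh fun i k => (continues_const _).mul (((hV i).mul (hSh k)).add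
    (Continues.sum _ fun j _ => (hS i j).mul ((hh j).fderiv_apply _)))

theorem eq_sum_inv_of_sum_eq {M : Matrix (Fin m) (Fin m) ℂ} (hM : M.det ≠ 0) {x y : Fin m → ℂ}
    (h : ∀ i, ∑ j, M i j * x j = y i) (i : Fin m) : x i = ∑ j, M⁻¹ i j * y j := by
  have h1 : M.mulVec x = y := funext h
  have h2 : M⁻¹.mulVec y = x := by
    rw [← h1, Matrix.mulVec_mulVec, Matrix.nonsing_inv_mul _ (isUnit_iff_ne_zero.2 hM),
      Matrix.one_mulVec]
  exact (congrFun h2 i).symm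

/-- The linear differential system of a Gaussian integral. -/
theorem fderiv_eq_of_system {L : Params ℂ m m → ℂ} {h : Fin m → Params ℂ m m → ℂ}
    {q : Params ℂ m m} (hdet : (symMatrix q).det ≠ 0)
    (hL : AnalyticAt ℂ L q) (hh : ∀ i, AnalyticAt ℂ (h i) q)
    (hibp : ∀ᶠ q' in 𝓝 q, ∀ i, ∑ j, symMatrix q' i j * fderiv ℂ L q' (dirC j) =
      q'.2 i * L q' + h i q')
    (hheat : ∀ i j, fderiv ℂ L q (dirB i j) =
      -(1 / 2) * fderiv ℂ (fun q => fderiv ℂ L q (dirC i)) q (dirC j)) :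
    fderiv ℂ L q = L q • logForm q + boundaryForm h q := by
  have hA : ∀ i, fderiv ℂ L q (dirC i) =
      invC q i * L q + ∑ j, (symMatrix q)⁻¹ i j * h j q := by
    intro i
    rw [eq_sum_inv_of_sum_eq hdet hibp.self_of_nhds i, invC, Finset.sum_mul,
      ← Finset.sum_add_distrib]
    exact Finset.sum_congr rfl fun j _ => by ring
  have hAan : ∀ j, DifferentiableAt ℂ (fun q => fderiv ℂ L q (dirC j)) q := fun j =>
    (((ContinuousLinearMap.apply ℂ ℂ (dirC j)).analyticAt _).comp hL.fderiv).differentiableAt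
  -- The system is differentiated in the direction `c k`. Its matrix depends only on `β`, so the
  -- second derivatives solve a system with the same matrix.
  have hB : ∀ k i, ∑ j, symMatrix q i j *
      fderiv ℂ (fun q => fderiv ℂ L q (dirC j)) q (dirC k) =
      (if i = k then L q else 0) + q.2 i * fderiv ℂ L q (dirC k) + fderiv ℂ (h i) q (dirC k) := by
    intro k i
    have h1 : (fun q' => ∑ j, symMatrix q' i j * fderiv ℂ L q' (dirC j)) =ᶠ[𝓝 q]
        fun q' => q'.2 i * L q' + h i q' := hibp.mono fun q' h => h i
    have hline : ∀ j, HasFDerivAt (fun q' : Params ℂ m m => symMatrix q' i j)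
        (fderiv ℂ (fun q' : Params ℂ m m => symMatrix q' i j) q) q := fun j =>
      (analyticAt_symMatrix q i j).differentiableAt.hasFDerivAt
    have hzero : ∀ j, fderiv ℂ (fun q' : Params ℂ m m => symMatrix q' i j) q (dirC k) = 0 := by
      intro j
      have h3 := ((hline j).comp_hasDerivAt_of_eq (0 : ℂ)
        (((hasDerivAt_id (0 : ℂ)).smul_const (dirC k : Params ℂ m m)).const_add q) (by simp))
      rw [one_smul] at h3
      refine h3.unique ?_
      refine (hasDerivAt_const (0 : ℂ) (symMatrix q i j)).congr_of_eventuallyEq ?_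
      filter_upwards with t
      simp [symMatrix, dirC]
    have hc : fderiv ℂ (fun q' : Params ℂ m m => q'.2 i) q (dirC k) = if i = k then 1 else 0 := by
      have : (fun q' : Params ℂ m m => q'.2 i) = ((ContinuousLinearMap.proj (R := ℂ)
        (φ := fun _ : Fin m => ℂ) i).comp
          (ContinuousLinearMap.snd ℂ (Fin m → Fin m → ℂ) (Fin m → ℂ))) := rfl
      rw [this, ContinuousLinearMap.fderiv]
      simp [dirC, Pi.single_apply]
    have h2 : HasFDerivAt (fun q' => ∑ j, symMatrix q' i j * fderiv ℂ L q' (dirC j)) _ q :=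
      HasFDerivAt.fun_sum fun j _ => (hline j).mul (hAan j).hasFDerivAt
    have h3 : HasFDerivAt (fun q' => q'.2 i * L q' + h i q') _ q :=
      ((analyticAt_snd_apply q i).differentiableAt.hasFDerivAt.mul
        hL.differentiableAt.hasFDerivAt).add (hh i).differentiableAt.hasFDerivAt
    have h4 := congrArg (fun T => T (dirC k)) ((h3.congr_of_eventuallyEq h1).unique h2)
    simp only [add_apply, sum_apply, smul_apply, smul_eq_mul, hzero, hc, mul_zero, add_zero] at h4
    rw [← h4]
    split_ifs <;> ring
  have hC : ∀ i k, fderiv ℂ (fun q => fderiv ℂ L q (dirC i)) q (dirC k) =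
      (symMatrix q)⁻¹ i k * L q + invC q i * fderiv ℂ L q (dirC k) +
        ∑ j, (symMatrix q)⁻¹ i j * fderiv ℂ (h j) q (dirC k) := by
    intro i k
    rw [eq_sum_inv_of_sum_eq hdet (hB k) i]
    simp only [mul_add, Finset.sum_add_distrib, mul_ite, mul_zero, Finset.sum_ite_eq',
      Finset.mem_univ, if_true, invC, Finset.sum_mul, mul_assoc]
  -- First derivatives in `c` come from `hA`; those in `β` are second derivatives in `c` by the heat
  -- equation and come from `hC`.
  refine ContinuousLinearMap.ext fun v => ?_
  rw [clm_apply_params, add_apply, smul_apply, smul_eq_mul, logForm, boundaryForm, formOf_apply,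
    formOf_apply, mul_add, add_add_add_comm]
  refine congrArg₂ (· + ·) ?_ ?_
  · rw [Finset.mul_sum, ← Finset.sum_add_distrib]
    refine Finset.sum_congr rfl fun i _ => ?_
    rw [hA]; ring
  · rw [Finset.mul_sum, ← Finset.sum_add_distrib]
    refine Finset.sum_congr rfl fun i _ => ?_
    rw [Finset.mul_sum, ← Finset.sum_add_distrib]
    refine Finset.sum_congr rfl fun k _ => ?_
    rw [hheat, hC, hA]; ring

end LinearSystem

/-! ### Continuation of orthant integrals by induction on the dimension -/

section OrthantContinuation

open MeasureTheory

variable {m : ℕ}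

/-- The Gaussian integral over the orthant. -/
def orthInt (q : Params ℂ m m) : ℂ := moment (orthant m) (fun _ => 1) q

/-- The Gaussian integral over the whole space. -/
def fullInt (q : Params ℂ m m) : ℂ := moment Set.univ (fun _ => 1) q

/-- The derivative of the orthant integral. -/
theorem fderiv_orthInt {q : Params ℂ (m + 1) (m + 1)} (hq : q ∈ posDomain (m + 1))
    (hdet : (symMatrix q).det ≠ 0) :
    fderiv ℂ orthInt q = orthInt q • logForm q +
      boundaryForm (fun i q => orthInt (deleteIndex i q)) q := by
  refine fderiv_eq_of_system hdet (analyticAt_moment hq _) (fun i => ?_) ?_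
    (fderiv_moment_dirB hq _ isWeight_one)
  · exact (analyticAt_moment (deleteIndex_mem_posDomain i hq) _).comp
      ((deleteIndex i).analyticAt q)
  · filter_upwards [isOpen_posDomain.mem_nhds hq] with q' hq' i
    rw [orthInt, orthInt, ← moment_orthant_ibp hq' i]
    refine Finset.sum_congr rfl fun j _ => ?_
    rw [← fderiv_moment_dirC hq' _ isWeight_one]
    rfl

/-- The derivative of the full Gaussian integral. -/
theorem fderiv_fullInt {q : Params ℂ m m} (hq : q ∈ posDomain m)
    (hdet : (symMatrix q).det ≠ 0) :
    fderiv ℂ fullInt q = fullInt q • logForm q := by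
  have := fderiv_eq_of_system (L := fullInt) (h := fun _ _ => 0) hdet (analyticAt_moment hq _)
    (fun i => analyticAt_const) ?_ (fderiv_moment_dirB hq _ isWeight_one)
  · rw [this]
    refine ContinuousLinearMap.ext fun v => ?_
    simp [boundaryForm, formOf_apply]
  · filter_upwards [isOpen_posDomain.mem_nhds hq] with q' hq' i
    rw [add_zero, fullInt, ← moment_univ_ibp hq' i]
    refine Finset.sum_congr rfl fun j _ => ?_
    rw [← fderiv_moment_dirC hq' _ isWeight_one]
    rfl

theorem phase_toComplex (r : Params ℝ m m) (y : Fin m → ℝ) : phase y (toComplex r) =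
    ((∑ i, y i * r.2 i + ∑ i, ∑ j, -(1 / 2) * (y i * y j) * r.1 i j : ℝ) : ℂ) := by
  simp [phase_apply, toComplex]

/-- Positivity at real parameters keeps the principal logarithm analytic near the starting point of
a path. -/
theorem fullInt_toComplex {r : Params ℝ m m} (hr : toComplex r ∈ posDomain m) :
    ∃ x : ℝ, 0 < x ∧ fullInt (toComplex r) = x := by
  have hint := integrable_weight_mul_cexp hr isWeight_one
  simp only [phase_toComplex, one_mul, ← Complex.ofReal_exp] at hint
  refine ⟨∫ y : Fin m → ℝ, Real.exp (∑ i, y i * r.2 i +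
    ∑ i, ∑ j, -(1 / 2) * (y i * y j) * r.1 i j), integral_exp_pos hint.re, ?_⟩
  rw [fullInt, moment, Measure.restrict_univ]
  simp only [phase_toComplex, one_mul, ← Complex.ofReal_exp]
  exact integral_ofReal

/-- The Gaussian integrals over the orthant and their normalizations continue analytically along
all paths on which no principal minor vanishes. -/
theorem continues_orthInt : ∀ (m : ℕ) (r : Params ℝ m m), toComplex r ∈ posDomain m →
    Continues (minorDomain m) (toComplex r) (fun q => orthInt q * (fullInt q)⁻¹) ∧
      Continues (minorDomain m) (toComplex r) (orthInt (m := m)) := by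
  intro m
  induction m with
  -- In dimension `0` the parameter space is a single point, so both functions are constant.
  | zero =>
    intro r hr
    constructor
    · exact AnalyticOnNhd.continues fun q _ => by
        rw [show (fun q : Params ℂ 0 0 => orthInt q * (fullInt q)⁻¹) = fun _ =>
          orthInt (toComplex r) * (fullInt (toComplex r))⁻¹ from funext fun q => by
            rw [Subsingleton.elim q (toComplex r)]]
        exact analyticAt_const
    · exact AnalyticOnNhd.continues fun q _ => by
        rw [show (orthInt (m := 0)) = fun _ =>
          orthInt (toComplex r) from funext fun q => by rw [Subsingleton.elim q (toComplex r)]]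
        exact analyticAt_const
  | succ m ih =>
    intro r hr
    set z := toComplex r with hz
    have hpos : ∀ᶠ q in 𝓝 z, q ∈ posDomain (m + 1) := isOpen_posDomain.eventually_mem hr
    have hfan : AnalyticAt ℂ (fullInt (m := m + 1)) z := analyticAt_moment hr _
    have hoan : AnalyticAt ℂ (orthInt (m := m + 1)) z := analyticAt_moment hr _
    obtain ⟨x, hx, hfx⟩ := fullInt_toComplex hr
    have hslit : fullInt z ∈ Complex.slitPlane := by
      rw [hfx]; exact Complex.ofReal_mem_slitPlane.2 hx
    have hne : ∀ᶠ q in 𝓝 z, fullInt q ≠ 0 :=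
      hfan.continuousAt.eventually_ne (Complex.slitPlane_ne_zero hslit)
    have hdet : z ∈ minorDomain (m + 1) → ∀ᶠ q in 𝓝 z, (symMatrix q).det ≠ 0 := fun hzN =>
      (analyticAt_det (analyticAt_symMatrix z)).continuousAt.eventually_ne
        (det_symMatrix_ne_zero hzN)
    -- Continuing the logarithm instead of the integral makes its differential the explicit form
    -- `logForm`; exponentials of it and of its negative then continue the integral and its inverse.
    have hlog : Continues (minorDomain (m + 1)) z fun q => Complex.log (fullInt q) := by
      refine (continues_logForm z).of_fderiv (fun _ => hfan.clog hslit) fun hzN => ?_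
      filter_upwards [hpos, hdet hzN, hfan.eventually_analyticAt,
        hfan.continuousAt.eventually (Complex.isOpen_slitPlane.mem_nhds hslit)]
        with q h1 h2 h3 h4
      rw [(h3.differentiableAt.hasFDerivAt.clog h4).fderiv, fderiv_fullInt h1 h2, smul_smul,
        inv_mul_cancel₀ (Complex.slitPlane_ne_zero h4), one_smul]
    have hfull : Continues (minorDomain (m + 1)) z fullInt := hlog.cexp.congr fun _ => by
      filter_upwards [hne] with q hq using Complex.exp_log hq
    have hinv : Continues (minorDomain (m + 1)) z fun q => (fullInt q)⁻¹ :=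
      ((continues_const (-1)).mul hlog).cexp.congr fun _ => by
        filter_upwards [hne] with q hq
        rw [neg_one_mul, Complex.exp_neg, Complex.exp_log hq]
    have hdel : ∀ i, Continues (minorDomain (m + 1)) z fun q => orthInt (deleteIndex i q) := by
      intro i
      have h1 : deleteIndex i z = toComplex ((fun a b => r.1 (i.succAbove a) (i.succAbove b),
          fun a => r.2 (i.succAbove a)) : Params ℝ m m) := rfl
      have h2 := (ih _ (h1 ▸ deleteIndex_mem_posDomain i hr)).2
      rw [← h1] at h2
      exact h2.comp (fun q _ => (deleteIndex i).analyticAt q)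
        fun q hq => deleteIndex_mem_minorDomain i hq
    -- In the derivative of the quotient the multiples of `logForm` cancel. What remains is the
    -- boundary form, continuable by induction, over the full integral.
    have hratio : Continues (minorDomain (m + 1)) z fun q => orthInt q * (fullInt q)⁻¹ := by
      refine (hinv.smul (continues_boundaryForm hdel)).of_fderiv
        (fun _ => hoan.mul (hfan.inv (Complex.slitPlane_ne_zero hslit))) fun hzN => ?_
      filter_upwards [hpos, hdet hzN, hfan.eventually_analyticAt, hoan.eventually_analyticAt,
        hne] with q h1 h2 h3 h4 h5
      have h6 := h4.differentiableAt.hasFDerivAt.mul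
        ((hasDerivAt_inv h5).comp_hasFDerivAt q h3.differentiableAt.hasFDerivAt)
      have h7 := h6.fderiv
      rw [fderiv_fullInt h1 h2, fderiv_orthInt h1 h2] at h7
      refine Eq.trans h7 ?_
      refine ContinuousLinearMap.ext fun v => ?_
      simp only [add_apply, smul_apply, smul_eq_mul, Function.comp]
      field_simp
      ring
    refine ⟨hratio, (hratio.mul hfull).congr fun _ => ?_⟩
    filter_upwards [hne] with q hq
    rw [mul_assoc, inv_mul_cancel₀ hq, mul_one]

end OrthantContinuation
end
end GaussPolyhedron

namespace GaussPolyhedron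
noncomputable section

/-! ### Gaussian law of scalar products with independent vectors -/

section Pushforward

open MeasureTheory

variable {d : ℕ} {ι : Type}

/-- The Gram matrix of a family of vectors. -/
def gramMatrix (v : ι → Fin d → ℝ) : Matrix ι ι ℝ := Matrix.of fun i j => ∑ k, v i k * v j k

/-- The linear map whose coordinates are the scalar products with a family of vectors. -/
def coordMap (v : ι → Fin d → ℝ) : (Fin d → ℝ) →L[ℝ] (ι → ℝ) :=
  ContinuousLinearMap.pi fun i => ∑ k, v i k • ContinuousLinearMap.proj k

theorem coordMap_apply (v : ι → Fin d → ℝ) (x : Fin d → ℝ) (i : ι) :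
    coordMap v x i = ∑ k, v i k * x k := by
  simp [coordMap]

variable [Fintype ι] [DecidableEq ι]

/-- The section of `coordMap` with image in the span of the vectors. -/
def coordSection (v : ι → Fin d → ℝ) : (ι → ℝ) →L[ℝ] (Fin d → ℝ) :=
  ContinuousLinearMap.pi fun k => ∑ i, ∑ j, (v i k * (gramMatrix v)⁻¹ i j) •
    ContinuousLinearMap.proj j

theorem coordSection_apply (v : ι → Fin d → ℝ) (y : ι → ℝ) (k : Fin d) :
    coordSection v y k = ∑ i, v i k * ((gramMatrix v)⁻¹.mulVec y) i := by
  simp [coordSection, Matrix.mulVec, dotProduct, Finset.mul_sum, mul_assoc]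

theorem coordMap_coordSection {v : ι → Fin d → ℝ} (hv : (gramMatrix v).det ≠ 0) (y : ι → ℝ) :
    coordMap v (coordSection v y) = y := by
  ext i
  have h1 : coordMap v (coordSection v y) i =
      ((gramMatrix v).mulVec ((gramMatrix v)⁻¹.mulVec y)) i := by
    rw [coordMap_apply]
    simp only [coordSection_apply, Finset.mul_sum]
    rw [Finset.sum_comm]
    simp only [Matrix.mulVec, dotProduct, gramMatrix, Matrix.of_apply, Finset.sum_mul, mul_assoc]
  rw [h1, Matrix.mulVec_mulVec, Matrix.mul_nonsing_inv _ (isUnit_iff_ne_zero.2 hv),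
    Matrix.one_mulVec]

theorem sum_coordSection_mul (v : ι → Fin d → ℝ) (y : ι → ℝ) (x : Fin d → ℝ) :
    ∑ k, coordSection v y k * x k = ∑ i, ((gramMatrix v)⁻¹.mulVec y) i * coordMap v x i := by
  simp only [coordSection_apply, coordMap_apply, Finset.sum_mul, Finset.mul_sum]
  rw [Finset.sum_comm]
  exact Finset.sum_congr rfl fun i _ => Finset.sum_congr rfl fun k _ => by ring

/-- The inverse of the Gram matrix as a quadratic form. -/
def dualForm (v : ι → Fin d → ℝ) (y : ι → ℝ) : ℝ := ∑ i, ((gramMatrix v)⁻¹.mulVec y) i * y i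

theorem sum_sq_coordSection {v : ι → Fin d → ℝ} (hv : (gramMatrix v).det ≠ 0) (y : ι → ℝ) :
    ∑ k, coordSection v y k ^ 2 = dualForm v y := by
  simp only [sq, sum_coordSection_mul, coordMap_coordSection hv, dualForm]

/-- Splitting a vector along the kernel of `coordMap` and its orthogonal complement. -/
def coordSplit (v : ι → Fin d → ℝ) (hv : (gramMatrix v).det ≠ 0) :
    ((LinearMap.ker (coordMap v).toLinearMap) × (ι → ℝ)) ≃L[ℝ] (Fin d → ℝ) :=
  LinearEquiv.toContinuousLinearEquiv
    { toFun := fun z => z.1 + coordSection v z.2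
      map_add' := fun z z' => by
        rw [Prod.fst_add, Prod.snd_add, map_add, Submodule.coe_add, add_add_add_comm]
      map_smul' := fun c z => by simp
      invFun := fun x => (⟨x - coordSection v (coordMap v x), by
        simp [coordMap_coordSection hv]⟩, coordMap v x)
      left_inv := fun z => by
        have h : coordMap v (z.1 : Fin d → ℝ) = 0 := z.1.2
        ext1
        · ext1
          simp [h, coordMap_coordSection hv]
        · simp [h, coordMap_coordSection hv]
      right_inv := fun x => by simp }

theorem coordSplit_apply {v : ι → Fin d → ℝ} (hv : (gramMatrix v).det ≠ 0)
    (z : (LinearMap.ker (coordMap v).toLinearMap) × (ι → ℝ)) :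
    coordSplit v hv z = z.1 + coordSection v z.2 := rfl

theorem coordMap_coordSplit {v : ι → Fin d → ℝ} (hv : (gramMatrix v).det ≠ 0)
    (z : (LinearMap.ker (coordMap v).toLinearMap) × (ι → ℝ)) :
    coordMap v (coordSplit v hv z) = z.2 := by
  have h : coordMap v (z.1 : Fin d → ℝ) = 0 := z.1.2
  rw [coordSplit_apply, map_add, h, zero_add, coordMap_coordSection hv]

/-- Pythagoras: the kernel is orthogonal to the span of the vectors, where the section takes its
values. This makes the Gaussian weight a product. -/
theorem sum_sq_coordSplit {v : ι → Fin d → ℝ} (hv : (gramMatrix v).det ≠ 0)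
    (z : (LinearMap.ker (coordMap v).toLinearMap) × (ι → ℝ)) :
    ∑ k, coordSplit v hv z k ^ 2 = ∑ k, (z.1 : Fin d → ℝ) k ^ 2 + dualForm v z.2 := by
  have h : coordMap v (z.1 : Fin d → ℝ) = 0 := z.1.2
  have h2 := sum_coordSection_mul v z.2 z.1
  rw [h] at h2
  simp only [Pi.zero_apply, mul_zero, Finset.sum_const_zero] at h2
  rw [← sum_sq_coordSection hv, coordSplit_apply]
  simp only [Pi.add_apply, add_sq, Finset.sum_add_distrib]
  have h3 : ∑ k, 2 * (z.1 : Fin d → ℝ) k * coordSection v z.2 k = 0 := by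
    have h4 := congrArg (fun t => 2 * t) h2
    simp only [mul_zero, Finset.mul_sum] at h4
    rw [← h4]
    exact Finset.sum_congr rfl fun k _ => by ring
  rw [h3, add_zero]

theorem integrable_exp_neg_sum_sq {κ : ℝ} (hκ : 0 < κ) :
    Integrable fun x : Fin d → ℝ => Real.exp (-κ * ∑ k, x k ^ 2) := by
  simpa using integrable_exp_sum_abs_sub_sum_sq (m := d) hκ 0

/-- The law of the scalar products with independent vectors under a Gaussian weight, up to a
constant. -/
theorem exists_integral_coordMap {v : ι → Fin d → ℝ} (hv : (gramMatrix v).det ≠ 0) {κ : ℝ}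
    (hκ : 0 < κ) : ∃ c : ℝ, ∀ h : (ι → ℝ) → ℝ,
      (∫ x : Fin d → ℝ, Real.exp (-κ * ∑ k, x k ^ 2) * h (coordMap v x) =
        c * ∫ y, Real.exp (-κ * dualForm v y) * h y) ∧
      (Integrable (fun y => Real.exp (-κ * dualForm v y) * h y) →
        Integrable fun x : Fin d → ℝ => Real.exp (-κ * ∑ k, x k ^ 2) * h (coordMap v x)) := by
  let K := LinearMap.ker (coordMap v).toLinearMap
  let T := coordSplit v hv
  let ν : Measure K := Measure.addHaar
  have hT : MeasurableEmbedding T := T.toHomeomorph.measurableEmbedding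
  have : ((ν.prod volume).map T).IsAddHaarMeasure :=
    T.toLinearEquiv.toAddEquiv.isAddHaarMeasure_map _ T.continuous T.symm.continuous
  -- Uniqueness of Haar measure replaces a Jacobian computation; the value of the constant never
  -- matters.
  obtain ⟨c, hc0, hct, hc⟩ : ∃ c : ENNReal, c ≠ 0 ∧ c ≠ ⊤ ∧
      (volume : Measure (Fin d → ℝ)) = c • (ν.prod volume).map T :=
    ⟨_, ENNReal.coe_ne_zero.2 (Measure.addHaarScalarFactor_pos_of_isAddHaarMeasure _ _).ne',
      ENNReal.coe_ne_top, Measure.isAddLeftInvariant_eq_smul _ _⟩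
  have key : ∀ (h : (ι → ℝ) → ℝ) (z : K × (ι → ℝ)),
      Real.exp (-κ * ∑ k, T z k ^ 2) * h (coordMap v (T z)) =
      Real.exp (-κ * ∑ k, (z.1 : Fin d → ℝ) k ^ 2) * (Real.exp (-κ * dualForm v z.2) * h z.2) := by
    intro h z
    rw [coordMap_coordSplit hv, sum_sq_coordSplit hv, mul_add, Real.exp_add, mul_assoc]
  -- The weight on the kernel is, up to a positive factor, a slice of the integrable weight on the
  -- whole space.
  have hK : Integrable (fun k : K => Real.exp (-κ * ∑ i, (k : Fin d → ℝ) i ^ 2)) ν := by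
    have h1 := integrable_exp_neg_sum_sq (d := d) hκ
    rw [hc, integrable_smul_measure hc0 hct, hT.integrable_map_iff] at h1
    have h2 := h1.prod_left_ae
    obtain ⟨y, hy⟩ := h2.exists
    have h3 := hy.mul_const (Real.exp (-κ * dualForm v y))⁻¹
    refine h3.congr (Filter.Eventually.of_forall fun k => ?_)
    have := key (fun _ => 1) (k, y)
    simp only [mul_one] at this
    simp only [Function.comp]
    rw [this, mul_assoc, mul_inv_cancel₀ (Real.exp_pos _).ne', mul_one]
  refine ⟨c.toReal * ∫ k : K, Real.exp (-κ * ∑ i, (k : Fin d → ℝ) i ^ 2) ∂ν, fun h => ⟨?_, ?_⟩⟩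
  · conv_lhs => rw [hc]
    rw [integral_smul_measure, hT.integral_map]
    simp only [key]
    rw [integral_prod_mul (μ := ν) (ν := volume)
      (fun k : K => Real.exp (-κ * ∑ i, (k : Fin d → ℝ) i ^ 2))
      (fun y => Real.exp (-κ * dualForm v y) * h y), smul_eq_mul, mul_assoc]
  · intro hi
    rw [hc, integrable_smul_measure hc0 hct, hT.integrable_map_iff]
    refine (hK.mul_prod hi).congr (Filter.Eventually.of_forall fun z => ?_)
    exact (key h z).symm

/-- Each `y i` is the scalar product of `v i` with the section of `y`, whose squared norm is the
dual form, so Cauchy-Schwarz applies. -/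
theorem exists_le_dualForm {v : ι → Fin d → ℝ} (hv : (gramMatrix v).det ≠ 0) :
    ∃ δ > 0, ∀ y, δ * ∑ i, y i ^ 2 ≤ dualForm v y := by
  set M := ∑ i, ∑ k, v i k ^ 2 with hM
  have hM0 : 0 ≤ M := by positivity
  refine ⟨(M + 1)⁻¹, by positivity, fun y => ?_⟩
  rw [inv_mul_le_iff₀ (by positivity), ← sum_sq_coordSection hv]
  have h1 : ∀ i, y i ^ 2 ≤ (∑ k, v i k ^ 2) * ∑ k, coordSection v y k ^ 2 := by
    intro i
    conv_lhs => rw [← coordMap_coordSection hv y, coordMap_apply]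
    exact Finset.sum_mul_sq_le_sq_mul_sq _ _ _
  have h2 := Finset.sum_le_sum fun i (_ : i ∈ Finset.univ) => h1 i
  rw [← Finset.sum_mul] at h2
  have h3 : 0 ≤ ∑ k, coordSection v y k ^ 2 := by positivity
  linarith

theorem integral_gauss (d : ℕ) :
    gaussConst d * ∫ x : Fin d → ℝ, Real.exp (-(1 / 2) * ∑ i, x i ^ 2) = 1 := by
  have h1 : ∀ x : Fin d → ℝ, Real.exp (-(1 / 2) * ∑ i, x i ^ 2) =
      ∏ i, Real.exp (-(1 / 2) * x i ^ 2) := fun x => by rw [← Real.exp_sum, Finset.mul_sum]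
  simp only [h1]
  rw [integral_fintype_prod_volume_eq_pow (ι := Fin d) (fun x : ℝ => Real.exp (-(1 / 2) * x ^ 2)),
    integral_gaussian, gaussConst, Fintype.card_fin, Real.sqrt_eq_rpow, ← Real.rpow_natCast,
    ← Real.rpow_mul (by positivity), show Real.pi / (1 / 2) = 2 * Real.pi by ring,
    ← Real.rpow_add (by positivity)]
  rw [show -(d : ℝ) / 2 + 1 / 2 * d = 0 by ring, Real.rpow_zero]

end Pushforward
end
end GaussPolyhedron

namespace GaussPolyhedron
noncomputable section

/-! ### The functions `φ_F` as normalized orthant integrals -/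

section OrthantProbability

open MeasureTheory

variable {d n : ℕ}

/-- The Gram matrix `α_F(a)` with rows and columns numbered. -/
def gramFin {𝕜 : Type} [CommRing 𝕜] (F : Finset (Fin n)) (a : Fin d → Fin n → 𝕜) :
    Matrix (Fin F.card) (Fin F.card) 𝕜 := (gram a F).submatrix F.equivFin.symm F.equivFin.symm

theorem det_gramFin {𝕜 : Type} [CommRing 𝕜] (F : Finset (Fin n)) (a : Fin d → Fin n → 𝕜) :
    (gramFin F a).det = (gram a F).det := Matrix.det_submatrix_equiv_self _ _

/-- The coefficients of the quadratic exponential that is the density of the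
vector `(-f_j)_{j ∈ F}`. -/
def quadParam {𝕜 : Type} [Field 𝕜] (F : Finset (Fin n)) (p : Params 𝕜 d n) :
    Params 𝕜 F.card F.card :=
  (fun i j => (gramFin F p.1)⁻¹ i j,
    fun i => -∑ j, (gramFin F p.1)⁻¹ i j * p.2 (F.equivFin.symm j))

theorem map_ofReal_inv {ι : Type} [Fintype ι] [DecidableEq ι] (M : Matrix ι ι ℝ) :
    (M.map Complex.ofRealHom)⁻¹ = M⁻¹.map Complex.ofRealHom := by
  rw [Matrix.inv_def, Matrix.inv_def, ← RingHom.mapMatrix_apply, ← RingHom.map_det,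
    ← RingHom.map_adjugate, Ring.inverse_eq_inv', Ring.inverse_eq_inv', ← map_inv₀]
  ext i j
  simp

theorem gramFin_toComplex (F : Finset (Fin n)) (p : Params ℝ d n) :
    gramFin F (toComplex p).1 = (gramFin F p.1).map Complex.ofRealHom := by
  ext i j
  simp [gramFin, gram, toComplex]

theorem quadParam_toComplex (F : Finset (Fin n)) (p : Params ℝ d n) :
    quadParam F (toComplex p) = toComplex (quadParam F p) := by
  ext i j
  · simp only [quadParam, gramFin_toComplex, map_ofReal_inv]
    rfl
  · simp only [quadParam, gramFin_toComplex, map_ofReal_inv]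
    simp [toComplex]

/-- The columns with index in `F`. -/
def columns (F : Finset (Fin n)) (a : Fin d → Fin n → ℝ) (i : Fin F.card) (k : Fin d) : ℝ :=
  a k (F.equivFin.symm i)

theorem gramMatrix_columns (F : Finset (Fin n)) (a : Fin d → Fin n → ℝ) :
    gramMatrix (columns F a) = gramFin F a := rfl

theorem gramMatrix_inv_symm {ι : Type} [Fintype ι] [DecidableEq ι] (v : ι → Fin d → ℝ) (i j : ι) :
    (gramMatrix v)⁻¹ i j = (gramMatrix v)⁻¹ j i := by
  have h : (gramMatrix v).transpose = gramMatrix v := by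
    ext i j
    simp [gramMatrix, mul_comm]
  conv_lhs => rw [← h, ← Matrix.transpose_nonsing_inv, Matrix.transpose_apply]

theorem quadParam_mem_posDomain {F : Finset (Fin n)} {p : Params ℝ d n}
    (hp : p ∈ regularSet ℝ F) : toComplex (quadParam F p) ∈ posDomain F.card := by
  have hv : (gramMatrix (columns F p.1)).det ≠ 0 := by
    rw [gramMatrix_columns, det_gramFin]; exact hp
  obtain ⟨δ, hδ, h⟩ := exists_le_dualForm hv
  refine ⟨δ, hδ, fun y => (h y).trans (le_of_eq ?_)⟩
  simp only [dualForm, toComplex, quadParam, Complex.ofReal_re, Matrix.mulVec, dotProduct,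
    Finset.sum_mul, gramMatrix_columns]
  exact Finset.sum_congr rfl fun i _ => Finset.sum_congr rfl fun j _ => by ring

/-- The substitution reflects the scalar products to `-f_j`, which turns the region where all `f_j`
are negative into the orthant. Expanding the square gives the phase, and the term without `y` goes
into `C`. -/
theorem exp_dualForm_shift (F : Finset (Fin n)) (p : Params ℝ d n) :
    ∃ C : ℝ, ∀ y : Fin F.card → ℝ,
      (Real.exp (-(1 / 2) * dualForm (columns F p.1) ((fun i => -p.2 (F.equivFin.symm i)) - y)) : ℂ) =
        C * Complex.exp (phase y (toComplex (quadParam F p))) := by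
  set b : Fin F.card → ℝ := fun i => p.2 (F.equivFin.symm i) with hb
  refine ⟨Real.exp (-(1 / 2) * dualForm (columns F p.1) b), fun y => ?_⟩
  rw [phase_toComplex, ← Complex.ofReal_exp, ← Complex.ofReal_mul, ← Real.exp_add]
  congr 2
  have hs := gramMatrix_inv_symm (columns F p.1)
  simp only [dualForm, Matrix.mulVec, dotProduct, Finset.sum_mul, quadParam, Pi.sub_apply,
    gramMatrix_columns] at hs ⊢
  have h1 : ∑ i, ∑ j, (gramFin F p.1)⁻¹ i j * y j * b i =
      ∑ i, ∑ j, (gramFin F p.1)⁻¹ i j * b j * y i := by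
    rw [Finset.sum_comm]
    exact Finset.sum_congr rfl fun i _ => Finset.sum_congr rfl fun j _ => by rw [hs j i]; ring
  have h2 : ∀ i j, (gramFin F p.1)⁻¹ i j * (-p.2 (F.equivFin.symm j) - y j) *
      (-p.2 (F.equivFin.symm i) - y i) = (gramFin F p.1)⁻¹ i j * b j * b i +
      (gramFin F p.1)⁻¹ i j * y j * y i + (gramFin F p.1)⁻¹ i j * b j * y i +
      (gramFin F p.1)⁻¹ i j * y j * b i := fun i j => by simp only [hb]; ring
  have h3 : ∑ i, y i * -∑ j, (gramFin F p.1)⁻¹ i j * p.2 (F.equivFin.symm j) =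
      -∑ i, ∑ j, (gramFin F p.1)⁻¹ i j * b j * y i := by
    rw [← Finset.sum_neg_distrib]
    refine Finset.sum_congr rfl fun i _ => ?_
    rw [mul_neg, Finset.mul_sum]
    congr 1
    exact Finset.sum_congr rfl fun j _ => by simp only [hb]; ring
  have h4 : ∑ i, ∑ j, -(1 / 2) * (y i * y j) * (gramFin F p.1)⁻¹ i j =
      -(1 / 2) * ∑ i, ∑ j, (gramFin F p.1)⁻¹ i j * y j * y i := by
    simp only [Finset.mul_sum]
    exact Finset.sum_congr rfl fun i _ => Finset.sum_congr rfl fun j _ => by ring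
  rw [h3, h4]
  simp only [h2, Finset.sum_add_distrib, h1]
  ring

theorem heaviside_neg_sub_one (y : ℝ) : heaviside (-y) - 1 = if 0 < y then -1 else 0 := by
  unfold heaviside
  by_cases h : 0 < y
  · rw [if_neg (by linarith), if_pos h]; ring
  · rw [if_pos (by linarith), if_neg h]; ring

theorem prod_heaviside_neg_sub_one {m : ℕ} (y : Fin m → ℝ) :
    ∏ i, (heaviside (-y i) - 1) = (orthant m).indicator (fun _ => (-1 : ℝ) ^ m) y := by
  classical
  simp only [heaviside_neg_sub_one, Set.indicator_apply, orthant, Set.mem_ofPred_eq]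
  split_ifs with h
  · rw [Finset.prod_congr rfl fun i _ => if_pos (h i)]; simp
  · push Not at h
    obtain ⟨i, hi⟩ := h
    exact Finset.prod_eq_zero (Finset.mem_univ i) (if_neg hi.not_gt)

/-- The functions `φ_F` are normalized Gaussian orthant integrals. -/
theorem phiF_eq {F : Finset (Fin n)} {p : Params ℝ d n} (hp : p ∈ regularSet ℝ F) :
    (phiF F p : ℂ) = (-1) ^ F.card * (orthInt (quadParam F (toComplex p)) *
      (fullInt (quadParam F (toComplex p)))⁻¹) := by
  rw [quadParam_toComplex]
  have hv : (gramMatrix (columns F p.1)).det ≠ 0 := by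
    rw [gramMatrix_columns, det_gramFin]; exact hp
  set q := toComplex (quadParam F p) with hq
  obtain ⟨c, hc⟩ := exists_integral_coordMap hv (κ := 1 / 2) (by norm_num)
  obtain ⟨C, hC⟩ := exp_dualForm_shift F p
  set b : Fin F.card → ℝ := fun i => -p.2 (F.equivFin.symm i) with hb
  have hshift : ∀ h : (Fin F.card → ℝ) → ℝ,
      ((∫ y, Real.exp (-(1 / 2) * dualForm (columns F p.1) y) * h y : ℝ) : ℂ) =
      C * ∫ y, (h (b - y) : ℂ) * Complex.exp (phase y q) := by
    intro h
    rw [← integral_sub_left_eq_self _ volume b, ← integral_const_mul, ← integral_complex_ofReal]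
    congr 1; ext y
    rw [Complex.ofReal_mul, hC]
    ring
  -- Total mass one identifies the product of all unknown constants as the inverse of the full
  -- integral.
  have h1 : (1 : ℂ) = gaussConst d * (c * (C * fullInt q)) := by
    have h2 := integral_gauss d
    have h3 := (hc fun _ => 1).1
    simp only [mul_one] at h3
    rw [h3] at h2
    have h4 := hshift fun _ => 1
    simp only [mul_one, Complex.ofReal_one] at h4
    rw [← Complex.ofReal_one, ← h2, Complex.ofReal_mul, Complex.ofReal_mul, h4, fullInt, moment,
      Measure.restrict_univ]
  have h5 : (phiF F p : ℂ) = gaussConst d * (c * (C * ((-1) ^ F.card * orthInt q))) := by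
    have h6 := (hc fun y => ∏ i, (heaviside (y i - b i) - 1)).1
    have h7 : phiF F p = gaussConst d * ∫ x : Fin d → ℝ, Real.exp (-(1 / 2) * ∑ k, x k ^ 2) *
        ∏ i, (heaviside (coordMap (columns F p.1) x i - b i) - 1) := by
      rw [phiF, ← integral_const_mul]
      congr 1; ext x
      rw [mul_assoc, ← Finset.prod_coe_sort F, ← F.equivFin.symm.prod_comp]
      simp only [coordMap_apply, columns, linForm, hb, sub_neg_eq_add]
    rw [h7, h6, Complex.ofReal_mul, Complex.ofReal_mul, hshift]
    congr 3
    have h8 : ∀ y : Fin F.card → ℝ,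
        ((∏ i, (heaviside ((b - y) i - b i) - 1) : ℝ) : ℂ) * Complex.exp (phase y q) =
        (orthant F.card).indicator (fun y => (-1) ^ F.card * (1 * Complex.exp (phase y q))) y := by
      intro y
      have : ∀ i, (b - y) i - b i = -y i := fun i => by simp
      simp only [this, prod_heaviside_neg_sub_one]
      by_cases hy : y ∈ orthant F.card <;> simp [hy]
    simp only [h8]
    rw [integral_indicator, integral_const_mul, orthInt, moment]
    have : orthant F.card = ⋂ i, {y | 0 < y i} := by ext; simp [orthant]
    rw [this]
    exact MeasurableSet.iInter fun i => measurableSet_lt measurable_const (measurable_pi_apply i)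
  have hne : fullInt q ≠ 0 := by
    intro h0
    rw [h0] at h1
    simp at h1
  rw [h5, eq_comm, ← mul_assoc, mul_inv_eq_iff_eq_mul₀ hne]
  calc _ = (-1) ^ F.card * orthInt q * 1 := (mul_one _).symm
    _ = _ := by rw [h1]; ring

end OrthantProbability
end
end GaussPolyhedron

namespace GaussPolyhedron
noncomputable section

/-! ### Analyticity and continuation of the functions `φ_F` -/

section FaceContinuation

variable {d n : ℕ}

theorem gram_symm {𝕜 : Type} [CommRing 𝕜] (a : Fin d → Fin n → 𝕜) (F : Finset (Fin n))
    (i j : F) : gram a F i j = gram a F j i := by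
  simp [gram, mul_comm]

theorem symMatrix_quadParam (F : Finset (Fin n)) (p : Params ℂ d n) :
    symMatrix (quadParam F p) = (gramFin F p.1)⁻¹ := by
  have h : (gramFin F p.1).transpose = gramFin F p.1 := by
    ext i j
    exact gram_symm _ _ _ _
  have h2 : ∀ i j, (gramFin F p.1)⁻¹ i j = (gramFin F p.1)⁻¹ j i := fun i j => by
    conv_lhs => rw [← h, ← Matrix.transpose_nonsing_inv, Matrix.transpose_apply]
  ext i j
  simp only [symMatrix, quadParam, Matrix.of_apply]
  rw [h2 j i]; ring

/-- The principal minors of the inverse of a Gram matrix are nonzero if all Gram determinants of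
subfamilies are. -/
theorem quadParam_mem_minorDomain {F : Finset (Fin n)} {p : Params ℂ d n}
    (hp : ∀ S ⊆ F, p ∈ regularSet ℂ S) : quadParam F p ∈ minorDomain F.card := by
  classical
  intro k f hdet
  have hM : IsUnit (gramFin F p.1).det := by
    rw [isUnit_iff_ne_zero, det_gramFin]; exact hp F le_rfl
  rw [symMatrix_quadParam] at hdet
  obtain ⟨v, hv, hv0⟩ := Matrix.exists_mulVec_eq_zero_iff.2 hdet
  -- Complementary minors by kernel vectors: `w = α⁻¹ V` vanishes on the image of `f` by the choice
  -- of `v`, while `α w = V` vanishes off that image. So `w` lives on the complement `S` and is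
  -- annihilated by `α_S`, hence is zero.
  set V : Fin F.card → ℂ := Function.extend f v 0 with hV
  set w := (gramFin F p.1)⁻¹.mulVec V with hw
  have hMw : (gramFin F p.1).mulVec w = V := by
    rw [hw, Matrix.mulVec_mulVec, Matrix.mul_nonsing_inv _ hM, Matrix.one_mulVec]
  have hwf : ∀ i, w (f i) = 0 := by
    intro i
    refine Eq.trans ?_ (congrFun hv0 i)
    rw [hw]
    simp only [Matrix.mulVec, dotProduct, Matrix.submatrix_apply]
    refine (Finset.sum_of_injOn f f.injective.injOn (by simp) ?_ ?_).symm
    · intro j _ hj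
      have : ¬ ∃ a, f a = j := fun ⟨a, ha⟩ => hj ⟨a, by simp, ha⟩
      rw [hV, Function.extend_apply' _ _ _ this]; simp
    · intro j _
      rw [hV, f.injective.extend_apply]
  set u : Fin n → ℂ := fun j => if h : j ∈ F then w (F.equivFin ⟨j, h⟩) else 0 with hu
  have huF : ∀ j : F, u j = w (F.equivFin j) := fun j => by simp [hu]
  set S : Finset (Fin n) := F.filter fun j => ∀ h : j ∈ F, F.equivFin ⟨j, h⟩ ∉ Set.range f with hS
  have hu0 : ∀ j ∈ F, j ∉ S → u j = 0 := by
    intro j hj hjS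
    rw [hS, Finset.mem_filter, not_and, not_forall] at hjS
    obtain ⟨h, hr⟩ := hjS hj
    obtain ⟨i, hi⟩ := not_not.1 hr
    rw [huF ⟨j, hj⟩, ← hi, hwf]
  have hSw : (gram p.1 S).mulVec (fun j => u j) = 0 := by
    ext i
    have hiF : (i : Fin n) ∈ F := (Finset.mem_filter.1 i.2).1
    have h1 : (gram p.1 S).mulVec (fun j => u j) i =
        ∑ j ∈ S, (∑ k, p.1 k i * p.1 k j) * u j := by
      rw [← Finset.sum_coe_sort S]
      rfl
    rw [h1, Finset.sum_subset (Finset.filter_subset _ F) fun j hj hjS => by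
      rw [hu0 j hj hjS, mul_zero], ← Finset.sum_coe_sort F, ← F.equivFin.symm.sum_comp]
    have h2 := congrFun hMw (F.equivFin ⟨i, hiF⟩)
    have h3 : V (F.equivFin ⟨i, hiF⟩) = 0 := by
      rw [hV, Function.extend_apply']
      · rfl
      · exact fun ⟨a, ha⟩ => (Finset.mem_filter.1 i.2).2 hiF ⟨a, ha⟩
    rw [h3] at h2
    rw [Pi.zero_apply, ← h2]
    simp only [Matrix.mulVec, dotProduct, gramFin, Matrix.submatrix_apply, gram, Matrix.of_apply,
      Equiv.symm_apply_apply, huF, Equiv.apply_symm_apply]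
  have hS0 : (fun j : S => u j) = 0 := by
    by_contra hne
    exact hp S (Finset.filter_subset _ _) (Matrix.exists_mulVec_eq_zero_iff.1 ⟨_, hne, hSw⟩)
  have hw0 : w = 0 := by
    ext i
    have h1 : u (F.equivFin.symm i) = w i := by rw [huF]; simp
    rw [← h1]
    by_cases hiS : ((F.equivFin.symm i : F) : Fin n) ∈ S
    · exact congrFun hS0 ⟨_, hiS⟩
    · exact hu0 _ (F.equivFin.symm i).2 hiS
  rw [hw0, Matrix.mulVec_zero] at hMw
  apply hv
  ext i
  rw [← f.injective.extend_apply v 0 i, ← hV, ← hMw]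
  rfl

theorem analyticAt_gramFin (F : Finset (Fin n)) (p : Params ℂ d n) (i j : Fin F.card) :
    AnalyticAt ℂ (fun p : Params ℂ d n => gramFin F p.1 i j) p := by
  have h : ∀ (k : Fin d) (l : Fin n), AnalyticAt ℂ (fun p : Params ℂ d n => p.1 k l) p :=
    fun k l => ((ContinuousLinearMap.proj (R := ℂ) (φ := fun _ : Fin n => ℂ) l).comp
    ((ContinuousLinearMap.proj (R := ℂ) (φ := fun _ : Fin d => Fin n → ℂ) k).comp
      (ContinuousLinearMap.fst ℂ (Fin d → Fin n → ℂ) (Fin n → ℂ)))).analyticAt p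
  simp only [gramFin, gram, Matrix.submatrix_apply, Matrix.of_apply]
  exact Finset.analyticAt_fun_sum _ fun k _ => (h k _).mul (h k _)

theorem analyticAt_quadParam {F : Finset (Fin n)} {p : Params ℂ d n} (hp : p ∈ regularSet ℂ F) :
    AnalyticAt ℂ (quadParam F) p := by
  have hdet : (gramFin F p.1).det ≠ 0 := by rw [det_gramFin]; exact hp
  have hinv := analyticAt_inv (analyticAt_gramFin F p) hdet
  have hb : ∀ l : Fin n, AnalyticAt ℂ (fun p : Params ℂ d n => p.2 l) p := fun l =>
    ((ContinuousLinearMap.proj (R := ℂ) (φ := fun _ : Fin n => ℂ) l).comp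
      (ContinuousLinearMap.snd ℂ (Fin d → Fin n → ℂ) (Fin n → ℂ))).analyticAt p
  refine AnalyticAt.prod ?_ ?_
  · exact analyticAt_pi_iff.2 fun i => analyticAt_pi_iff.2 fun j => hinv i j
  · exact analyticAt_pi_iff.2 fun i =>
      (Finset.analyticAt_fun_sum _ fun j _ => (hinv i j).mul (hb _)).neg

/-- The complex-analytic function that extends `φ_F`. -/
def phiFC (F : Finset (Fin n)) (p : Params ℂ d n) : ℂ :=
  (-1) ^ F.card * (orthInt (quadParam F p) * (fullInt (quadParam F p))⁻¹)

theorem phiFC_toComplex {F : Finset (Fin n)} {p : Params ℝ d n} (hp : p ∈ regularSet ℝ F) :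
    phiFC F (toComplex p) = phiF F p := (phiF_eq hp).symm

theorem det_gram_toComplex (F : Finset (Fin n)) (p : Params ℝ d n) :
    (gram (toComplex p).1 F).det = ((gram p.1 F).det : ℂ) := by
  rw [← det_gramFin, ← det_gramFin, gramFin_toComplex, ← RingHom.mapMatrix_apply,
    ← RingHom.map_det]
  rfl

theorem toComplex_mem_regularSet {F : Finset (Fin n)} {p : Params ℝ d n}
    (hp : p ∈ regularSet ℝ F) : toComplex p ∈ regularSet ℂ F := by
  change (gram (toComplex p).1 F).det ≠ 0
  rw [det_gram_toComplex]
  exact Complex.ofReal_ne_zero.2 hp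

theorem continues_phiFC {F : Finset (Fin n)} {p : Params ℝ d n} (hp : p ∈ regularSet ℝ F) :
    Continues {q : Params ℂ d n | ∀ S ⊆ F, q ∈ regularSet ℂ S} (toComplex p) (phiFC F) := by
  have h := (continues_orthInt F.card (quadParam F p) (quadParam_mem_posDomain hp)).1
  rw [← quadParam_toComplex] at h
  exact (continues_const _).mul (h.comp (fun q hq => analyticAt_quadParam (hq F le_rfl))
    fun q hq => quadParam_mem_minorDomain hq)

theorem analyticAt_phiFC {F : Finset (Fin n)} {p : Params ℝ d n} (hp : p ∈ regularSet ℝ F) :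
    AnalyticAt ℂ (phiFC F) (toComplex p) := by
  have hq := quadParam_mem_posDomain hp
  have hne : fullInt (toComplex (quadParam F p)) ≠ 0 := by
    obtain ⟨x, hx, h⟩ := fullInt_toComplex hq
    rw [h]; exact Complex.ofReal_ne_zero.2 hx.ne'
  have h1 : AnalyticAt ℂ (fun q => orthInt q * (fullInt q)⁻¹) (quadParam F (toComplex p)) := by
    rw [quadParam_toComplex]
    exact (analyticAt_moment hq _).mul ((analyticAt_moment hq _).inv hne)
  exact analyticAt_const.mul
    (h1.comp (analyticAt_quadParam (toComplex_mem_regularSet hp)))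

/-- Complexification of parameters as a linear map. -/
def toComplexL (d n : ℕ) : Params ℝ d n →L[ℝ] Params ℂ d n :=
  (ContinuousLinearMap.pi fun i => ContinuousLinearMap.pi fun j =>
    Complex.ofRealCLM.comp ((ContinuousLinearMap.proj j).comp
      ((ContinuousLinearMap.proj i).comp (ContinuousLinearMap.fst ℝ
        (Fin d → Fin n → ℝ) _)))).prod
  (ContinuousLinearMap.pi fun j =>
    Complex.ofRealCLM.comp ((ContinuousLinearMap.proj j).comp (ContinuousLinearMap.snd ℝ _ _)))

theorem toComplexL_apply (p : Params ℝ d n) : toComplexL d n p = toComplex p := rfl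

theorem isOpen_regularSet (F : Finset (Fin n)) : IsOpen (regularSet ℝ F : Set (Params ℝ d n)) := by
  refine isOpen_ne_fun ?_ continuous_const
  refine Continuous.matrix_det ?_
  refine continuous_matrix fun i j => ?_
  simp only [gram, Matrix.of_apply]
  fun_prop

/-- Near `p` the function is the real part of the complex-analytic `phiFC` restricted to real
parameters. -/
theorem analyticAt_phiF {F : Finset (Fin n)} {p : Params ℝ d n} (hp : p ∈ regularSet ℝ F) :
    AnalyticAt ℝ (phiF F) p := by
  have h1 : AnalyticAt ℝ (phiFC F) (toComplexL d n p) := (analyticAt_phiFC hp).restrictScalars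
  have h2 := (Complex.reCLM.analyticAt _).comp (h1.comp ((toComplexL d n).analyticAt p))
  refine h2.congr ?_
  filter_upwards [(isOpen_regularSet F).mem_nhds hp] with q hq
  simp [toComplexL_apply, phiFC_toComplex hq]

end FaceContinuation
end
end GaussPolyhedron

namespace GaussPolyhedron
noncomputable section

/-! ### General position and local constancy of the nerve -/

section Nerve

variable {d n : ℕ}

theorem empty_mem_nerve {p : Params ℝ d n} {x : Fin d → ℝ} (hx : x ∈ polyhedron p) :
    ∅ ∈ nerve p := ⟨x, hx, by simp⟩

theorem mem_nerve_of_subset {p : Params ℝ d n} {J J' : Finset (Fin n)} (hJ : J ∈ nerve p)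
    (h : J' ⊆ J) : J' ∈ nerve p := by
  obtain ⟨x, hx, hxJ⟩ := hJ
  exact ⟨x, hx, fun j hj => hxJ j (h hj)⟩

theorem homForm_smul (p : Params ℝ d n) (k : Option (Fin n)) (c : ℝ) (y : ℝ × (Fin d → ℝ)) :
    homForm p k (c • y) = c * homForm p k y := by
  cases k with
  | none => simp [homForm]
  | some j =>
    simp only [homForm, Prod.smul_fst, Prod.smul_snd, Pi.smul_apply, smul_eq_mul, mul_add,
      Finset.mul_sum]
    congr 1
    · ring
    · exact Finset.sum_congr rfl fun i _ => by ring

theorem homForm_some_one (p : Params ℝ d n) (j : Fin n) (x : Fin d → ℝ) :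
    homForm p (some j) (1, x) = linForm p x j := by
  simp [homForm, linForm, add_comm]

theorem one_mem_homFace {p : Params ℝ d n} {x : Fin d → ℝ} {J : Finset (Fin n)}
    (hx : x ∈ polyhedron p) (hJ : ∀ j ∈ J, x ∈ facet p j) :
    ((1, x) : ℝ × (Fin d → ℝ)) ∈ homFace p (J.map Function.Embedding.some) := by
  constructor
  · rintro (_ | j)
    · exact zero_le_one
    · rw [homForm_some_one]; exact hx j
  · intro k hk
    obtain ⟨j, hj, rfl⟩ := Finset.mem_map.1 hk
    exact (homForm_some_one p j x).trans (hJ j hj).2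

theorem homFace_ne_zero {p : Params ℝ d n} {J : Finset (Fin n)} (hJ : J ∈ nerve p) :
    homFace p (J.map Function.Embedding.some) ≠ {0} := by
  obtain ⟨x, hx, hxJ⟩ := hJ
  intro h
  have := one_mem_homFace hx hxJ
  rw [h] at this
  exact one_ne_zero (congrArg Prod.fst this)

/-- In general position the normal vectors of the facets through a point are independent. -/
theorem mem_regularSet_of_mem_nerve {p : Params ℝ d n} (hgen : InGeneralPosition p)
    {J : Finset (Fin n)} (hJ : J ∈ nerve p) : p ∈ regularSet ℝ J := by
  classical
  intro hdet
  obtain ⟨c, hc, hc0⟩ := Matrix.exists_mulVec_eq_zero_iff.2 hdet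
  have h1 : ∀ k, ∑ j : J, p.1 k j * c j = 0 := by
    have h2 : ∑ k, (∑ j : J, p.1 k j * c j) ^ 2 = ∑ i, c i * (gram p.1 J).mulVec c i := by
      simp only [Matrix.mulVec, dotProduct, gram, Matrix.of_apply, sq,
        Finset.mul_sum, Finset.sum_mul]
      rw [Finset.sum_comm]
      refine Finset.sum_congr rfl fun i _ => ?_
      rw [Finset.sum_comm]
      exact Finset.sum_congr rfl fun j _ => Finset.sum_congr rfl fun k _ => by ring
    rw [hc0] at h2
    simp only [Pi.zero_apply, mul_zero, Finset.sum_const_zero] at h2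
    intro k
    exact pow_eq_zero_iff two_ne_zero |>.1
      ((Finset.sum_eq_zero_iff_of_nonneg fun k _ => sq_nonneg _).1 h2 k (Finset.mem_univ k))
  obtain ⟨x, hx, hxJ⟩ := id hJ
  have hb : ∑ j : J, c j * p.2 j = 0 := by
    have h3 : ∑ j : J, c j * linForm p x j = 0 :=
      Finset.sum_eq_zero fun j _ => by rw [(hxJ j j.2).2, mul_zero]
    simp only [linForm, mul_add, Finset.sum_add_distrib, Finset.mul_sum] at h3
    rw [Finset.sum_comm] at h3
    have h4 : ∑ k, ∑ j : J, c j * (p.1 k j * x k) = 0 := by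
      refine Finset.sum_eq_zero fun k _ => ?_
      rw [← zero_mul (x k), ← h1 k, Finset.sum_mul]
      exact Finset.sum_congr rfl fun j _ => by ring
    rwa [h4, zero_add] at h3
  -- All `f_j` with `j ∈ J` vanish at `x`, so the relation between the normals also annihilates the
  -- constants `b_j`. It is therefore a relation between the homogeneous forms.
  have hrel : ∀ y, ∑ j : J, c j * homForm p (some (j : Fin n)) y = 0 := by
    intro y
    simp only [homForm, mul_add, Finset.sum_add_distrib, Finset.mul_sum]
    have h4 : ∑ j : J, ∑ k, c j * (p.1 k j * y.2 k) = 0 := by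
      rw [Finset.sum_comm]
      refine Finset.sum_eq_zero fun k _ => ?_
      rw [← zero_mul (y.2 k), ← h1 k, Finset.sum_mul]
      exact Finset.sum_congr rfl fun j _ => by ring
    rw [h4, add_zero, ← zero_mul y.1, ← hb, Finset.sum_mul]
    exact Finset.sum_congr rfl fun j _ => by ring
  obtain ⟨j₀, hj₀⟩ := Function.ne_iff.1 hc
  have hsub : J.erase j₀ ∈ nerve p := mem_nerve_of_subset hJ (Finset.erase_subset _ _)
  -- The form `j₀` is redundant on this cone, so two index sets of different size cut out the same
  -- nonzero cone, contradicting the dimension count.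
  have heq : homFace p ((J.erase (j₀ : Fin n)).map Function.Embedding.some) =
      homFace p (J.map Function.Embedding.some) := by
    ext y
    constructor
    · rintro ⟨h5, h6⟩
      refine ⟨h5, fun k hk => ?_⟩
      obtain ⟨j, hj, rfl⟩ := Finset.mem_map.1 hk
      have h7 : ∀ j ∈ J, j ≠ j₀ → homForm p (some j) y = 0 := fun j hj hne =>
        h6 _ (Finset.mem_map.2 ⟨j, Finset.mem_erase.2 ⟨hne, hj⟩, rfl⟩)
      by_cases hne : j = j₀
      · subst hne
        have h8 := hrel y
        rw [Finset.sum_eq_single j₀ (fun b _ hb => by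
          rw [h7 b b.2 (fun h => hb (Subtype.ext h)), mul_zero]) (by simp)] at h8
        exact (mul_eq_zero.1 h8).resolve_left hj₀
      · exact h7 j hj hne
    · rintro ⟨h5, h6⟩
      exact ⟨h5, fun k hk => h6 k (Finset.map_subset_map.2 (Finset.erase_subset _ _) hk)⟩
  have h9 := (hgen (J.map Function.Embedding.some)).resolve_left (homFace_ne_zero hJ)
  have h10 := (hgen _).resolve_left (homFace_ne_zero hsub)
  rw [heq, Finset.card_map, Finset.card_erase_of_mem j₀.2] at h10
  rw [Finset.card_map] at h9
  have : 0 < J.card := Finset.card_pos.2 ⟨j₀, j₀.2⟩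
  omega

/-- Dehomogenization. -/
theorem mem_nerve_of_mem_homFace {p : Params ℝ d n} {J : Finset (Fin n)} {y : ℝ × (Fin d → ℝ)}
    (hy : y ∈ homFace p (J.map Function.Embedding.some)) (hy0 : y.1 ≠ 0) : J ∈ nerve p := by
  have hpos : 0 < y.1 := lt_of_le_of_ne (hy.1 none) hy0.symm
  have h1 : ∀ j, linForm p (y.1⁻¹ • y.2) j = y.1⁻¹ * homForm p (some j) y := by
    intro j
    rw [← homForm_smul, ← homForm_some_one]
    congr 1
    ext1
    · simp [hy0]
    · rfl
  have h2 : y.1⁻¹ • y.2 ∈ polyhedron p := fun j => by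
    rw [h1]; exact mul_nonneg (inv_nonneg.2 hpos.le) (hy.1 _)
  exact ⟨_, h2, fun j hj => ⟨h2, by
    have h3 := hy.2 (some j) (Finset.mem_map.2 ⟨j, hj, rfl⟩)
    rw [h1, h3, mul_zero]⟩⟩

/-- A point with `x₀ > 0` would dehomogenize to a point of the face. So `x₀` vanishes on the cone,
and adding the index of `x₀` leaves the cone unchanged although general position would lower its
dimension. -/
theorem homFace_eq_zero_of_not_mem_nerve {p : Params ℝ d n} (hgen : InGeneralPosition p)
    {J : Finset (Fin n)} (hJ : J ∉ nerve p) :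
    homFace p (J.map Function.Embedding.some) = {0} := by
  classical
  by_contra hne
  have heq : homFace p (insert none (J.map Function.Embedding.some)) =
      homFace p (J.map Function.Embedding.some) := by
    ext y
    constructor
    · rintro ⟨h5, h6⟩
      exact ⟨h5, fun k hk => h6 k (Finset.mem_insert_of_mem hk)⟩
    · intro hy
      refine ⟨hy.1, fun k hk => ?_⟩
      rcases Finset.mem_insert.1 hk with rfl | hk
      · by_contra h
        exact hJ (mem_nerve_of_mem_homFace hy h)
      · exact hy.2 k hk
  have h9 := (hgen _).resolve_left hne
  have h10 := (hgen (insert none (J.map Function.Embedding.some))).resolve_left (by rwa [heq])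
  rw [heq, Finset.card_insert_of_notMem (by simp)] at h10
  omega

theorem continuous_homForm (k : Option (Fin n)) :
    Continuous fun z : Params ℝ d n × (ℝ × (Fin d → ℝ)) => homForm z.1 k z.2 := by
  cases k <;> simp only [homForm] <;> fun_prop

/-- The cone at `p₀` misses the unit sphere. Incidence is a closed condition, and projection along
the compact sphere is closed, so nearby cones miss it too; a point of a face would give a point on
the sphere. -/
theorem eventually_not_mem_nerve {p₀ : Params ℝ d n} (hgen : InGeneralPosition p₀)
    {J : Finset (Fin n)} (hJ : J ∉ nerve p₀) : ∀ᶠ p in 𝓝 p₀, J ∉ nerve p := by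
  let C : Set (Params ℝ d n × Metric.sphere (0 : ℝ × (Fin d → ℝ)) 1) :=
    {z | (z.2 : ℝ × (Fin d → ℝ)) ∈ homFace z.1 (J.map Function.Embedding.some)}
  have hc : ∀ k, Continuous fun z : Params ℝ d n × Metric.sphere (0 : ℝ × (Fin d → ℝ)) 1 =>
      homForm z.1 k (z.2 : ℝ × (Fin d → ℝ)) := fun k =>
    (continuous_homForm k).comp (continuous_fst.prodMk (continuous_subtype_val.comp continuous_snd))
  have hC : IsClosed C := by
    have : C = (⋂ k, {z | 0 ≤ homForm z.1 k (z.2 : ℝ × (Fin d → ℝ))}) ∩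
        ⋂ k ∈ J.map Function.Embedding.some, {z | homForm z.1 k (z.2 : ℝ × (Fin d → ℝ)) = 0} := by
      ext z; simp [C, homFace]
    rw [this]
    refine IsClosed.inter (isClosed_iInter fun k => isClosed_le continuous_const (hc k))
      (isClosed_biInter fun k _ => isClosed_eq (hc k) continuous_const)
  have hcl := isClosedMap_fst_of_compactSpace (X := Params ℝ d n) _ hC
  have hp₀ : p₀ ∉ Prod.fst '' C := by
    rintro ⟨⟨p, y⟩, hy, rfl⟩
    have hy' : (y : ℝ × (Fin d → ℝ)) ∈ homFace p (J.map Function.Embedding.some) := hy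
    rw [homFace_eq_zero_of_not_mem_nerve hgen hJ] at hy'
    have := y.2
    rw [Set.mem_singleton_iff.1 hy'] at this
    simp at this
  filter_upwards [hcl.isOpen_compl.mem_nhds hp₀] with p hp hJp
  obtain ⟨x, hx, hxJ⟩ := hJp
  have h1 := one_mem_homFace hx hxJ
  have h2 : ((1, x) : ℝ × (Fin d → ℝ)) ≠ 0 := fun h => one_ne_zero (congrArg Prod.fst h)
  refine hp ⟨(p, ⟨‖((1, x) : ℝ × (Fin d → ℝ))‖⁻¹ • (1, x),
    mem_sphere_zero_iff_norm.2 (by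
      rw [norm_smul, norm_inv, norm_norm, inv_mul_cancel₀ (norm_ne_zero_iff.2 h2)])⟩), ?_, rfl⟩
  refine ⟨fun k => ?_, fun k hk => ?_⟩
  · simp only [homForm_smul]
    exact mul_nonneg (by positivity) (h1.1 k)
  · simp only [homForm_smul]
    rw [h1.2 k hk, mul_zero]

/-- The columns with index in `A`, as a family indexed by `A`. -/
def normals (p : Params ℝ d n) (A : Finset (Fin n)) (j : A) (k : Fin d) : ℝ := p.1 k j

theorem det_gramMatrix_normals {p : Params ℝ d n} {A : Finset (Fin n)} (h : p ∈ regularSet ℝ A) :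
    (gramMatrix (normals p A)).det ≠ 0 := h

theorem linForm_add (p : Params ℝ d n) (A : Finset (Fin n)) (x y : Fin d → ℝ) (j : A) :
    linForm p (x + y) j = linForm p x j + coordMap (normals p A) y j := by
  simp [linForm, coordMap_apply, normals, mul_add, Finset.sum_add_distrib]; ring

theorem continuous_linForm (j : Fin n) :
    Continuous fun z : Params ℝ d n × (Fin d → ℝ) => linForm z.1 z.2 j := by
  simp only [linForm]; fun_prop

/-- A point of the face is carried along with the parameter. All constraints active at `x₀`, not
only those in `J`, are kept active, so the others are strictly positive at `x₀` and remain so. -/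
theorem eventually_mem_nerve {p₀ : Params ℝ d n} (hgen : InGeneralPosition p₀)
    {J : Finset (Fin n)} (hJ : J ∈ nerve p₀) : ∀ᶠ p in 𝓝 p₀, J ∈ nerve p := by
  classical
  obtain ⟨x₀, hx₀, hxJ⟩ := hJ
  set A : Finset (Fin n) := Finset.univ.filter fun j => linForm p₀ x₀ j = 0 with hA
  have hAn : A ∈ nerve p₀ := ⟨x₀, hx₀, fun j hj => ⟨hx₀, (Finset.mem_filter.1 hj).2⟩⟩
  have hreg := mem_regularSet_of_mem_nerve hgen hAn
  -- The correction lies in the span of the active normals and restores the active equations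
  -- exactly. It vanishes at `p₀` and is continuous there since the Gram determinant is nonzero.
  let x : Params ℝ d n → Fin d → ℝ := fun p =>
    x₀ + coordSection (normals p A) fun j => -linForm p x₀ j
  have hx0 : x p₀ = x₀ := by
    have : (fun j : A => -linForm p₀ x₀ j) = 0 := by
      ext j
      simp [(Finset.mem_filter.1 j.2).2]
    simp [x, this]
  have hcont : ContinuousAt x p₀ := by
    refine continuousAt_const.add (continuousAt_pi.2 fun k => ?_)
    simp only [coordSection_apply, Matrix.mulVec, dotProduct]
    refine tendsto_finsetSum _ fun i _ => Filter.Tendsto.mul ?_ (tendsto_finsetSum _ fun j _ =>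
      Filter.Tendsto.mul ?_ ?_)
    · exact Continuous.continuousAt (by unfold normals; fun_prop)
    · have hg : Continuous fun p : Params ℝ d n => gramMatrix (normals p A) := by
        refine continuous_matrix fun i j => ?_
        simp only [gramMatrix, normals, Matrix.of_apply]
        fun_prop
      have h1 : ContinuousAt (fun p : Params ℝ d n => (gramMatrix (normals p A)).det⁻¹ *
          (gramMatrix (normals p A)).adjugate i j) p₀ :=
        (hg.matrix_det.continuousAt.inv₀ (det_gramMatrix_normals hreg)).mul
          (hg.matrix_adjugate.matrix_elem i j).continuousAt
      refine h1.congr (Filter.Eventually.of_forall fun p => ?_)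
      simp [Matrix.inv_def]
    · exact Continuous.continuousAt (by simp only [linForm]; fun_prop)
  have hpos : ∀ j, j ∉ A → ∀ᶠ p in 𝓝 p₀, 0 < linForm p (x p) j := by
    intro j hj
    have h1 : ContinuousAt (fun p => linForm p (x p) j) p₀ :=
      (continuous_linForm j).continuousAt.comp (continuousAt_id.prodMk hcont)
    refine h1.eventually_const_lt ?_
    show 0 < linForm p₀ (x p₀) j
    rw [hx0]
    refine lt_of_le_of_ne (hx₀ j) fun h => hj ?_
    exact Finset.mem_filter.2 ⟨Finset.mem_univ j, h.symm⟩
  have hpos' : ∀ᶠ p in 𝓝 p₀, ∀ j, j ∉ A → 0 < linForm p (x p) j :=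
    Filter.eventually_all.2 fun j => by
      by_cases hj : j ∈ A
      · exact Filter.Eventually.of_forall fun p h => absurd hj h
      · exact (hpos j hj).mono fun p h _ => h
  filter_upwards [hpos', (isOpen_regularSet A).mem_nhds hreg] with p hp hpA
  have h0 : ∀ j ∈ A, linForm p (x p) j = 0 := by
    intro j hj
    have := linForm_add p A x₀ (coordSection (normals p A) fun j => -linForm p x₀ j) ⟨j, hj⟩
    rw [coordMap_coordSection (det_gramMatrix_normals hpA)] at this
    exact this.trans (add_neg_cancel _)
  have hmem : x p ∈ polyhedron p := fun j => by
    by_cases hj : j ∈ A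
    · exact (h0 j hj).ge
    · exact (hp j hj).le
  refine ⟨x p, hmem, fun j hj => ⟨hmem, h0 j ?_⟩⟩
  exact Finset.mem_filter.2 ⟨Finset.mem_univ j, (hxJ j hj).2⟩

/-- The nerve is locally constant at a parameter in general position. -/
theorem eventually_nerve_eq {p₀ : Params ℝ d n} (hgen : InGeneralPosition p₀) :
    ∀ᶠ p in 𝓝 p₀, nerve p = nerve p₀ := by
  have : ∀ᶠ p in 𝓝 p₀, ∀ J, J ∈ nerve p ↔ J ∈ nerve p₀ :=
    Filter.eventually_all.2 fun J => by
      by_cases hJ : J ∈ nerve p₀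
      · exact (eventually_mem_nerve hgen hJ).mono fun p h => ⟨fun _ => hJ, fun _ => h⟩
      · exact (eventually_not_mem_nerve hgen hJ).mono fun p h =>
          ⟨fun h' => absurd h' h, fun h' => absurd h' hJ⟩
  exact this.mono fun p h => Set.ext h

end Nerve
end
end GaussPolyhedron

namespace GaussPolyhedron
noncomputable section

/-! ### Inclusion-exclusion over the nerve by nearest points -/

section Tube

variable {d n : ℕ} (p : Params ℝ d n)

theorem heaviside_sub_one (y : ℝ) : heaviside y - 1 = if y < 0 then -1 else 0 := by
  unfold heaviside
  by_cases h : y < 0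
  · rw [if_neg (by linarith), if_pos h]; ring
  · rw [if_pos (by linarith), if_neg h]; ring

/-- The face of the polyhedron on which the constraints with index in `F` are active. -/
def commonFace (F : Finset (Fin n)) : Set (Fin d → ℝ) :=
  {w | w ∈ polyhedron p ∧ ∀ j ∈ F, linForm p w j = 0}

/-- `y` is the nearest point to `x` in a face of the polyhedron. -/
def IsNearest (x : Fin d → ℝ) (F : Finset (Fin n)) (y : Fin d → ℝ) : Prop :=
  y ∈ commonFace p F ∧ ∀ w ∈ commonFace p F, ∑ k, (x k - y k) * (w k - y k) ≤ 0

/-- The active constraints at a point. -/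
def activeSet (y : Fin d → ℝ) : Finset (Fin n) :=
  Finset.univ.filter fun j => linForm p y j = 0

/-- The coefficients of `y - x` in terms of the active normals at `y`. -/
def multiplier (x y : Fin d → ℝ) : activeSet p y → ℝ :=
  (gramMatrix (normals p (activeSet p y)))⁻¹.mulVec (coordMap (normals p (activeSet p y)) (y - x))

variable {p}

theorem mem_activeSet {y : Fin d → ℝ} {j : Fin n} : j ∈ activeSet p y ↔ linForm p y j = 0 := by
  simp [activeSet]

theorem activeSet_mem_nerve {y : Fin d → ℝ} (hy : y ∈ polyhedron p) :
    activeSet p y ∈ nerve p := ⟨y, hy, fun _ hj => ⟨hy, mem_activeSet.1 hj⟩⟩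

theorem convex_commonFace (F : Finset (Fin n)) : Convex ℝ (commonFace p F) := by
  have key : ∀ (x y : Fin d → ℝ) (a b : ℝ), a + b = 1 → ∀ j,
      linForm p (a • x + b • y) j = a * linForm p x j + b * linForm p y j := by
    intro x y a b hab j
    simp only [linForm, Pi.add_apply, Pi.smul_apply, smul_eq_mul, mul_add, Finset.sum_add_distrib,
      Finset.mul_sum]
    have : p.2 j = a * p.2 j + b * p.2 j := by rw [← add_mul, hab, one_mul]
    rw [this, add_add_add_comm, ← this]
    congr 2 <;> exact Finset.sum_congr rfl fun k _ => by ring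
  rintro x ⟨hx, hx'⟩ y ⟨hy, hy'⟩ a b ha hb hab
  refine ⟨fun j => ?_, fun j hj => ?_⟩
  · rw [key x y a b hab]
    exact add_nonneg (mul_nonneg ha (hx j)) (mul_nonneg hb (hy j))
  · rw [key x y a b hab, hx' j hj, hy' j hj]; ring

theorem isClosed_commonFace (F : Finset (Fin n)) : IsClosed (commonFace p F) := by
  have h : ∀ j, Continuous fun w => linForm p w j := fun j =>
    (continuous_linForm j).comp (Continuous.prodMk_right p)
  have : commonFace p F = (⋂ j, {w | 0 ≤ linForm p w j}) ∩ ⋂ j ∈ F, {w | linForm p w j = 0} := by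
    ext w; simp [commonFace, polyhedron]
  rw [this]
  exact (isClosed_iInter fun j => isClosed_le continuous_const (h j)).inter
    (isClosed_biInter fun j _ => isClosed_eq (h j) continuous_const)

theorem exists_isNearest (x : Fin d → ℝ) {F : Finset (Fin n)} (hF : F ∈ nerve p) :
    ∃ y, IsNearest p x F y := by
  obtain ⟨z, hz, hzF⟩ := hF
  let K : Set (EuclideanSpace ℝ (Fin d)) := (fun w => w.ofLp) ⁻¹' commonFace p F
  have hcl : IsClosed K := (isClosed_commonFace F).preimage (PiLp.continuous_ofLp 2 _)
  have hcv : Convex ℝ K := fun a ha b hb s t hs ht hst => convex_commonFace F ha hb hs ht hst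
  obtain ⟨y, hy, hmin⟩ := exists_norm_eq_iInf_of_complete_convex (K := K)
    ⟨WithLp.toLp 2 z, hz, fun j hj => (hzF j hj).2⟩ hcl.isComplete hcv (WithLp.toLp 2 x)
  rw [norm_eq_iInf_iff_real_inner_le_zero hcv hy] at hmin
  refine ⟨y.ofLp, hy, fun w hw => ?_⟩
  have := hmin (WithLp.toLp 2 w) hw
  simpa [PiLp.inner_apply, mul_comm] using this

theorem IsNearest.unique {x y y' : Fin d → ℝ} {F : Finset (Fin n)} (h : IsNearest p x F y)
    (h' : IsNearest p x F y') : y = y' := by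
  have h1 := add_nonpos (h.2 y' h'.1) (h'.2 y h.1)
  rw [← Finset.sum_add_distrib] at h1
  have h2 : ∑ k, (y k - y' k) ^ 2 ≤ 0 :=
    (Finset.sum_le_sum fun k _ => by nlinarith).trans h1
  have h3 := (Finset.sum_eq_zero_iff_of_nonneg fun k _ => sq_nonneg _).1
    (le_antisymm h2 (Finset.sum_nonneg fun k _ => sq_nonneg _))
  exact funext fun k => sub_eq_zero.1 (pow_eq_zero_iff two_ne_zero |>.1 (h3 k (Finset.mem_univ k)))

/-- Feasible directions at the nearest point do not lead towards `x`. -/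
theorem IsNearest.sum_nonneg {x y w : Fin d → ℝ} {F : Finset (Fin n)} (h : IsNearest p x F y)
    (hw : ∀ i, 0 ≤ coordMap (normals p (activeSet p y)) w i)
    (hwF : ∀ i : activeSet p y, (i : Fin n) ∈ F → coordMap (normals p (activeSet p y)) w i = 0) :
    0 ≤ ∑ k, (y k - x k) * w k := by
  have hline : ∀ (s : ℝ) (j : activeSet p y), linForm p (y + s • w) j =
      s * coordMap (normals p (activeSet p y)) w j := fun s j => by
    rw [linForm_add, mem_activeSet.1 j.2, map_smul, zero_add]; rfl
  have h1 : ∀ᶠ s in 𝓝[>] (0 : ℝ), ∀ j, j ∉ activeSet p y → 0 ≤ linForm p (y + s • w) j := by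
    refine Filter.eventually_all.2 fun j => ?_
    by_cases hj : j ∈ activeSet p y
    · exact Filter.Eventually.of_forall fun _ h => absurd hj h
    · have hc : Continuous fun s : ℝ => linForm p (y + s • w) j := by
        simp only [linForm, Pi.add_apply, Pi.smul_apply]; fun_prop
      have h2 : 0 < linForm p (y + (0 : ℝ) • w) j := by
        rw [zero_smul, add_zero]
        exact lt_of_le_of_ne (h.1.1 j) fun h => hj (mem_activeSet.2 h.symm)
      exact ((hc.continuousAt.eventually_const_lt h2).filter_mono nhdsWithin_le_nhds).mono
        fun s hs _ => hs.le
  obtain ⟨s, hs, hs0⟩ := (h1.and self_mem_nhdsWithin).exists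
  have hs0 : 0 < s := hs0
  have hmem : y + s • w ∈ commonFace p F := by
    refine ⟨fun j => ?_, fun j hj => ?_⟩
    · by_cases hj : j ∈ activeSet p y
      · exact (hline s ⟨j, hj⟩).symm ▸ mul_nonneg hs0.le (hw _)
      · exact hs j hj
    · have hj' : j ∈ activeSet p y := mem_activeSet.2 (h.1.2 j hj)
      exact (hline s ⟨j, hj'⟩).trans (by rw [hwF ⟨j, hj'⟩ hj, mul_zero])
  have h3 := h.2 _ hmem
  have h4 : ∑ k, (x k - y k) * ((y + s • w) k - y k) = -(s * ∑ k, (y k - x k) * w k) := by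
    rw [Finset.mul_sum, ← Finset.sum_neg_distrib]
    exact Finset.sum_congr rfl fun k _ => by simp; ring
  rw [h4, neg_nonpos] at h3
  exact nonneg_of_mul_nonneg_right h3 hs0

/-- The Kuhn-Tucker conditions: `y - x` is a combination of the active normals, with a sign
condition for those constraints that are not imposed as equations. -/
theorem IsNearest.multiplier_spec (hreg : ∀ J ∈ nerve p, p ∈ regularSet ℝ J)
    {x y : Fin d → ℝ} {F : Finset (Fin n)} (h : IsNearest p x F y) :
    (∀ z, ∑ k, (y k - x k) * z k =
      ∑ i, multiplier p x y i * coordMap (normals p (activeSet p y)) z i) ∧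
    ∀ i : activeSet p y, (i : Fin n) ∉ F → 0 ≤ multiplier p x y i := by
  have hv := det_gramMatrix_normals (hreg _ (activeSet_mem_nerve h.1.1))
  set v := normals p (activeSet p y) with hvdef
  set s := coordSection v (coordMap v (y - x)) with hs
  have hsz : ∀ z, ∑ k, s k * z k = ∑ i, multiplier p x y i * coordMap v z i := fun z =>
    sum_coordSection_mul v _ z
  -- The part of `y - x` orthogonal to the active normals. Moving along `-r` keeps all active
  -- equations, so minimality gives `0 ≤ -|r|²`.
  set r := (y - x) - s with hr
  have hr0 : coordMap v r = 0 := by rw [hr, map_sub, hs, coordMap_coordSection hv, sub_self]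
  have h1 : 0 ≤ ∑ k, (y k - x k) * (-r) k :=
    h.sum_nonneg (fun i => by rw [map_neg, hr0]; simp) (fun i _ => by rw [map_neg, hr0]; simp)
  have h2 : ∑ k, s k * r k = 0 := by rw [hsz, hr0]; simp
  have h3 : ∑ k, r k ^ 2 ≤ 0 := by
    have : ∑ k, (y k - x k) * (-r) k = -(∑ k, s k * r k) - ∑ k, r k ^ 2 := by
      rw [← Finset.sum_neg_distrib, ← Finset.sum_sub_distrib]
      refine Finset.sum_congr rfl fun k _ => ?_
      have : y k - x k = r k + s k := by simp [hr]
      rw [this, Pi.neg_apply]; ring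
    rw [this, h2] at h1
    linarith
  have h4 : ∀ k, y k - x k = s k := fun k => by
    have := (Finset.sum_eq_zero_iff_of_nonneg fun k _ => sq_nonneg (r k)).1
      (le_antisymm h3 (Finset.sum_nonneg fun k _ => sq_nonneg _)) k (Finset.mem_univ k)
    have := pow_eq_zero_iff two_ne_zero |>.1 this
    simp only [hr, Pi.sub_apply] at this
    linarith
  have h5 : ∀ z, ∑ k, (y k - x k) * z k = ∑ i, multiplier p x y i * coordMap v z i := fun z => by
    simp only [h4, hsz]
  refine ⟨h5, fun i hi => ?_⟩
  -- The dual vector raises the single constraint `i` and fixes the other active ones. It is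
  -- feasible when `i ∉ F`, and pairing it with `y - x` reads off the multiplier.
  have h6 : coordMap v (coordSection v (Pi.single i 1)) = Pi.single i 1 :=
    coordMap_coordSection hv _
  have h7 := h.sum_nonneg (w := coordSection v (Pi.single i 1))
    (fun j => by
      rw [← hvdef, h6]
      exact (Pi.single_nonneg.2 zero_le_one : (0 : activeSet p y → ℝ) ≤ Pi.single i 1) j)
    (fun j hj => by
      rw [← hvdef, h6]
      exact Pi.single_eq_of_ne (by rintro rfl; exact hi hj) _)
  rw [h5, h6] at h7
  simpa [Pi.single_apply] using h7

/-- The converse of the Kuhn-Tucker conditions, with a face `G` that may differ from the one that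
produced `y`. -/
theorem isNearest_of_multiplier {x y : Fin d → ℝ} {G : Finset (Fin n)} (hy : y ∈ polyhedron p)
    (hG : G ⊆ activeSet p y)
    (h1 : ∀ z, ∑ k, (y k - x k) * z k =
      ∑ i, multiplier p x y i * coordMap (normals p (activeSet p y)) z i)
    (h2 : ∀ i : activeSet p y, (i : Fin n) ∉ G → 0 ≤ multiplier p x y i) : IsNearest p x G y := by
  refine ⟨⟨hy, fun j hj => mem_activeSet.1 (hG hj)⟩, fun w hw => ?_⟩
  have h3 := h1 (w - y)
  have h4 : ∀ i, coordMap (normals p (activeSet p y)) (w - y) i = linForm p w i := fun i => by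
    have := linForm_add p (activeSet p y) y (w - y) i
    rw [add_sub_cancel, mem_activeSet.1 i.2, zero_add] at this
    exact this.symm
  have h5 : 0 ≤ ∑ k, (y k - x k) * (w - y) k := by
    rw [h3]
    refine Finset.sum_nonneg fun i _ => ?_
    rw [h4]
    by_cases hi : (i : Fin n) ∈ G
    · rw [hw.2 i hi, mul_zero]
    · exact mul_nonneg (h2 i hi) (hw.1 i)
  have h6 : ∑ k, (x k - y k) * (w k - y k) = -∑ k, (y k - x k) * (w - y) k := by
    rw [← Finset.sum_neg_distrib]
    exact Finset.sum_congr rfl fun k _ => by simp only [Pi.sub_apply]; ring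
  rw [h6]; linarith

/-- An index whose membership can be changed without changing the nearest point. -/
def IsFree (p : Params ℝ d n) (x y : Fin d → ℝ) (j : Fin n) : Prop :=
  linForm p x j < 0 ∧ ∃ hj : j ∈ activeSet p y, 0 ≤ multiplier p x y ⟨j, hj⟩

/-- Pairing `y - x` with itself gives `-∑ μ_i f_i(x)` over the active `i`. Without a free index
every term is nonpositive: where `f_i(x) < 0` the multiplier is negative, and elsewhere `i ∉ F`
makes it nonnegative. Then `y = x` would lie in the polyhedron. -/
theorem IsNearest.exists_isFree (hreg : ∀ J ∈ nerve p, p ∈ regularSet ℝ J)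
    {x y : Fin d → ℝ} {F : Finset (Fin n)} (h : IsNearest p x F y)
    (hF : ∀ j ∈ F, linForm p x j < 0) (hx : x ∉ polyhedron p) : ∃ j, IsFree p x y j := by
  by_contra hcon
  obtain ⟨h1, h2⟩ := h.multiplier_spec hreg
  have h3 := h1 (y - x)
  have h4 : ∀ i : activeSet p y, multiplier p x y i *
      coordMap (normals p (activeSet p y)) (y - x) i ≤ 0 := by
    intro i
    have h5 := linForm_add p (activeSet p y) x (y - x) i
    rw [add_sub_cancel, mem_activeSet.1 i.2] at h5
    have h6 : coordMap (normals p (activeSet p y)) (y - x) i = -linForm p x i := by linarith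
    rw [h6]
    by_cases hi : linForm p x i < 0
    · have h7 : multiplier p x y i < 0 := by
        by_contra h8
        exact hcon ⟨i, hi, i.2, not_lt.1 h8⟩
      nlinarith
    · have := h2 i fun hiF => hi (hF i hiF)
      nlinarith
  have h5 : ∑ k, (y k - x k) ^ 2 ≤ 0 := by
    simp only [sq]
    exact h3.le.trans (Finset.sum_nonpos fun i _ => h4 i)
  have h6 := (Finset.sum_eq_zero_iff_of_nonneg fun k _ => sq_nonneg (y k - x k)).1
    (le_antisymm h5 (Finset.sum_nonneg fun k _ => sq_nonneg _))
  have : y = x := funext fun k =>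
    sub_eq_zero.1 (pow_eq_zero_iff two_ne_zero |>.1 (h6 k (Finset.mem_univ k)))
  exact hx (this ▸ h.1.1)

/-- Insert or remove an element. -/
def toggle (F : Finset (Fin n)) (j : Fin n) : Finset (Fin n) :=
  if j ∈ F then F.erase j else insert j F

theorem toggle_toggle (F : Finset (Fin n)) (j : Fin n) : toggle (toggle F j) j = F := by
  unfold toggle
  by_cases h : j ∈ F <;> simp [h]

theorem mem_toggle_of_ne {F : Finset (Fin n)} {i j : Fin n} (h : i ≠ j) :
    i ∈ toggle F j ↔ i ∈ F := by
  unfold toggle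
  split_ifs <;> simp [h]

theorem pow_card_add_toggle (F : Finset (Fin n)) (j : Fin n) :
    (-1 : ℝ) ^ F.card + (-1) ^ (toggle F j).card = 0 := by
  unfold toggle
  by_cases h : j ∈ F
  · rw [if_pos h, ← Finset.card_erase_add_one h, pow_succ]; ring
  · rw [if_neg h, Finset.card_insert_of_notMem h, pow_succ]; ring

/-- At a fixed `y`, changing `F` changes only which multipliers must be nonnegative. A free index is
active with nonnegative multiplier, so it may be in `F` or not. -/
theorem IsNearest.toggle (hreg : ∀ J ∈ nerve p, p ∈ regularSet ℝ J)
    {x y : Fin d → ℝ} {F : Finset (Fin n)} {j : Fin n}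
    (h : IsNearest p x F y) (hj : IsFree p x y j) : IsNearest p x (toggle F j) y := by
  obtain ⟨h1, h2⟩ := h.multiplier_spec hreg
  obtain ⟨-, hjA, hj0⟩ := hj
  refine isNearest_of_multiplier h.1.1 (fun i hi => ?_) h1 fun i hi => ?_
  · by_cases hij : i = j
    · exact hij ▸ hjA
    · exact mem_activeSet.2 (h.1.2 i ((mem_toggle_of_ne hij).1 hi))
  · by_cases hij : (i : Fin n) = j
    · subst hij; exact hj0
    · exact h2 i fun h => hi ((mem_toggle_of_ne hij).2 h)

/-- The indicator function of a simple polyhedron as a sum over its nerve. -/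
theorem prod_heaviside_eq_sum [DecidablePred (· ∈ nerve p)] (hreg : ∀ J ∈ nerve p, p ∈ regularSet ℝ J) (x : Fin d → ℝ) :
    ∏ j, heaviside (linForm p x j) =
      ∑ F : Finset (Fin n) with F ∈ nerve p, ∏ j ∈ F, (heaviside (linForm p x j) - 1) := by
  classical
  have hterm : ∀ F : Finset (Fin n), ∏ j ∈ F, (heaviside (linForm p x j) - 1) =
      if ∀ j ∈ F, linForm p x j < 0 then (-1) ^ F.card else 0 := by
    intro F
    simp only [heaviside_sub_one]
    split_ifs with h
    · rw [Finset.prod_congr rfl fun j hj => if_pos (h j hj), Finset.prod_const]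
    · push Not at h
      obtain ⟨j, hj, hj0⟩ := h
      exact Finset.prod_eq_zero hj (if_neg (not_lt.2 hj0))
  simp only [hterm]
  rw [← Finset.sum_filter, Finset.filter_filter]
  by_cases hx : x ∈ polyhedron p
  · have h1 : (Finset.univ.filter fun F : Finset (Fin n) =>
        F ∈ nerve p ∧ ∀ j ∈ F, linForm p x j < 0) = {∅} := by
      ext F
      simp only [Finset.mem_filter, Finset.mem_univ, true_and, Finset.mem_singleton]
      constructor
      · rintro ⟨-, h⟩
        exact Finset.eq_empty_of_forall_notMem fun j hj => (h j hj).not_ge (hx j)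
      · rintro rfl
        exact ⟨empty_mem_nerve hx, by simp⟩
    rw [h1, Finset.sum_singleton, Finset.card_empty, pow_zero]
    exact Finset.prod_eq_one fun j _ => if_pos (hx j)
  · have h1 : ∏ j, heaviside (linForm p x j) = 0 := by
      have : ∃ j, linForm p x j < 0 := by
        by_contra h
        push Not at h
        exact hx h
      obtain ⟨j, hj⟩ := this
      exact Finset.prod_eq_zero (Finset.mem_univ j) (if_neg (not_le.2 hj))
    rw [h1]
    symm
    set T := Finset.univ.filter fun F : Finset (Fin n) =>
      F ∈ nerve p ∧ ∀ j ∈ F, linForm p x j < 0 with hT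
    have hmem : ∀ F ∈ T, F ∈ nerve p ∧ ∀ j ∈ F, linForm p x j < 0 := fun F hF =>
      (Finset.mem_filter.1 hF).2
    choose! y hy using fun (F : Finset (Fin n)) (hF : F ∈ T) => exists_isNearest x (hmem F hF).1
    have hne' : ∃ j : Fin n, linForm p x j < 0 := by
      by_contra h
      push Not at h
      exact hx h
    obtain ⟨j₀, -⟩ := hne'
    -- The toggled index is a function of the nearest point alone. Since toggling preserves that
    -- point, the map on `T` is an involution.
    let J : (Fin d → ℝ) → Fin n := fun z => if h : ∃ j, IsFree p x z j then h.choose else j₀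
    have hJ : ∀ F ∈ T, IsFree p x (y F) (J (y F)) := fun F hF => by
      have h := (hy F hF).exists_isFree hreg (hmem F hF).2 hx
      simp only [J, dif_pos h]
      exact h.choose_spec
    have hnear : ∀ F (hF : F ∈ T), IsNearest p x (toggle F (J (y F))) (y F) := fun F hF =>
      (hy F hF).toggle hreg (hJ F hF)
    have htog : ∀ F ∈ T, toggle F (J (y F)) ∈ T := fun F hF => by
      refine Finset.mem_filter.2 ⟨Finset.mem_univ _, ⟨y F, (hnear F hF).1.1, fun j hj =>
        ⟨(hnear F hF).1.1, (hnear F hF).1.2 j hj⟩⟩, fun j hj => ?_⟩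
      by_cases hij : j = J (y F)
      · exact hij ▸ (hJ F hF).1
      · exact (hmem F hF).2 j ((mem_toggle_of_ne hij).1 hj)
    have hyt : ∀ F (hF : F ∈ T), y (toggle F (J (y F))) = y F := fun F hF =>
      (hy _ (htog F hF)).unique (hnear F hF)
    refine Finset.sum_involution (fun F _ => toggle F (J (y F)))
      (fun F _ => pow_card_add_toggle F _) (fun F hF _ => ?_) htog fun F hF => ?_
    · intro h
      have := pow_card_add_toggle F (J (y F))
      rw [h] at this
      have h2 : (-1 : ℝ) ^ F.card ≠ 0 := pow_ne_zero _ (by norm_num)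
      exact h2 (by linarith)
    · simp only [hyt F hF, toggle_toggle]

end Tube
end
end GaussPolyhedron

namespace GaussPolyhedron
noncomputable section

/-! ### The sum over the nerve and the continuation of `φ` -/

section Probability

open MeasureTheory

variable {d n : ℕ}

theorem measurable_heaviside : Measurable heaviside := by
  unfold heaviside
  exact Measurable.ite measurableSet_Ici measurable_const measurable_const

theorem integrable_gauss_prod (F : Finset (Fin n)) (p : Params ℝ d n) :
    Integrable fun x : Fin d → ℝ => gaussConst d * Real.exp (-(1 / 2) * ∑ i, x i ^ 2) *
      ∏ j ∈ F, (heaviside (linForm p x j) - 1) := by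
  refine ((integrable_exp_neg_sum_sq (d := d) (κ := 1 / 2) (by norm_num)).const_mul
    (gaussConst d)).mul_bdd (c := 1) ?_ ?_
  · refine (Finset.measurable_prod _ fun j _ => Measurable.sub_const ?_ _).aestronglyMeasurable
    refine measurable_heaviside.comp (Continuous.measurable ?_)
    exact (continuous_linForm j).comp (Continuous.prodMk_right p)
  · refine Filter.Eventually.of_forall fun x => ?_
    rw [norm_prod]
    refine Finset.prod_le_one (fun _ _ => norm_nonneg _) fun j _ => ?_
    rw [heaviside_sub_one]
    split_ifs <;> simp

/-- The Gaussian probability of a simple polyhedron is a sum over its nerve. -/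
theorem phi_eq_sum {p : Params ℝ d n} [DecidablePred (· ∈ nerve p)]
    (hreg : ∀ J ∈ nerve p, p ∈ regularSet ℝ J) :
    phi p = ∑ F : Finset (Fin n) with F ∈ nerve p, phiF F p := by
  unfold phi phiF
  rw [← integral_finsetSum _ fun F _ => integrable_gauss_prod F p]
  simp only [prod_heaviside_eq_sum hreg, Finset.mul_sum]

theorem exists_analytic_continuation {p₀ : Params ℝ d n} (hgen : InGeneralPosition p₀) :
    ∃ W : Set (Params ℝ d n), IsOpen W ∧ IsConnected W ∧ p₀ ∈ W ∧
      (∀ F ∈ nerve p₀, W ⊆ regularSet ℝ F) ∧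
      AnalyticOnNhd ℝ phi W ∧
      ∀ γ : C(unitInterval, Params ℂ d n),
        (∀ t, ∀ F ∈ nerve p₀, γ t ∈ regularSet ℂ F) →
        ∀ p ∈ W, γ 0 = toComplex p →
        ∃ g : unitInterval → Params ℂ d n → ℂ, IsContinuationAlong γ g ∧
          ∀ᶠ q in 𝓝 p, g 0 (toComplex q) = (phi q : ℂ) := by
  classical
  have hreg : ∀ᶠ p in 𝓝 p₀, ∀ F, F ∈ nerve p₀ → p ∈ regularSet ℝ F := by
    refine Filter.eventually_all.2 fun F => ?_
    by_cases hF : F ∈ nerve p₀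
    · filter_upwards [(isOpen_regularSet F).mem_nhds (mem_regularSet_of_mem_nerve hgen hF)]
        with p hp _ using hp
    · exact Filter.Eventually.of_forall fun _ h => absurd h hF
  -- On this ball the nerve is that of `p₀`, so the sum for `φ` has a fixed index set.
  obtain ⟨r, hr, hW⟩ := Metric.eventually_nhds_iff_ball.1 ((eventually_nerve_eq hgen).and hreg)
  have hsum : ∀ p ∈ Metric.ball p₀ r,
      phi p = ∑ F : Finset (Fin n) with F ∈ nerve p₀, phiF F p := fun p hp => by
    obtain ⟨h1, h2⟩ := hW p hp
    rw [phi_eq_sum (by rwa [h1])]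
    simp only [h1]
  have hnhds : ∀ p ∈ Metric.ball p₀ r, Metric.ball p₀ r ∈ 𝓝 p := fun p hp =>
    Metric.isOpen_ball.mem_nhds hp
  refine ⟨Metric.ball p₀ r, Metric.isOpen_ball,
    ⟨⟨p₀, Metric.mem_ball_self hr⟩, (convex_ball p₀ r).isPreconnected⟩, Metric.mem_ball_self hr,
    fun F hF p hp => (hW p hp).2 F hF, fun p hp => ?_, fun γ hγ p hp h0 => ?_⟩
  · have h1 : AnalyticAt ℝ (fun p => ∑ F : Finset (Fin n) with F ∈ nerve p₀, phiF F p) p :=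
      Finset.analyticAt_fun_sum _ fun F hF =>
        analyticAt_phiF ((hW p hp).2 F (Finset.mem_filter.1 hF).2)
    refine h1.congr ?_
    filter_upwards [hnhds p hp] with q hq using (hsum q hq).symm
  · have h1 : Continues {q : Params ℂ d n | ∀ F ∈ nerve p₀, q ∈ regularSet ℂ F} (toComplex p)
        (fun q => ∑ F : Finset (Fin n) with F ∈ nerve p₀, phiFC F q) :=
      Continues.sum _ fun F hF =>
        (continues_phiFC ((hW p hp).2 F (Finset.mem_filter.1 hF).2)).mono fun q hq S hS =>
          hq S (mem_nerve_of_subset (Finset.mem_filter.1 hF).2 hS)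
    obtain ⟨g, hg, hg0⟩ := h1 γ h0 hγ
    refine ⟨g, hg, ?_⟩
    have h2 : Filter.Tendsto (toComplex : Params ℝ d n → Params ℂ d n) (𝓝 p) (𝓝 (toComplex p)) :=
      (toComplexL d n).continuous.tendsto p
    filter_upwards [h2.eventually hg0, hnhds p hp] with q hq hq'
    rw [hq, hsum q hq', Complex.ofReal_sum]
    exact Finset.sum_congr rfl fun F hF =>
      phiFC_toComplex ((hW q hq').2 F (Finset.mem_filter.1 hF).2)

end Probability
end
end GaussPolyhedron

namespace GaussPolyhedron
noncomputable section

/-! ### Existence and invertibility of adapted frames -/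

section Frames

variable {d n : ℕ} {p : Params ℝ d n} {F : Finset (Fin n)}

theorem eq_zero_of_sum_mul_eq_zero (hp : p ∈ regularSet ℝ F) {c : F → ℝ}
    (hc : ∀ k, ∑ j : F, p.1 k j * c j = 0) : c = 0 := by
  classical
  by_contra hne
  refine hp (Matrix.exists_mulVec_eq_zero_iff.1 ⟨c, hne, ?_⟩)
  ext i
  simp only [Matrix.mulVec, dotProduct, gram, Matrix.of_apply, Finset.sum_mul, Pi.zero_apply]
  rw [Finset.sum_comm]
  refine Finset.sum_eq_zero fun k _ => ?_
  rw [← mul_zero (p.1 k i), ← hc k, Finset.mul_sum]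
  exact Finset.sum_congr rfl fun j _ => by ring

/-- Pairing a linear relation between the columns with an orthonormal column isolates its
coefficient. The rest is a relation between the independent columns `a_j`. -/
theorem IsAdaptedFrame.det_ne_zero (hp : p ∈ regularSet ℝ F) {e : F ↪ Fin d}
    {u : Matrix (Fin d) (Fin d) ℝ} (h : IsAdaptedFrame p.1 F e u) : u.det ≠ 0 := by
  classical
  intro hdet
  obtain ⟨c, hc, hc0⟩ := Matrix.exists_mulVec_eq_zero_iff.2 hdet
  have hrow : ∀ i, ∑ k, u i k * c k = 0 := fun i => congrFun hc0 i
  have hoff : ∀ l, l ∉ Set.range e → c l = 0 := by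
    intro l hl
    have h1 : ∑ i, u i l * ∑ k, u i k * c k = 0 := by simp [hrow]
    simp only [Finset.mul_sum] at h1
    rw [Finset.sum_comm] at h1
    have h2 : ∀ k, ∑ i, u i l * (u i k * c k) = if k = l then c l else 0 := by
      intro k
      have h3 : ∑ i, u i l * (u i k * c k) = (∑ i, u i l * u i k) * c k := by
        rw [Finset.sum_mul]
        exact Finset.sum_congr rfl fun i _ => by ring
      rw [h3]
      by_cases hk : k ∈ Set.range e
      · obtain ⟨j, rfl⟩ := hk
        simp only [h.col_eq]
        rw [h.orthogonal l hl j, zero_mul, if_neg]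
        rintro rfl
        exact hl ⟨j, rfl⟩
      · rw [h.orthonormal l hl k hk]
        by_cases hkl : k = l
        · simp [hkl]
        · simp [hkl, Ne.symm hkl]
    simpa [h2] using h1
  have hon : (fun j : F => c (e j)) = 0 := by
    refine eq_zero_of_sum_mul_eq_zero hp fun k => ?_
    rw [← hrow k]
    refine Fintype.sum_of_injective e e.injective _ _ (fun l hl => by rw [hoff l hl, mul_zero])
      fun j => by rw [h.col_eq]
  refine hc (funext fun l => ?_)
  by_cases hl : l ∈ Set.range e
  · obtain ⟨j, rfl⟩ := hl
    exact congrFun hon j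
  · exact hoff l hl

theorem exists_isAdaptedFrame (hp : p ∈ regularSet ℝ F) :
    ∃ (e : F ↪ Fin d) (u : Matrix (Fin d) (Fin d) ℝ), IsAdaptedFrame p.1 F e u := by
  classical
  let A : F → EuclideanSpace ℝ (Fin d) := fun j => WithLp.toLp 2 fun i => p.1 i j
  have hA : LinearIndependent ℝ A := by
    rw [Fintype.linearIndependent_iff]
    intro c hc
    refine congrFun (eq_zero_of_sum_mul_eq_zero hp fun k => ?_)
    have := congrArg (fun x : EuclideanSpace ℝ (Fin d) => x k) hc
    simpa [A, mul_comm] using this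
  have hcard : F.card ≤ d := by simpa using hA.fintype_card_le_finrank
  let e : F ↪ Fin d := F.equivFin.toEmbedding.trans (Fin.castLEEmb hcard)
  let S := Submodule.span ℝ (Set.range A)
  -- The dimension of the orthogonal complement matches the number of free columns, so an
  -- orthonormal basis can be indexed by them.
  have hS : Module.finrank ℝ Sᗮ = Fintype.card {k // k ∉ Set.range e} := by
    have h1 : Module.finrank ℝ S = F.card := by simpa using finrank_span_eq_card hA
    have h2 := S.finrank_add_finrank_orthogonal
    have h3 : Fintype.card {k // k ∉ Set.range e} = d - F.card := by
      rw [Fintype.card_subtype_compl, Fintype.card_fin]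
      congr 1
      rw [← Fintype.card_coe F]
      exact (Fintype.card_congr (Equiv.ofInjective e e.injective)).symm
    rw [finrank_euclideanSpace_fin] at h2
    omega
  let b := (stdOrthonormalBasis ℝ Sᗮ).reindex
    (Fintype.equivOfCardEq (by rw [Fintype.card_fin, hS]) :
      Fin (Module.finrank ℝ Sᗮ) ≃ {k // k ∉ Set.range e})
  let u : Matrix (Fin d) (Fin d) ℝ := fun i k =>
    if h : k ∈ Set.range e then p.1 i h.choose else (b ⟨k, h⟩ : EuclideanSpace ℝ (Fin d)) i
  have hu : ∀ k (h : k ∉ Set.range e) i, u i k = (b ⟨k, h⟩ : EuclideanSpace ℝ (Fin d)) i :=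
    fun k h i => dif_neg h
  refine ⟨e, u, fun j i => ?_, fun k hk j => ?_, fun k hk l hl => ?_⟩
  · have h : e j ∈ Set.range e := ⟨j, rfl⟩
    have h2 : h.choose = j := e.injective h.choose_spec
    simp only [u, dif_pos h, h2]
  · have h1 : inner ℝ (A j) (b ⟨k, hk⟩ : EuclideanSpace ℝ (Fin d)) = 0 :=
      Submodule.inner_right_of_mem_orthogonal (Submodule.subset_span (Set.mem_range_self j))
        (SetLike.coe_mem _)
    simpa [hu k hk, PiLp.inner_apply, A] using h1
  · have h1 := orthonormal_iff_ite.1 b.orthonormal ⟨k, hk⟩ ⟨l, hl⟩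
    rw [Submodule.coe_inner, PiLp.inner_apply] at h1
    simp only [Subtype.mk.injEq] at h1
    rw [← h1]
    refine Finset.sum_congr rfl fun i _ => ?_
    rw [hu k hk, hu l hl]
    exact mul_comm _ _

end Frames
end
end GaussPolyhedron

namespace GaussPolyhedron
noncomputable section

/-! ### Deformation of multiple contour integrals -/

section Homotopy

open MeasureTheory

variable {d : ℕ}

/-- The point `(σ_k t_k + τ q_k(t_k))_k`. -/
def shift (σ : Fin d → ℝ) (q : Fin d → ℝ → ℂ) (τ : ℝ) (t : Fin d → ℝ) : Fin d → ℂ :=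
  fun k => σ k * t k + τ * q k (t k)

/-- The derivative of `s ↦ σ_k s + τ q_k(s)`. -/
def rate (σ : Fin d → ℝ) (q : Fin d → ℝ → ℂ) (τ : ℝ) (k : Fin d) (s : ℝ) : ℂ :=
  σ k + τ * deriv (q k) s

variable {σ : Fin d → ℝ} {q : Fin d → ℝ → ℂ} {G : (Fin d → ℂ) → ℂ}

theorem continuous_shift (hq : ∀ k, ContDiff ℝ 1 (q k)) (τ : ℝ) : Continuous (shift σ q τ) := by
  have := fun k => (hq k).continuous
  unfold shift
  fun_prop

theorem continuous_rate (hq : ∀ k, ContDiff ℝ 1 (q k)) (τ : ℝ) (k : Fin d) :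
    Continuous (rate σ q τ k) := by
  have := (hq k).continuous_deriv_one
  unfold rate
  fun_prop

theorem hasDerivAt_shift_single (hq : ∀ k, ContDiff ℝ 1 (q k)) (τ : ℝ) (t : Fin d → ℝ)
    (k : Fin d) :
    HasDerivAt (fun s : ℝ => shift σ q τ (t + s • Pi.single k 1))
      (rate σ q τ k (t k) • (Pi.single k 1 : Fin d → ℂ)) 0 := by
  refine hasDerivAt_pi.2 fun l => ?_
  by_cases hl : l = k
  · subst hl
    have h1 : HasDerivAt (fun s : ℝ => t l + s) 1 0 := (hasDerivAt_id 0).const_add (t l)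
    have h2 : HasDerivAt (q l) (deriv (q l) (t l + 0)) (t l + 0) :=
      ((hq l).differentiable one_ne_zero _).hasDerivAt
    have h3 := ((h1.ofReal_comp.const_mul (σ l : ℂ)).add
      ((h2.scomp (0 : ℝ) h1).const_mul (τ : ℂ)))
    simpa [shift, rate, Function.comp_def, Pi.add_def] using h3
  · simpa [shift, Pi.single_eq_of_ne hl] using hasDerivAt_const (0 : ℝ) (shift σ q τ t l)

theorem hasDerivAt_shift (τ : ℝ) (t : Fin d → ℝ) :
    HasDerivAt (fun τ : ℝ => shift σ q τ t) (∑ k, q k (t k) • (Pi.single k 1 : Fin d → ℂ)) τ := by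
  refine hasDerivAt_pi.2 fun l => ?_
  have h := ((hasDerivAt_id τ).ofReal_comp.mul_const (q l (t l))).const_add ((σ l : ℂ) * t l)
  simpa [shift, Finset.sum_apply, Pi.single_apply] using h

variable {M : ℝ}

theorem norm_rate_le (hσ : ∀ k, |σ k| ≤ M) (hqM' : ∀ k s, ‖deriv (q k) s‖ ≤ M)
    {τ : ℝ} (hτ : τ ∈ Set.Ioo (0 : ℝ) 2) (k : Fin d) (s : ℝ) : ‖rate σ q τ k s‖ ≤ 3 * M := by
  have h1 : ‖(σ k : ℂ)‖ ≤ M := by simpa using hσ k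
  have h2 : ‖(τ : ℂ) * deriv (q k) s‖ ≤ 2 * M := by
    rw [norm_mul, Complex.norm_real, Real.norm_eq_abs, abs_of_pos hτ.1]
    exact mul_le_mul hτ.2.le (hqM' k s) (norm_nonneg _) (by norm_num)
  exact (norm_add_le _ _).trans (by linarith)

theorem integrable_mul_prod_rate (hσ : ∀ k, |σ k| ≤ M)
    (hq : ∀ k, ContDiff ℝ 1 (q k)) (hqM' : ∀ k s, ‖deriv (q k) s‖ ≤ M)
    {τ : ℝ} (hτ : τ ∈ Set.Ioo (0 : ℝ) 2) (S : Finset (Fin d)) {f : (Fin d → ℝ) → ℂ}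
    (hf : Integrable f) : Integrable fun t => f t * ∏ k ∈ S, rate σ q τ k (t k) := by
  refine hf.mul_bdd (c := ∏ k ∈ S, (3 * M)) ?_ ?_
  · refine Continuous.aestronglyMeasurable (continuous_finsetProd _ fun k _ => ?_)
    exact (continuous_rate hq τ k).comp (continuous_apply k)
  · refine Filter.Eventually.of_forall fun t => ?_
    rw [norm_prod]
    exact Finset.prod_le_prod (fun _ _ => norm_nonneg _) fun k _ => norm_rate_le hσ hqM' hτ k _

/-- Invariance of a multiple contour integral under a homotopy of the contour in which each
coordinate of the contour depends on one variable. -/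
theorem integral_shift_eq (hM : 0 ≤ M) (hσ : ∀ k, |σ k| ≤ M) (hq : ∀ k, ContDiff ℝ 1 (q k))
    (hqM : ∀ k s, ‖q k s‖ ≤ M) (hqM' : ∀ k s, ‖deriv (q k) s‖ ≤ M)
    (hG : ∀ τ ∈ Set.Ioo (0 : ℝ) 2, ∀ t, AnalyticAt ℂ G (shift σ q τ t))
    (hB : ∀ τ₀ > 0, ∃ B : (Fin d → ℝ) → ℝ, Integrable B ∧ ∀ τ ∈ Set.Ioo τ₀ 2, ∀ t,
      ‖G (shift σ q τ t)‖ ≤ B t ∧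
        ∀ k, ‖fderiv ℂ G (shift σ q τ t) (Pi.single k 1)‖ ≤ B t)
    {τ τ' : ℝ} (hτ : τ ∈ Set.Ioo (0 : ℝ) 2) (hτ' : τ' ∈ Set.Ioo (0 : ℝ) 2) :
    ∫ t, G (shift σ q τ t) * ∏ k, rate σ q τ k (t k) =
      ∫ t, G (shift σ q τ' t) * ∏ k, rate σ q τ' k (t k) := by
  classical
  have hcG : ∀ τ ∈ Set.Ioo (0 : ℝ) 2, Continuous fun t => G (shift σ q τ t) := fun τ hτ =>
    continuous_iff_continuousAt.2 fun t =>
      (hG τ hτ t).continuousAt.comp (continuous_shift hq τ).continuousAt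
  have hcG' : ∀ τ ∈ Set.Ioo (0 : ℝ) 2, ∀ k,
      Continuous fun t => fderiv ℂ G (shift σ q τ t) (Pi.single k 1) := fun τ hτ k =>
    continuous_iff_continuousAt.2 fun t =>
      ((hG τ hτ t).fderiv.continuousAt.comp (continuous_shift hq τ).continuousAt).clm_apply
        continuousAt_const
  have hpiece : ∀ τ ∈ Set.Ioo (0 : ℝ) 2, Integrable (fun t => G (shift σ q τ t)) ∧
      ∀ k, Integrable fun t => fderiv ℂ G (shift σ q τ t) (Pi.single k 1) := by
    intro τ hτ
    obtain ⟨B, hBi, hB⟩ := hB (τ / 2) (by linarith [hτ.1])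
    have hτ2 : τ ∈ Set.Ioo (τ / 2) 2 := ⟨by linarith [hτ.1], hτ.2⟩
    exact ⟨hBi.mono' (hcG τ hτ).aestronglyMeasurable (Filter.Eventually.of_forall fun t =>
      (hB τ hτ2 t).1), fun k => hBi.mono' (hcG' τ hτ k).aestronglyMeasurable
        (Filter.Eventually.of_forall fun t => (hB τ hτ2 t).2 k)⟩
  -- the derivative of the integrand in the homotopy parameter
  let D : ℝ → (Fin d → ℝ) → Fin d → ℂ := fun τ t k =>
    (fderiv ℂ G (shift σ q τ t) (Pi.single k 1) * rate σ q τ k (t k) * q k (t k) +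
      G (shift σ q τ t) * deriv (q k) (t k)) * ∏ l ∈ Finset.univ.erase k, rate σ q τ l (t l)
  have hderiv : ∀ τ ∈ Set.Ioo (0 : ℝ) 2, ∀ t,
      HasDerivAt (fun τ => G (shift σ q τ t) * ∏ k, rate σ q τ k (t k)) (∑ k, D τ t k) τ := by
    intro τ hτ t
    have h1 := ((hG τ hτ t).differentiableAt.hasFDerivAt.restrictScalars ℝ).comp_hasDerivAt τ
      (hasDerivAt_shift τ t)
    have h2 : ∀ k, HasDerivAt (fun τ : ℝ => rate σ q τ k (t k)) (deriv (q k) (t k)) τ := fun k => by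
      simpa [rate] using ((hasDerivAt_id τ).ofReal_comp.mul_const (deriv (q k) (t k))).const_add
        (σ k : ℂ)
    have h3 := h1.mul (HasDerivAt.fun_finsetProd (u := Finset.univ) fun k _ => h2 k)
    refine h3.congr_deriv ?_
    simp only [ContinuousLinearMap.coe_restrictScalars', map_sum, map_smul, smul_eq_mul, D,
      Function.comp_def, Finset.sum_mul, Finset.mul_sum]
    rw [← Finset.sum_add_distrib]
    refine Finset.sum_congr rfl fun k _ => ?_
    rw [← Finset.mul_prod_erase Finset.univ _ (Finset.mem_univ k)]
    ring
  -- The `k`-th part `D τ t k` of the `τ`-derivative is a partial derivative in `t k`. This uses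
  -- that the rates for `l ≠ k` do not involve `t k`.
  have hline : ∀ τ ∈ Set.Ioo (0 : ℝ) 2, ∀ k t, HasLineDerivAt ℝ
      (fun t => G (shift σ q τ t) * q k (t k) * ∏ l ∈ Finset.univ.erase k, rate σ q τ l (t l))
      (D τ t k) t (Pi.single k 1) := by
    intro τ hτ k t
    have h0 : HasFDerivAt G (fderiv ℂ G (shift σ q τ t))
        (shift σ q τ (t + (0 : ℝ) • Pi.single k 1)) := by
      simpa using (hG τ hτ t).differentiableAt.hasFDerivAt
    have h1 := (h0.restrictScalars ℝ).comp_hasDerivAt (0 : ℝ) (hasDerivAt_shift_single hq τ t k)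
    have h2 : HasDerivAt (fun s : ℝ => q k (t k + s)) (deriv (q k) (t k)) 0 := by
      have h3 : HasDerivAt (q k) (deriv (q k) (t k + 0)) (t k + 0) :=
        ((hq k).differentiable one_ne_zero _).hasDerivAt
      simpa using h3.comp_const_add (t k) 0
    have h4 := (h1.mul h2).mul_const (∏ l ∈ Finset.univ.erase k, rate σ q τ l (t l))
    have h5 : HasDerivAt (fun s : ℝ => G (shift σ q τ (t + s • Pi.single k 1)) *
        q k ((t + s • Pi.single k (1 : ℝ) : Fin d → ℝ) k) *
        ∏ l ∈ Finset.univ.erase k, rate σ q τ l ((t + s • Pi.single k (1 : ℝ) : Fin d → ℝ) l)) (D τ t k) 0 := by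
      refine (h4.congr_of_eventuallyEq (Filter.Eventually.of_forall fun s => ?_)).congr_deriv ?_
      · have : ∏ l ∈ Finset.univ.erase k, rate σ q τ l ((t + s • Pi.single k (1 : ℝ) : Fin d → ℝ) l) =
            ∏ l ∈ Finset.univ.erase k, rate σ q τ l (t l) :=
          Finset.prod_congr rfl fun l hl => by
            simp [Pi.single_eq_of_ne (Finset.ne_of_mem_erase hl)]
        rw [this]; simp
      · simp [D, mul_comm (rate σ q τ k (t k))]
    exact h5
  have hDint : ∀ τ ∈ Set.Ioo (0 : ℝ) 2, ∀ k, Integrable fun t => D τ t k := by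
    intro τ hτ k
    refine integrable_mul_prod_rate hσ hq hqM' hτ _ (Integrable.add ?_ ?_)
    · refine Integrable.mul_bdd (c := M) ?_
        ((hq k).continuous.comp (continuous_apply k)).aestronglyMeasurable
        (Filter.Eventually.of_forall fun t => hqM k _)
      refine Integrable.mul_bdd (c := 3 * M) ((hpiece τ hτ).2 k)
        ((continuous_rate hq τ k).comp (continuous_apply k)).aestronglyMeasurable
        (Filter.Eventually.of_forall fun t => norm_rate_le hσ hqM' hτ k _)
    · exact Integrable.mul_bdd (c := M) (hpiece τ hτ).1
        ((hq k).continuous_deriv_one.comp (continuous_apply k)).aestronglyMeasurable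
        (Filter.Eventually.of_forall fun t => hqM' k _)
  -- A line derivative integrates to zero when it and the function are integrable: integration by
  -- parts against the constant `1`.
  have hzero : ∀ τ ∈ Set.Ioo (0 : ℝ) 2, ∫ t, ∑ k, D τ t k = 0 := by
    intro τ hτ
    rw [integral_finsetSum _ fun k _ => hDint τ hτ k]
    refine Finset.sum_eq_zero fun k _ => ?_
    have h1 : Integrable fun t => G (shift σ q τ t) * q k (t k) *
        ∏ l ∈ Finset.univ.erase k, rate σ q τ l (t l) :=
      integrable_mul_prod_rate hσ hq hqM' hτ _ (Integrable.mul_bdd (c := M) (hpiece τ hτ).1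
        ((hq k).continuous.comp (continuous_apply k)).aestronglyMeasurable
        (Filter.Eventually.of_forall fun t => hqM k _))
    have h2 := integral_bilinear_hasLineDerivAt_right_eq_neg_left_of_integrable
      (μ := (volume : Measure (Fin d → ℝ))) (f := fun _ => (1 : ℂ)) (f' := fun _ => 0)
      (g' := fun t => D τ t k) (v := Pi.single k 1) (B := ContinuousLinearMap.mul ℝ ℂ)
      (by simp) (by simpa using hDint τ hτ k) (by simpa using h1)
      (fun t _ => by simpa [HasLineDerivAt] using hasDerivAt_const (0 : ℝ) (1 : ℂ))
      (fun t _ => hline τ hτ k t)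
    simpa using h2
  have hI : ∀ τ ∈ Set.Ioo (0 : ℝ) 2,
      HasDerivAt (fun τ => ∫ t, G (shift σ q τ t) * ∏ k, rate σ q τ k (t k)) 0 τ := by
    intro τ hτ
    obtain ⟨B, hBi, hB⟩ := hB (τ / 2) (by linarith [hτ.1])
    have hsub : ∀ s ∈ Set.Ioo (τ / 2) 2, s ∈ Set.Ioo (0 : ℝ) 2 := fun s hs =>
      ⟨by linarith [hs.1, hτ.1], hs.2⟩
    rw [← hzero τ hτ]
    refine (hasDerivAt_integral_of_dominated_loc_of_deriv_le (s := Set.Ioo (τ / 2) 2)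
      (bound := fun t => ∑ k : Fin d, (B t * (3 * M) * M + B t * M) * (3 * M) ^ (d - 1))
      (isOpen_Ioo.mem_nhds ⟨by linarith [hτ.1], hτ.2⟩) ?_
      (integrable_mul_prod_rate hσ hq hqM' hτ _ (hpiece τ hτ).1)
      (integrable_finsetSum _ fun k _ => hDint τ hτ k).aestronglyMeasurable
      (Filter.Eventually.of_forall fun t s hs => ?_) ?_
      (Filter.Eventually.of_forall fun t s hs => hderiv s (hsub s hs) t)).2
    · filter_upwards [isOpen_Ioo.mem_nhds hτ] with s hs
      exact (integrable_mul_prod_rate hσ hq hqM' hs _ (hpiece s hs).1).aestronglyMeasurable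
    · refine (norm_sum_le _ _).trans (Finset.sum_le_sum fun k _ => ?_)
      have hr := norm_rate_le hσ hqM' (hsub s hs)
      have hB0 : 0 ≤ B t := (norm_nonneg _).trans (hB s hs t).1
      rw [norm_mul, norm_prod]
      refine mul_le_mul ?_ ?_ (by positivity) (by positivity)
      · refine (norm_add_le _ _).trans (add_le_add ?_ ?_)
        · rw [norm_mul, norm_mul]
          gcongr
          · exact (hB s hs t).2 k
          · exact hr k _
          · exact hqM k _
        · rw [norm_mul]
          gcongr
          · exact (hB s hs t).1
          · exact hqM' k _
      · refine (Finset.prod_le_prod (fun _ _ => norm_nonneg _) fun l _ => hr l _).trans ?_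
        simp [Finset.card_erase_of_mem]
    · exact integrable_finsetSum _ fun k _ =>
        (((hBi.mul_const _).mul_const _).add (hBi.mul_const _)).mul_const _
  exact isOpen_Ioo.is_const_of_deriv_eq_zero isPreconnected_Ioo
    (fun s hs => (hI s hs).differentiableAt.differentiableWithinAt)
    (fun s hs => (hI s hs).deriv) hτ hτ'

end Homotopy
end
end GaussPolyhedron

namespace GaussPolyhedron
noncomputable section

/-! ### The contours in the coordinates of the frame -/

section Coordinates

variable {d n : ℕ} {F : Finset (Fin n)} {e : F ↪ Fin d} {u : Matrix (Fin d) (Fin d) ℝ} {ε : ℝ → ℝ}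

theorem signs_apply (lam : F → ℤˣ) (j : F) : signs e lam (e j) = ((lam j : ℤ) : ℝ) :=
  e.injective.extend_apply _ _ _

theorem signs_eq_or (lam : F → ℤˣ) (k : Fin d) : signs e lam k = 1 ∨ signs e lam k = -1 := by
  by_cases hk : ∃ j, e j = k
  · obtain ⟨j, rfl⟩ := hk
    simp only [signs_apply]
    rcases Int.units_eq_one_or (lam j) with h | h
    · exact Or.inl (by rw [h]; simp)
    · exact Or.inr (by rw [h]; simp)
  · exact Or.inl (Function.extend_apply' _ _ _ hk)

theorem abs_signs (lam : F → ℤˣ) (k : Fin d) : |signs e lam k| = 1 := by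
  rcases signs_eq_or (e := e) lam k with h | h <;> simp [h]

theorem prod_signs (lam : F → ℤˣ) : ∏ k, signs e lam k = ∏ j, ((lam j : ℤ) : ℝ) := by
  refine (Fintype.prod_of_injective e e.injective _ _ (fun k hk => ?_) fun j => ?_).symm
  · exact Function.extend_apply' _ _ _ hk
  · exact (signs_apply lam j).symm

/-- The imaginary displacements of the contour. -/
def lift (e : F ↪ Fin d) (ε : ℝ → ℝ) (lam : F → ℤˣ) (k : Fin d) (s : ℝ) : ℂ :=
  ((signs e lam k * ε (signs e lam k * s) : ℝ) : ℂ) * Complex.I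

theorem contDiff_lift (hε : IsHeight ε) (lam : F → ℤˣ) (k : Fin d) :
    ContDiff ℝ (⊤ : ℕ∞) (lift e ε lam k) := by
  unfold lift
  refine ContDiff.mul (Complex.ofRealCLM.contDiff.comp ?_) contDiff_const
  exact contDiff_const.mul (hε.smooth.comp (contDiff_const.mul contDiff_id))

theorem norm_lift (hε : IsHeight ε) (lam : F → ℤˣ) (k : Fin d) (s : ℝ) :
    ‖lift e ε lam k s‖ = ε (signs e lam k * s) := by
  obtain ⟨m, hm, h⟩ := hε.lower
  rw [lift, norm_mul, Complex.norm_I, mul_one, Complex.norm_real, Real.norm_eq_abs, abs_mul,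
    abs_signs, one_mul, abs_of_pos (hm.trans_le (h _))]

theorem norm_deriv_lift (hε : IsHeight ε) (lam : F → ℤˣ) (k : Fin d) (s : ℝ) :
    ‖deriv (lift e ε lam k) s‖ = |deriv ε (signs e lam k * s)| := by
  have h1 : HasDerivAt (fun s : ℝ => signs e lam k * s) (signs e lam k) s := by
    simpa using (hasDerivAt_id s).const_mul (signs e lam k)
  have h2 : HasDerivAt ε (deriv ε (signs e lam k * s)) (signs e lam k * s) :=
    (hε.smooth.differentiable (by simp) _).hasDerivAt
  have h3 := (((h2.comp s h1).const_mul (signs e lam k)).ofReal_comp).mul_const Complex.I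
  have h4 : deriv (lift e ε lam k) s = _ := h3.deriv
  rw [h4, norm_mul, Complex.norm_I, mul_one, Complex.norm_real, Real.norm_eq_abs, abs_mul,
    abs_mul, abs_signs, one_mul, mul_one]

/-- The linear change of coordinates `z_i = ∑ k, (u⁻¹)_{k i} w_k`. -/
def frameMap (u : Matrix (Fin d) (Fin d) ℝ) : (Fin d → ℂ) →L[ℂ] (Fin d → ℂ) :=
  ContinuousLinearMap.pi fun i => ∑ k, ((u⁻¹ k i : ℝ) : ℂ) • ContinuousLinearMap.proj k

theorem frameMap_apply (w : Fin d → ℂ) (i : Fin d) :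
    frameMap u w i = ∑ k, ((u⁻¹ k i : ℝ) : ℂ) * w k := by
  simp [frameMap]

/-- The real points `x_i = ∑ k, (u⁻¹)_{k i} σ_k t_k`. -/
def realPoint (u : Matrix (Fin d) (Fin d) ℝ) (σ t : Fin d → ℝ) : Fin d → ℝ :=
  fun i => ∑ k, u⁻¹ k i * (σ k * t k)

theorem frameMap_real (σ t : Fin d → ℝ) (i : Fin d) :
    frameMap u (fun k => (σ k : ℂ) * t k) i = realPoint u σ t i := by
  simp [frameMap_apply, realPoint]

theorem contour_eq (lam : F → ℤˣ) (t : Fin d → ℝ) :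
    contour e u ε lam t = frameMap u (shift (signs e lam) (lift e ε lam) 1 t) := by
  ext i
  simp [contour, frameMap_apply, shift, lift]

theorem contDiff_contour (hε : IsHeight ε) (lam : F → ℤˣ) :
    ContDiff ℝ (⊤ : ℕ∞) (contour e u ε lam) := by
  have h : contour e u ε lam =
      fun t => frameMap u (shift (signs e lam) (lift e ε lam) 1 t) := funext (contour_eq lam)
  rw [h]
  refine ((frameMap u).restrictScalars ℝ).contDiff.comp (contDiff_pi.2 fun k => ?_)
  refine ContDiff.add ?_ (contDiff_const.mul ((contDiff_lift hε lam k).comp (contDiff_apply _ _ k)))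
  exact contDiff_const.mul (Complex.ofRealCLM.contDiff.comp (contDiff_apply _ _ k))

/-- Each frame coordinate depends on one `t k`, so the Jacobian matrix is the transposed inverse
frame with its columns scaled by the rates. -/
theorem pullback_contour (hε : IsHeight ε) (lam : F → ℤˣ) (g : (Fin d → ℂ) → ℂ) (t : Fin d → ℝ) :
    pullback (contour e u ε lam) g t =
      ((u⁻¹).det : ℂ) * (g (frameMap u (shift (signs e lam) (lift e ε lam) 1 t)) *
        ∏ k, rate (signs e lam) (lift e ε lam) 1 k (t k)) := by
  have hq : ∀ k, ContDiff ℝ 1 (lift e ε lam k) := fun k =>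
    (contDiff_lift hε lam k).of_le (by exact_mod_cast le_top)
  have h1 : ∀ k i, fderiv ℝ (contour e u ε lam) t (Pi.single k 1) i =
      rate (signs e lam) (lift e ε lam) 1 k (t k) * ((u⁻¹ k i : ℝ) : ℂ) := by
    intro k i
    have h2 := ((frameMap u).restrictScalars ℝ).hasFDerivAt.comp_hasDerivAt (0 : ℝ)
      (hasDerivAt_shift_single (σ := signs e lam) hq 1 t k)
    have h3 : HasLineDerivAt ℝ (contour e u ε lam)
        (frameMap u (rate (signs e lam) (lift e ε lam) 1 k (t k) • Pi.single k 1)) t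
        (Pi.single k 1) := by
      have h4 : HasDerivAt (fun s : ℝ => contour e u ε lam (t + s • Pi.single k 1)) _ 0 :=
        h2.congr_of_eventuallyEq (Filter.Eventually.of_forall fun s => contour_eq lam _)
      exact h4
    have h5 := ((contDiff_contour (u := u) (e := e) hε lam).differentiable (by simp)
      t).hasFDerivAt.hasLineDerivAt (Pi.single k 1)
    rw [h5.unique h3, map_smul, Pi.smul_apply, smul_eq_mul, frameMap_apply]
    simp [Pi.single_apply]
  have h6 : (Matrix.of fun i k : Fin d => fderiv ℝ (contour e u ε lam) t (Pi.single k 1) i) =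
      Matrix.of fun i k => rate (signs e lam) (lift e ε lam) 1 k (t k) *
        ((u⁻¹).map Complex.ofRealHom).transpose i k := by
    ext i k
    simp [h1]
  rw [pullback, h6, Matrix.det_mul_row, Matrix.det_transpose, ← RingHom.mapMatrix_apply,
    ← RingHom.map_det, contour_eq]
  simp only [Complex.ofRealHom_eq_coe]
  ring

/-- The coefficients of the affine forms in the coordinates `w`. -/
def frameCoeff (u : Matrix (Fin d) (Fin d) ℝ) (p : Params ℝ d n) (j : Fin n) (k : Fin d) : ℝ :=
  ∑ i, u⁻¹ k i * p.1 i j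

theorem linForm_frameMap (p : Params ℝ d n) (w : Fin d → ℂ) (j : Fin n) :
    linForm (toComplex p) (frameMap u w) j = ∑ k, (frameCoeff u p j k : ℂ) * w k + p.2 j := by
  simp only [linForm, toComplex, frameMap_apply, frameCoeff, Finset.mul_sum, Complex.ofReal_sum,
    Finset.sum_mul, Complex.ofReal_mul]
  rw [Finset.sum_comm]
  congr 1
  exact Finset.sum_congr rfl fun k _ => Finset.sum_congr rfl fun i _ => by ring

theorem linForm_realPoint (p : Params ℝ d n) (σ t : Fin d → ℝ) (j : Fin n) :
    linForm p (realPoint u σ t) j = ∑ k, frameCoeff u p j k * (σ k * t k) + p.2 j := by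
  simp only [linForm, realPoint, frameCoeff, Finset.mul_sum, Finset.sum_mul]
  rw [Finset.sum_comm]
  congr 1
  exact Finset.sum_congr rfl fun k _ => Finset.sum_congr rfl fun i _ => by ring

theorem re_linForm_shift (p : Params ℝ d n) (lam : F → ℤˣ) (τ : ℝ) (t : Fin d → ℝ) (j : Fin n) :
    (linForm (toComplex p) (frameMap u (shift (signs e lam) (lift e ε lam) τ t)) j).re =
      linForm p (realPoint u (signs e lam) t) j := by
  rw [linForm_frameMap, linForm_realPoint]
  simp [shift, lift]

theorem im_linForm_shift (p : Params ℝ d n) (lam : F → ℤˣ) (τ : ℝ) (t : Fin d → ℝ) (j : Fin n) :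
    (linForm (toComplex p) (frameMap u (shift (signs e lam) (lift e ε lam) τ t)) j).im =
      τ * ∑ k, frameCoeff u p j k * (signs e lam k * ε (signs e lam k * t k)) := by
  rw [linForm_frameMap, Finset.mul_sum]
  simp [shift, lift]
  exact Finset.sum_congr rfl fun k _ => by ring

/-- The parameter is so close to that of the frame that the imaginary displacements dominate. -/
def IsClose (e : F ↪ Fin d) (u : Matrix (Fin d) (Fin d) ℝ) (p : Params ℝ d n) (m C : ℝ) : Prop :=
  ∀ j : F, (∑ k, |frameCoeff u p j k - if k = e j then 1 else 0|) * C < m / 2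

theorem frameCoeff_of_isAdaptedFrame {p : Params ℝ d n} (h : IsAdaptedFrame p.1 F e u)
    (hu : u.det ≠ 0) (j : F) (k : Fin d) : frameCoeff u p j k = if k = e j then 1 else 0 := by
  have h1 : frameCoeff u p j k = (u⁻¹ * u) k (e j) := by
    rw [Matrix.mul_apply, frameCoeff]
    exact Finset.sum_congr rfl fun i _ => by rw [h.col_eq]
  rw [h1, Matrix.nonsing_inv_mul _ (isUnit_iff_ne_zero.2 hu), Matrix.one_apply]

theorem isClose_self {p : Params ℝ d n} (h : IsAdaptedFrame p.1 F e u) (hu : u.det ≠ 0) {m C : ℝ}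
    (hm : 0 < m) : IsClose e u p m C := fun j => by
  simp [frameCoeff_of_isAdaptedFrame h hu, hm]

theorem isOpen_isClose (m C : ℝ) : IsOpen {p : Params ℝ d n | IsClose e u p m C} := by
  have h : {p : Params ℝ d n | IsClose e u p m C} = ⋂ j : F, {p |
      (∑ k, |frameCoeff u p j k - if k = e j then 1 else 0|) * C < m / 2} := by
    ext p; simp [IsClose]
  rw [h]
  refine isOpen_iInter_of_finite fun j => isOpen_lt ?_ continuous_const
  unfold frameCoeff
  fun_prop

/-- At the parameter of the frame `f_j` is the coordinate `e j` plus a constant, with imaginary part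
`λ_j τ ε`. Closeness limits the error from other parameters to half of the lower bound `τ m`. -/
theorem IsClose.le_signs_mul_im {p : Params ℝ d n} {m C : ℝ} (h : IsClose e u p m C)
    (hm : ∀ s, m ≤ ε s) (hm0 : 0 < m) (hC : ∀ s, ε s ≤ C) (lam : F → ℤˣ) {τ : ℝ} (hτ : 0 < τ)
    (t : Fin d → ℝ) (j : F) :
    τ * (m / 2) ≤ signs e lam (e j) *
      (linForm (toComplex p) (frameMap u (shift (signs e lam) (lift e ε lam) τ t)) j).im := by
  rw [im_linForm_shift, mul_left_comm]
  refine mul_le_mul_of_nonneg_left ?_ hτ.le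
  set σ := signs e lam with hσ
  have hs : ∀ k, |σ k| = 1 := abs_signs lam
  have h1 : σ (e j) * ∑ k, frameCoeff u p j k * (σ k * ε (σ k * t k)) =
      ε (σ (e j) * t (e j)) + ∑ k, (frameCoeff u p j k - if k = e j then 1 else 0) *
        (σ (e j) * σ k * ε (σ k * t k)) := by
    have h2 : σ (e j) * σ (e j) = 1 := by rw [← abs_mul_abs_self, hs, one_mul]
    simp only [sub_mul, Finset.sum_sub_distrib, ite_mul, one_mul, zero_mul, Finset.sum_ite_eq',
      Finset.mem_univ, if_true, h2]
    rw [add_sub_cancel, Finset.mul_sum]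
    exact Finset.sum_congr rfl fun k _ => by ring
  have h3 : |∑ k, (frameCoeff u p j k - if k = e j then 1 else 0) *
      (σ (e j) * σ k * ε (σ k * t k))| ≤ m / 2 := by
    refine (Finset.abs_sum_le_sum_abs _ _).trans (le_trans ?_ (h j).le)
    rw [Finset.sum_mul]
    refine Finset.sum_le_sum fun k _ => ?_
    rw [abs_mul]
    refine mul_le_mul_of_nonneg_left ?_ (abs_nonneg _)
    rw [abs_mul, abs_mul, hs, hs, one_mul, one_mul, abs_of_pos (hm0.trans_le (hm _))]
    exact hC _
  rw [h1]
  linarith [neg_le_of_abs_le h3, hm (σ (e j) * t (e j))]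

theorem IsClose.le_abs_im {p : Params ℝ d n} {m C : ℝ} (h : IsClose e u p m C)
    (hm : ∀ s, m ≤ ε s) (hm0 : 0 < m) (hC : ∀ s, ε s ≤ C) (lam : F → ℤˣ) {τ : ℝ} (hτ : 0 < τ)
    (t : Fin d → ℝ) (j : F) : τ * (m / 2) ≤
      |(linForm (toComplex p) (frameMap u (shift (signs e lam) (lift e ε lam) τ t)) j).im| := by
  refine (h.le_signs_mul_im hm hm0 hC lam hτ t j).trans ((le_abs_self _).trans ?_)
  rw [abs_mul, abs_signs, one_mul]

end Coordinates
end
end GaussPolyhedron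

namespace GaussPolyhedron
noncomputable section

/-! ### Change of variables and growth of the integrand -/

section Bounds

open MeasureTheory

variable {d n : ℕ} {F : Finset (Fin n)} {u : Matrix (Fin d) (Fin d) ℝ}

theorem map_realPoint (hu : u.det ≠ 0) {σ : Fin d → ℝ} (hσ : ∀ k, |σ k| = 1) :
    MeasurableEmbedding (realPoint u σ) ∧
      Measure.map (realPoint u σ) volume = ENNReal.ofReal |u.det| • volume := by
  classical
  let N : Matrix (Fin d) (Fin d) ℝ := Matrix.of fun i k => σ k * (u⁻¹).transpose i k
  have hdet : N.det = (∏ k, σ k) * (u.det)⁻¹ := by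
    rw [Matrix.det_mul_row, Matrix.det_transpose, Matrix.det_nonsing_inv, Ring.inverse_eq_inv']
  have hprod : |∏ k, σ k| = 1 := by
    rw [Finset.abs_prod]; exact Finset.prod_eq_one fun k _ => hσ k
  have hN : N.det ≠ 0 := by
    rw [← abs_ne_zero, hdet, abs_mul, hprod, one_mul, abs_ne_zero]
    exact inv_ne_zero hu
  have heq : realPoint u σ = Matrix.toLin' N := by
    ext t i
    simp only [realPoint, Matrix.toLin'_apply, Matrix.mulVec, dotProduct, N, Matrix.of_apply,
      Matrix.transpose_apply]
    exact Finset.sum_congr rfl fun k _ => by ring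
  rw [heq]
  constructor
  · refine (LinearMap.isClosedEmbedding_of_injective ?_).measurableEmbedding
    exact LinearMap.ker_eq_bot.2 (Matrix.mulVec_injective_of_isUnit
      ((Matrix.isUnit_iff_isUnit_det N).2 (isUnit_iff_ne_zero.2 hN)))
  · rw [Real.map_matrix_volume_pi_eq_smul_volume_pi hN, hdet, mul_inv, inv_inv, abs_mul, abs_inv,
      hprod, inv_one, one_mul]

theorem integral_comp_realPoint (hu : u.det ≠ 0) {σ : Fin d → ℝ} (hσ : ∀ k, |σ k| = 1)
    (g : (Fin d → ℝ) → ℂ) : ∫ t, g (realPoint u σ t) = (|u.det| : ℝ) * ∫ x, g x := by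
  obtain ⟨h1, h2⟩ := map_realPoint hu hσ
  rw [← h1.integral_map, h2, integral_smul_measure, ENNReal.toReal_ofReal (abs_nonneg _)]
  simp

theorem integrable_comp_realPoint (hu : u.det ≠ 0) {σ : Fin d → ℝ} (hσ : ∀ k, |σ k| = 1)
    {g : (Fin d → ℝ) → ℝ} (hg : Integrable g) : Integrable fun t => g (realPoint u σ t) := by
  obtain ⟨h1, h2⟩ := map_realPoint hu hσ
  refine (h1.integrable_map_iff (g := g)).1 ?_
  rw [h2]
  exact hg.smul_measure ENNReal.ofReal_ne_top

theorem norm_log_le (z : ℂ) : ‖Complex.log z‖ ≤ |Real.log ‖z‖| + Real.pi := by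
  rw [Complex.log]
  refine (norm_add_le _ _).trans (add_le_add ?_ ?_)
  · rw [Complex.norm_real, Real.norm_eq_abs]
  · rw [norm_mul, Complex.norm_I, mul_one, Complex.norm_real, Real.norm_eq_abs]
    exact Complex.abs_arg_le_pi z

theorem norm_neg_div_two_pi_I_le (z : ℂ) : ‖-(z / (2 * Real.pi * Complex.I))‖ ≤ ‖z‖ := by
  have h : ‖(2 * Real.pi * Complex.I : ℂ)‖ = 2 * Real.pi := by
    simp [abs_of_pos Real.pi_pos]
  rw [norm_neg, norm_div, h]
  exact div_le_self (norm_nonneg _) (by linarith [Real.pi_gt_three])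

theorem abs_log_le {x c : ℝ} (hc : 0 < c) (hx : c ≤ x) : |Real.log x| ≤ x + c⁻¹ := by
  have hx0 := hc.trans_le hx
  have h1 := Real.log_le_sub_one_of_pos hx0
  have h2 := Real.log_le_sub_one_of_pos (inv_pos.2 hx0)
  rw [Real.log_inv] at h2
  have h3 : x⁻¹ ≤ c⁻¹ := inv_anti₀ hc hx
  have h4 : 0 < c⁻¹ := inv_pos.2 hc
  exact abs_le.2 ⟨by linarith, by linarith⟩

theorem gaussConst_pos (d : ℕ) : 0 < gaussConst d := by
  unfold gaussConst
  exact Real.rpow_pos_of_pos (by linarith [Real.pi_pos]) _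

theorem norm_linForm_le (p : Params ℝ d n) {M : ℝ} (hM : 0 ≤ M) {x : Fin d → ℝ} {z : Fin d → ℂ}
    (hz : ∀ i, ‖z i - x i‖ ≤ M) (j : Fin n) : ‖linForm (toComplex p) z j‖ ≤
      (∑ i, |p.1 i j|) * (1 + M) * Real.exp (∑ i, |x i|) + |p.2 j| := by
  simp only [linForm, toComplex]
  refine (norm_add_le _ _).trans (add_le_add ?_ (by simp))
  refine (norm_sum_le _ _).trans ?_
  rw [mul_assoc, Finset.sum_mul]
  refine Finset.sum_le_sum fun i _ => ?_
  rw [norm_mul, Complex.norm_real, Real.norm_eq_abs]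
  refine mul_le_mul_of_nonneg_left ?_ (abs_nonneg _)
  have h1 : ‖z i‖ ≤ |x i| + M := by
    calc ‖z i‖ = ‖(x i : ℂ) + (z i - x i)‖ := by rw [add_sub_cancel]
      _ ≤ _ := (norm_add_le _ _).trans (add_le_add (by simp) (hz i))
  have h2 : |x i| ≤ ∑ i, |x i| :=
    Finset.single_le_sum (f := fun i => |x i|) (fun _ _ => abs_nonneg _) (Finset.mem_univ i)
  have h3 := Real.add_one_le_exp (∑ i, |x i|)
  have h4 : 0 ≤ ∑ i, |x i| := Finset.sum_nonneg fun _ _ => abs_nonneg _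
  nlinarith

/-- A bounded complex displacement changes the Gaussian exponent only by terms linear in `|x|`. -/
theorem norm_exp_gauss_le {M : ℝ} {x : Fin d → ℝ} {z : Fin d → ℂ}
    (hz : ∀ i, ‖z i - x i‖ ≤ M) : ‖Complex.exp (-(1 / 2) * ∑ i, z i ^ 2)‖ ≤
      Real.exp (d * M ^ 2) * Real.exp (M * ∑ i, |x i| - 1 / 2 * ∑ i, x i ^ 2) := by
  rw [Complex.norm_exp, ← Real.exp_add]
  refine Real.exp_le_exp.2 ?_
  have h1 : (-(1 / 2) * ∑ i, z i ^ 2 : ℂ).re = ∑ i, (-(1 / 2) * (z i ^ 2).re) := by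
    rw [← Finset.mul_sum, ← Complex.re_sum]
    have : (-(1 / 2) : ℂ) = ((-(1 / 2) : ℝ) : ℂ) := by norm_num
    rw [this, Complex.re_ofReal_mul]
  have h2 : ∀ i, -(1 / 2) * (z i ^ 2).re ≤ M ^ 2 + (M * |x i| - 1 / 2 * x i ^ 2) := by
    intro i
    set ζ := z i - x i with hζ
    have h3 : z i = x i + ζ := by rw [hζ, add_sub_cancel]
    have h4 : (z i ^ 2).re = x i ^ 2 + 2 * x i * ζ.re + (ζ ^ 2).re := by
      rw [h3, add_sq]
      simp [sq]
    have h5 : |ζ.re| ≤ M := (Complex.abs_re_le_norm ζ).trans (hz i)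
    have h6 : |(ζ ^ 2).re| ≤ M ^ 2 := by
      refine (Complex.abs_re_le_norm _).trans ?_
      rw [norm_pow]
      exact pow_le_pow_left₀ (norm_nonneg _) (hz i) 2
    have h7 : |x i * ζ.re| ≤ M * |x i| := by
      rw [abs_mul, mul_comm M]
      exact mul_le_mul_of_nonneg_left h5 (abs_nonneg _)
    rw [h4]
    have h8 := neg_le_of_abs_le h6
    have h9 := neg_le_of_abs_le h7
    nlinarith [sq_nonneg M]
  rw [h1]
  refine (Finset.sum_le_sum fun i _ => h2 i).trans (le_of_eq ?_)
  rw [Finset.sum_add_distrib, Finset.sum_sub_distrib, Finset.mul_sum, Finset.mul_sum]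
  simp

/-- Away from the zeros of `f_j` each logarithm is at most a multiple of `exp (∑ |x i|)`, so each
factor adds one to the linear rate `K`. -/
theorem exists_norm_logIntegrand_le (F : Finset (Fin n)) (p : Params ℝ d n) {c M : ℝ} (hc : 0 < c)
    (hM : 0 ≤ M) : ∃ A K : ℝ, 0 ≤ A ∧ ∀ (x : Fin d → ℝ) (z : Fin d → ℂ), (∀ i, ‖z i - x i‖ ≤ M) →
      (∀ j ∈ F, c ≤ ‖linForm (toComplex p) z j‖) → ‖logIntegrand F (toComplex p) z‖ ≤
        A * Real.exp (K * ∑ i, |x i| - 1 / 2 * ∑ i, x i ^ 2) := by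
  let a : Fin n → ℝ := fun j => (∑ i, |p.1 i j|) * (1 + M) + |p.2 j| + c⁻¹ + Real.pi
  have ha : ∀ j, 0 ≤ a j := fun j => by
    have := Real.pi_pos
    positivity
  refine ⟨gaussConst d * Real.exp (d * M ^ 2) * ∏ j ∈ F, a j, M + F.card,
    mul_nonneg (mul_nonneg (gaussConst_pos d).le (Real.exp_pos _).le)
      (Finset.prod_nonneg fun j _ => ha j), fun x z hz hf => ?_⟩
  have h1 : ∀ j ∈ F, ‖-(Complex.log (linForm (toComplex p) z j) / (2 * Real.pi * Complex.I))‖ ≤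
      a j * Real.exp (∑ i, |x i|) := by
    intro j hj
    have h2 := norm_linForm_le p hM hz j
    have h3 := abs_log_le hc (hf j hj)
    have h4 : (1 : ℝ) ≤ Real.exp (∑ i, |x i|) :=
      Real.one_le_exp (Finset.sum_nonneg fun _ _ => abs_nonneg _)
    refine (norm_neg_div_two_pi_I_le _).trans ((norm_log_le _).trans ?_)
    have h5 : 0 ≤ |p.2 j| + c⁻¹ + Real.pi := by
      have := Real.pi_pos
      positivity
    have h6 : a j * Real.exp (∑ i, |x i|) = (∑ i, |p.1 i j|) * (1 + M) * Real.exp (∑ i, |x i|) +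
        (|p.2 j| + c⁻¹ + Real.pi) * Real.exp (∑ i, |x i|) := by ring
    rw [h6]
    nlinarith
  rw [logIntegrand, norm_mul, norm_mul, norm_prod, Complex.norm_real, Real.norm_eq_abs,
    abs_of_pos (gaussConst_pos d)]
  have h7 := Finset.prod_le_prod (fun _ _ => norm_nonneg _) h1
  rw [Finset.prod_mul_distrib, Finset.prod_const, ← Real.exp_nat_mul] at h7
  have h8 : (M + F.card) * ∑ i, |x i| - 1 / 2 * ∑ i, x i ^ 2 =
      (M * ∑ i, |x i| - 1 / 2 * ∑ i, x i ^ 2) + F.card * ∑ i, |x i| := by ring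
  rw [h8, Real.exp_add]
  calc _ ≤ gaussConst d * (Real.exp (d * M ^ 2) *
        Real.exp (M * ∑ i, |x i| - 1 / 2 * ∑ i, x i ^ 2)) *
        ((∏ j ∈ F, a j) * Real.exp (F.card * ∑ i, |x i|)) := by
        refine mul_le_mul (mul_le_mul_of_nonneg_left (norm_exp_gauss_le hz)
          (gaussConst_pos d).le) h7 (Finset.prod_nonneg fun _ _ => norm_nonneg _) ?_
        have := gaussConst_pos d
        positivity
    _ = _ := by ring

theorem analyticAt_linForm (p : Params ℝ d n) (j : Fin n) (z : Fin d → ℂ) :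
    AnalyticAt ℂ (fun z => linForm (toComplex p) z j) z := by
  simp only [linForm]
  refine AnalyticAt.add (Finset.analyticAt_fun_sum _ fun i _ => analyticAt_const.mul ?_)
    analyticAt_const
  exact (ContinuousLinearMap.proj (R := ℂ) (φ := fun _ : Fin d => ℂ) i).analyticAt z

theorem analyticAt_logIntegrand (p : Params ℝ d n) {z : Fin d → ℂ}
    (hz : ∀ j ∈ F, linForm (toComplex p) z j ∈ Complex.slitPlane) :
    AnalyticAt ℂ (logIntegrand F (toComplex p)) z := by
  unfold logIntegrand
  refine AnalyticAt.mul (analyticAt_const.mul (AnalyticAt.cexp (analyticAt_const.mul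
    (Finset.analyticAt_fun_sum _ fun i _ => AnalyticAt.pow ?_ 2))))
    (Finset.analyticAt_fun_prod _ fun j hj => AnalyticAt.neg (AnalyticAt.div_const
      ((analyticAt_linForm p j z).clog (hz j hj))))
  exact (ContinuousLinearMap.proj (R := ℂ) (φ := fun _ : Fin d => ℂ) i).analyticAt z

end Bounds
end
end GaussPolyhedron

namespace GaussPolyhedron
noncomputable section

/-! ### Independence of the contour integral from the height -/

section Deformation

open MeasureTheory

variable {d n : ℕ} {F : Finset (Fin n)} {e : F ↪ Fin d} {u : Matrix (Fin d) (Fin d) ℝ} {ε : ℝ → ℝ}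
  {p : Params ℝ d n} {m C : ℝ}

/-- The integrand on the contour with displacement scaled by `τ`, up to a constant factor. -/
def scaledIntegrand (e : F ↪ Fin d) (u : Matrix (Fin d) (Fin d) ℝ) (ε : ℝ → ℝ) (p : Params ℝ d n)
    (lam : F → ℤˣ) (τ : ℝ) (t : Fin d → ℝ) : ℂ :=
  logIntegrand F (toComplex p) (frameMap u (shift (signs e lam) (lift e ε lam) τ t)) *
    ∏ k, rate (signs e lam) (lift e ε lam) τ k (t k)

theorem norm_frameMap_sub_realPoint_le {σ t : Fin d → ℝ} {w : Fin d → ℂ} {M : ℝ}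
    (hw : ∀ k, ‖w k - σ k * t k‖ ≤ M) (i : Fin d) :
    ‖frameMap u w i - realPoint u σ t i‖ ≤ (∑ k, ∑ i, |u⁻¹ k i|) * M := by
  rw [← frameMap_real, ← Pi.sub_apply, ← map_sub, frameMap_apply, Finset.sum_mul]
  refine (norm_sum_le _ _).trans (Finset.sum_le_sum fun k _ => ?_)
  rw [norm_mul, Complex.norm_real, Real.norm_eq_abs]
  exact mul_le_mul (Finset.single_le_sum (f := fun i => |u⁻¹ k i|) (fun _ _ => abs_nonneg _)
    (Finset.mem_univ i)) (hw k) (norm_nonneg _) (Finset.sum_nonneg fun _ _ => abs_nonneg _)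

theorem integrable_gauss_realPoint (hu : u.det ≠ 0) {σ : Fin d → ℝ} (hσ : ∀ k, |σ k| = 1)
    (A K : ℝ) : Integrable fun t => A * Real.exp (K * ∑ i, |realPoint u σ t i| -
      1 / 2 * ∑ i, realPoint u σ t i ^ 2) :=
  integrable_comp_realPoint hu hσ (g := fun x => A * Real.exp (K * ∑ i, |x i| -
    1 / 2 * ∑ i, x i ^ 2)) ((integrable_exp_sum_abs_sub_sum_sq (by norm_num) K).const_mul A)

/-- Analyticity and bounds of the integrand near the contour. -/
theorem exists_bound_near_contour (hm : ∀ s, m ≤ ε s) (hm0 : 0 < m) (hC : ∀ s, ε s ≤ C)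
    (hε : IsHeight ε) (hp : IsClose e u p m C) (lam : F → ℤˣ) {τ₀ : ℝ} (hτ₀ : 0 < τ₀) :
    ∃ ρ A K : ℝ, 0 < ρ ∧ 0 ≤ A ∧ ∀ τ ∈ Set.Ioo τ₀ 2, ∀ (t : Fin d → ℝ) (v : Fin d → ℂ), ‖v‖ ≤ ρ →
      AnalyticAt ℂ (fun w => logIntegrand F (toComplex p) (frameMap u w))
        (shift (signs e lam) (lift e ε lam) τ t + v) ∧
      ‖logIntegrand F (toComplex p)
        (frameMap u (shift (signs e lam) (lift e ε lam) τ t + v))‖ ≤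
        A * Real.exp (K * ∑ i, |realPoint u (signs e lam) t i| -
          1 / 2 * ∑ i, realPoint u (signs e lam) t i ^ 2) := by
  set c := τ₀ * (m / 2) with hc
  have hc0 : 0 < c := by positivity
  have hC0 : 0 ≤ C := hm0.le.trans ((hm 0).trans (hC 0))
  set S := 1 + ∑ j : F, ∑ k, |frameCoeff u p j k| with hS
  have hS0 : 0 < S := by positivity
  -- A displacement of size `ρ` moves each `f_j` by at most `c / 2`, half of its distance from the
  -- real axis. The bound `1` keeps the total displacement within `2 C + 1`.
  set ρ := min 1 (c / (2 * S)) with hρ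
  have hρ0 : 0 < ρ := lt_min one_pos (by positivity)
  obtain ⟨A, K, hA, hAK⟩ := exists_norm_logIntegrand_le F p (c := c / 2)
    (M := (∑ k, ∑ i, |u⁻¹ k i|) * (2 * C + 1)) (by positivity) (by positivity)
  refine ⟨ρ, A, K, hρ0, hA, fun τ hτ t v hv => ?_⟩
  have hτ0 : 0 < τ := hτ₀.trans hτ.1
  set w := shift (signs e lam) (lift e ε lam) τ t with hw
  have him : ∀ j ∈ F, c / 2 ≤
      |(linForm (toComplex p) (frameMap u (w + v)) j).im| := by
    intro j hj
    have h1 := hp.le_abs_im hm hm0 hC lam hτ0 t ⟨j, hj⟩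
    have h2 : linForm (toComplex p) (frameMap u (w + v)) j =
        linForm (toComplex p) (frameMap u w) j + ∑ k, (frameCoeff u p j k : ℂ) * v k := by
      rw [linForm_frameMap, linForm_frameMap]
      simp only [Pi.add_apply, mul_add, Finset.sum_add_distrib]
      ring
    have h3 : |(∑ k, (frameCoeff u p j k : ℂ) * v k).im| ≤ c / 2 := by
      refine (Complex.abs_im_le_norm _).trans ((norm_sum_le _ _).trans ?_)
      have h4 : ∑ k, |frameCoeff u p j k| ≤ S := by
        have h6 : ∑ k, |frameCoeff u p j k| ≤ ∑ j : F, ∑ k, |frameCoeff u p j k| :=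
          Finset.single_le_sum (f := fun j : F => ∑ k, |frameCoeff u p j k|)
            (fun _ _ => Finset.sum_nonneg fun _ _ => abs_nonneg _) (Finset.mem_univ ⟨j, hj⟩)
        linarith
      calc _ ≤ ∑ k, |frameCoeff u p j k| * (c / (2 * S)) := by
            refine Finset.sum_le_sum fun k _ => ?_
            rw [norm_mul, Complex.norm_real, Real.norm_eq_abs]
            exact mul_le_mul_of_nonneg_left (((norm_le_pi_norm v k).trans hv).trans
              (min_le_right _ _)) (abs_nonneg _)
        _ ≤ S * (c / (2 * S)) := by
            rw [← Finset.sum_mul]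
            exact mul_le_mul_of_nonneg_right h4 (by positivity)
        _ = c / 2 := by field_simp
    have h7 : c ≤ τ * (m / 2) := mul_le_mul_of_nonneg_right hτ.1.le (by positivity)
    rw [h2, Complex.add_im]
    have h8 := abs_sub_abs_le_abs_sub
      (linForm (toComplex p) (frameMap u w) j).im (-(∑ k, (frameCoeff u p j k : ℂ) * v k).im)
    rw [abs_neg, sub_neg_eq_add] at h8
    linarith
  have hdisp : ∀ l, ‖(w + v : Fin d → ℂ) l - (signs e lam l : ℂ) * t l‖ ≤
      2 * C + 1 := by
    intro l
    have h1 : (w + v : Fin d → ℂ) l - (signs e lam l : ℂ) * t l =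
        (τ : ℂ) * lift e ε lam l (t l) + v l := by
      simp only [hw, shift, Pi.add_apply]
      ring
    rw [h1]
    refine (norm_add_le _ _).trans (add_le_add ?_ ?_)
    · rw [norm_mul, Complex.norm_real, Real.norm_eq_abs, abs_of_pos hτ0, norm_lift hε]
      exact mul_le_mul hτ.2.le (hC _) (hm0.le.trans (hm _)) (by norm_num)
    · exact ((norm_le_pi_norm v l).trans hv).trans (min_le_left _ _)
  constructor
  · refine (analyticAt_logIntegrand p fun j hj => ?_).comp ((frameMap u).analyticAt _)
    exact Or.inr (abs_pos.1 ((by positivity : 0 < c / 2).trans_le (him j hj)))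
  · exact hAK _ _ (norm_frameMap_sub_realPoint_le hdisp)
      fun j hj => (him j hj).trans (Complex.abs_im_le_norm _)

theorem bounds_logIntegrand_shift (hu : u.det ≠ 0) (hm : ∀ s, m ≤ ε s) (hm0 : 0 < m)
    (hC : ∀ s, ε s ≤ C) (hε : IsHeight ε) (hp : IsClose e u p m C) (lam : F → ℤˣ) {τ₀ : ℝ}
    (hτ₀ : τ₀ > 0) : ∃ B : (Fin d → ℝ) → ℝ, Integrable B ∧ ∀ τ ∈ Set.Ioo τ₀ 2, ∀ t,
      ‖logIntegrand F (toComplex p) (frameMap u (shift (signs e lam) (lift e ε lam) τ t))‖ ≤ B t ∧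
        ∀ k, ‖fderiv ℂ (fun w => logIntegrand F (toComplex p) (frameMap u w))
          (shift (signs e lam) (lift e ε lam) τ t) (Pi.single k 1)‖ ≤ B t := by
  obtain ⟨ρ, A, K, hρ, hA, h⟩ := exists_bound_near_contour hm hm0 hC hε hp lam hτ₀
  have hint := integrable_gauss_realPoint hu (abs_signs (e := e) lam) A K
  refine ⟨_, hint.add (hint.div_const ρ), fun τ hτ t => ?_⟩
  set b := A * Real.exp (K * ∑ i, |realPoint u (signs e lam) t i| -
    1 / 2 * ∑ i, realPoint u (signs e lam) t i ^ 2) with hb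
  have hb0 : 0 ≤ b := by positivity
  set w := shift (signs e lam) (lift e ε lam) τ t with hw
  -- Cauchy's estimate on a disc of radius `ρ` in the `k`-th direction turns the bound for the
  -- function into one for its derivative.
  have hd : ∀ k : Fin d, ‖fderiv ℂ (fun w => logIntegrand F (toComplex p) (frameMap u w)) w
      (Pi.single k 1)‖ ≤ b / ρ := by
    intro k
    have h0 : ∀ s : ℂ, HasDerivAt (fun s : ℂ => w + s • (Pi.single k 1 : Fin d → ℂ))
        (Pi.single k 1) s := fun s => by
      simpa using ((hasDerivAt_id s).smul_const (Pi.single k (1 : ℂ) : Fin d → ℂ)).const_add w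
    have hn : ∀ s : ℂ, ‖s • (Pi.single k 1 : Fin d → ℂ)‖ = ‖s‖ := fun s => by
      rw [norm_smul, Pi.norm_single, norm_one, mul_one]
    have h1 : ∀ s : ℂ, ‖s‖ ≤ ρ → HasDerivAt (fun s : ℂ => logIntegrand F (toComplex p)
        (frameMap u (w + s • Pi.single k 1))) (fderiv ℂ (fun w => logIntegrand F (toComplex p)
          (frameMap u w)) (w + s • Pi.single k 1) (Pi.single k 1)) s := fun s hs => by
      have h2 := (h τ hτ t _ ((hn s).trans_le hs)).1.differentiableAt.hasFDerivAt
      exact h2.comp_hasDerivAt s (h0 s)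
    have h2 := h1 0 (by simpa using hρ.le)
    rw [zero_smul, add_zero] at h2
    rw [← h2.deriv]
    refine Complex.norm_deriv_le_of_forall_mem_sphere_norm_le hρ
      (DifferentiableOn.diffContOnCl_ball (U := Metric.closedBall 0 ρ) (fun s hs => ?_) le_rfl)
      fun s hs => (h τ hτ t _ ((hn s).trans (mem_sphere_zero_iff_norm.1 hs)).le).2
    exact (h1 s (mem_closedBall_zero_iff.1 hs)).differentiableAt.differentiableWithinAt
  refine ⟨?_, fun k => (hd k).trans ?_⟩
  · have h3 := (h τ hτ t 0 (by simpa using hρ.le)).2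
    rw [add_zero] at h3
    exact h3.trans (le_add_of_nonneg_right (by positivity))
  · exact le_add_of_nonneg_left hb0

theorem linForm_shift_mem_slitPlane (hm : ∀ s, m ≤ ε s) (hm0 : 0 < m) (hC : ∀ s, ε s ≤ C)
    (hp : IsClose e u p m C) (lam : F → ℤˣ) {τ : ℝ} (hτ : 0 < τ) (t : Fin d → ℝ) {j : Fin n}
    (hj : j ∈ F) : linForm (toComplex p) (frameMap u (shift (signs e lam) (lift e ε lam) τ t)) j ∈
      Complex.slitPlane :=
  Or.inr (abs_pos.1 ((by positivity : 0 < τ * (m / 2)).trans_le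
    (hp.le_abs_im hm hm0 hC lam hτ t ⟨j, hj⟩)))

theorem contDiff_one_lift (hε : IsHeight ε) (lam : F → ℤˣ) (k : Fin d) :
    ContDiff ℝ 1 (lift e ε lam k) :=
  (contDiff_lift hε lam k).of_le (by exact_mod_cast le_top)

theorem integrable_scaledIntegrand (hu : u.det ≠ 0) (hm : ∀ s, m ≤ ε s) (hm0 : 0 < m)
    (hC : ∀ s, ε s ≤ C) (hε : IsHeight ε) (hp : IsClose e u p m C) (lam : F → ℤˣ) {τ : ℝ}
    (hτ : τ ∈ Set.Ioo (0 : ℝ) 2) : Integrable (scaledIntegrand e u ε p lam τ) := by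
  obtain ⟨B, hBi, hB⟩ := bounds_logIntegrand_shift hu hm hm0 hC hε hp lam (half_pos hτ.1)
  obtain ⟨R, hR⟩ := hε.deriv_bounded
  have hσ : ∀ k, |signs e lam k| ≤ max 1 R := fun k => (abs_signs lam k).trans_le (le_max_left _ _)
  refine integrable_mul_prod_rate hσ (contDiff_one_lift hε lam)
    (fun k s => (norm_deriv_lift hε lam k s).trans_le ((hR _).trans (le_max_right _ _))) hτ _
    (hBi.mono' (Continuous.aestronglyMeasurable (continuous_iff_continuousAt.2 fun t => ?_))
      (Filter.Eventually.of_forall fun t => (hB τ ⟨half_lt_self hτ.1, hτ.2⟩ t).1))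
  have h1 : ContinuousAt (fun t => frameMap u (shift (signs e lam) (lift e ε lam) τ t)) t :=
    ((frameMap u).continuous.comp
      (continuous_shift (contDiff_one_lift hε lam) τ)).continuousAt
  exact (analyticAt_logIntegrand p fun j hj => linForm_shift_mem_slitPlane hm hm0 hC hp lam hτ.1 t
    hj).continuousAt.comp (f := fun t => frameMap u (shift (signs e lam) (lift e ε lam) τ t)) h1

/-- The integral does not change when the contour moves towards the real space. -/
theorem integral_scaledIntegrand_eq (hu : u.det ≠ 0) (hm : ∀ s, m ≤ ε s) (hm0 : 0 < m)
    (hC : ∀ s, ε s ≤ C) (hε : IsHeight ε) (hp : IsClose e u p m C) (lam : F → ℤˣ) {τ τ' : ℝ}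
    (hτ : τ ∈ Set.Ioo (0 : ℝ) 2) (hτ' : τ' ∈ Set.Ioo (0 : ℝ) 2) :
    ∫ t, scaledIntegrand e u ε p lam τ t = ∫ t, scaledIntegrand e u ε p lam τ' t := by
  obtain ⟨R, hR⟩ := hε.deriv_bounded
  have h1 : (1 : ℝ) ≤ max 1 (max C R) := le_max_left _ _
  have hCM : C ≤ max 1 (max C R) := (le_max_left _ _).trans (le_max_right _ _)
  have hRM : R ≤ max 1 (max C R) := (le_max_right _ _).trans (le_max_right _ _)
  exact integral_shift_eq (G := fun w => logIntegrand F (toComplex p) (frameMap u w))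
    (zero_le_one.trans h1) (fun k => (abs_signs lam k).trans_le h1) (contDiff_one_lift hε lam)
    (fun k s => (norm_lift hε lam k s).trans_le ((hC _).trans hCM))
    (fun k s => (norm_deriv_lift hε lam k s).trans_le ((hR _).trans hRM))
    (fun τ hτ t => (analyticAt_logIntegrand p fun j hj => linForm_shift_mem_slitPlane hm hm0 hC hp
      lam hτ.1 t hj).comp ((frameMap u).analyticAt _))
    (fun τ₀ hτ₀ => bounds_logIntegrand_shift hu hm hm0 hC hε hp lam hτ₀) hτ hτ'

theorem contourIntegral_contour (hε : IsHeight ε) (lam : F → ℤˣ) :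
    contourIntegral (contour e u ε lam) (logIntegrand F (toComplex p)) =
      ((u⁻¹).det : ℂ) * ∫ t, scaledIntegrand e u ε p lam 1 t := by
  simp only [contourIntegral, pullback_contour hε, scaledIntegrand]
  exact integral_const_mul _ _

theorem integrable_pullback_contour (hu : u.det ≠ 0) (hm : ∀ s, m ≤ ε s) (hm0 : 0 < m)
    (hC : ∀ s, ε s ≤ C) (hε : IsHeight ε) (hp : IsClose e u p m C) (lam : F → ℤˣ) :
    Integrable (pullback (contour e u ε lam) (logIntegrand F (toComplex p))) := by
  have h := (integrable_scaledIntegrand hu hm hm0 hC hε hp lam (τ := 1)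
    ⟨one_pos, one_lt_two⟩).const_mul ((u⁻¹).det : ℂ)
  exact h.congr (Filter.Eventually.of_forall fun t => (pullback_contour hε lam _ t).symm)

end Deformation
end
end GaussPolyhedron

namespace GaussPolyhedron
noncomputable section

/-! ### Integrability of logarithms against a Gaussian -/

section LogIntegrability

open MeasureTheory

variable {d n : ℕ}

theorem ae_affine_ne_zero {c : Fin d → ℝ} (hc : c ≠ 0) (b : ℝ) :
    ∀ᵐ t : Fin d → ℝ, ∑ k, c k * t k + b ≠ 0 := by
  by_cases h : ∃ t₀ : Fin d → ℝ, ∑ k, c k * t₀ k + b = 0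
  · obtain ⟨t₀, h₀⟩ := h
    let φ : (Fin d → ℝ) →ₗ[ℝ] ℝ := ∑ k, c k • LinearMap.proj k
    have hφ : ∀ t, φ t = ∑ k, c k * t k := fun t => by simp [φ]
    have hs : AffineSubspace.mk' t₀ (LinearMap.ker φ) ≠ ⊤ := by
      intro htop
      refine hc (funext fun k => ?_)
      have h1 : t₀ + Pi.single k 1 ∈ AffineSubspace.mk' t₀ (LinearMap.ker φ) := by
        rw [htop]; trivial
      rw [AffineSubspace.mem_mk', vsub_eq_sub, add_sub_cancel_left, LinearMap.mem_ker, hφ] at h1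
      simpa [Pi.single_apply] using h1
    have h2 := Measure.addHaar_affineSubspace (volume : Measure (Fin d → ℝ)) _ hs
    refine measure_mono_null (fun t ht => ?_) h2
    have ht' : ∑ k, c k * t k + b = 0 := not_not.1 ht
    change t ∈ AffineSubspace.mk' t₀ (LinearMap.ker φ)
    rw [AffineSubspace.mem_mk', vsub_eq_sub, LinearMap.mem_ker, map_sub, hφ, hφ]
    linarith
  · push Not at h
    exact Filter.Eventually.of_forall h

/-- The logarithm is integrable near its singularity and bounded by `|y + b|` where `|y + b| ≥ 1`,
so the Gaussian controls the rest. -/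
theorem integrable_gauss_mul_log {κ : ℝ} (hκ : 0 < κ) (b K : ℝ) :
    Integrable fun y : ℝ => Real.exp (-κ * y ^ 2) * (|Real.log (y + b)| + |y + b| + K) := by
  have h1 : Integrable ((Set.Ioc (-1 : ℝ) 1).indicator fun v => |Real.log v|) := by
    rw [integrable_indicator_iff measurableSet_Ioc]
    exact ((intervalIntegrable_iff_integrableOn_Ioc_of_le (by norm_num)).1
      (intervalIntegral.intervalIntegrable_log' (a := -1) (b := 1))).abs
  have h2 := (h1.comp_add_right b).add
    ((integrable_exp_neg_sq_add_abs hκ 1).const_mul (2 + 2 * |b| + |K|))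
  refine h2.mono' ?_ (Filter.Eventually.of_forall fun y => ?_)
  · refine Measurable.aestronglyMeasurable ?_
    have : Measurable fun y : ℝ => Real.log (y + b) :=
      Real.measurable_log.comp (measurable_id.add_const b)
    exact (by fun_prop : Measurable fun y : ℝ => Real.exp (-κ * y ^ 2)).mul
      ((this.abs.add (measurable_id.add_const b).abs).add_const K)
  · have h3 : |Real.log (y + b)| ≤
        (Set.Ioc (-1 : ℝ) 1).indicator (fun v => |Real.log v|) (y + b) + |y + b| := by
      by_cases hv : y + b ∈ Set.Ioc (-1 : ℝ) 1
      · rw [Set.indicator_of_mem hv]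
        linarith [abs_nonneg (y + b)]
      · rw [Set.indicator_of_notMem hv, zero_add, ← Real.log_abs]
        have hv1 : 1 ≤ |y + b| := by
          by_contra h
          have := abs_lt.1 (not_le.1 h)
          exact hv ⟨this.1, this.2.le⟩
        rw [abs_of_nonneg (Real.log_nonneg hv1)]
        linarith [Real.log_le_sub_one_of_pos (one_pos.trans_le hv1)]
    have h4 : Real.exp (-κ * y ^ 2) ≤ 1 := Real.exp_le_one_iff.2 (by nlinarith [sq_nonneg y])
    have h5 : Real.exp (1 * |y| - κ * y ^ 2) = Real.exp (-κ * y ^ 2) * Real.exp |y| := by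
      rw [← Real.exp_add]; ring_nf
    have h6 : 2 * |y + b| + |K| ≤ (2 + 2 * |b| + |K|) * Real.exp |y| := by
      have := Real.add_one_le_exp |y|
      nlinarith [abs_add_le y b, abs_nonneg y, abs_nonneg b, abs_nonneg K,
        mul_nonneg (abs_nonneg b) (abs_nonneg y), mul_nonneg (abs_nonneg K) (abs_nonneg y)]
    set I := (Set.Ioc (-1 : ℝ) 1).indicator (fun v => |Real.log v|) (y + b) with hI
    have hI0 : 0 ≤ I := Set.indicator_nonneg (fun _ _ => abs_nonneg _) _
    have h7 := Real.exp_pos (-κ * y ^ 2)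
    rw [Real.norm_eq_abs, abs_mul, abs_of_pos h7]
    have h8 : |(|Real.log (y + b)| + |y + b| + K)| ≤ I + (2 * |y + b| + |K|) := by
      refine (abs_add_le _ _).trans ?_
      rw [abs_of_nonneg (by positivity)]
      linarith
    calc Real.exp (-κ * y ^ 2) * |(|Real.log (y + b)| + |y + b| + K)| ≤
          Real.exp (-κ * y ^ 2) * (I + (2 + 2 * |b| + |K|) * Real.exp |y|) :=
          mul_le_mul_of_nonneg_left (h8.trans (by linarith)) h7.le
      _ ≤ I + (2 + 2 * |b| + |K|) * Real.exp (1 * |y| - κ * y ^ 2) := by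
          rw [h5]; nlinarith

/-- Products of logarithms of independent affine forms are integrable for a Gaussian weight. -/
theorem integrable_gauss_mul_prod_log {F : Finset (Fin n)} {p : Params ℝ d n}
    (hp : p ∈ regularSet ℝ F) {κ : ℝ} (hκ : 0 < κ) {K : ℝ} (hK : 0 ≤ K) :
    Integrable fun x : Fin d → ℝ => Real.exp (-κ * ∑ k, x k ^ 2) *
      ∏ j : F, (|Real.log (linForm p x j)| + |linForm p x j| + K) := by
  have hv := det_gramMatrix_normals hp
  obtain ⟨δ, hδ, hdual⟩ := exists_le_dualForm hv
  obtain ⟨c, hc⟩ := exists_integral_coordMap hv hκ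
  let h : (F → ℝ) → ℝ := fun y => ∏ j, (|Real.log (y j + p.2 j)| + |y j + p.2 j| + K)
  have hmeas : Measurable h := by
    refine Finset.measurable_prod _ fun j _ => ?_
    have h1 : Measurable fun y : F → ℝ => y j + p.2 j := (measurable_pi_apply j).add_const _
    exact ((Real.measurable_log.comp h1).abs.add h1.abs).add_const K
  have h0 : ∀ y, 0 ≤ h y := fun y => Finset.prod_nonneg fun j _ => by positivity
  -- Replacing the dual form by the smaller `δ ∑ y j ²` makes the majorant a product of functions of
  -- one variable.
  have h1 : Integrable fun y : F → ℝ => ∏ j, (Real.exp (-(κ * δ) * y j ^ 2) *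
      (|Real.log (y j + p.2 j)| + |y j + p.2 j| + K)) :=
    Integrable.fintype_prod fun j : F => integrable_gauss_mul_log (mul_pos hκ hδ) (p.2 j) K
  have h2 : Integrable fun y => Real.exp (-κ * dualForm (normals p F) y) * h y := by
    refine h1.mono' ?_ (Filter.Eventually.of_forall fun y => ?_)
    · refine (Measurable.mul ?_ hmeas).aestronglyMeasurable
      have hd : Continuous fun y => dualForm (normals p F) y := by
        unfold dualForm
        simp only [Matrix.mulVec, dotProduct]
        fun_prop
      exact Real.measurable_exp.comp (hd.measurable.const_mul _)
    · rw [Real.norm_eq_abs, abs_mul, Real.abs_exp, abs_of_nonneg (h0 y), Finset.prod_mul_distrib,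
        ← Real.exp_sum, ← Finset.mul_sum]
      refine mul_le_mul_of_nonneg_right (Real.exp_le_exp.2 ?_) (h0 y)
      nlinarith [hdual y]
  refine ((hc h).2 h2).congr (Filter.Eventually.of_forall fun x => ?_)
  have h3 : ∀ j : F, coordMap (normals p F) x j + p.2 j = linForm p x j := fun j => by
    simp [coordMap_apply, normals, linForm]
  simp only [h, h3]

end LogIntegrability

/-! ### Boundary values of the logarithm -/

section BoundaryValues

/-- The boundary values of the logarithm on the real axis, from above for `s = 1` and from below
for `s = -1`. -/
def boundaryLog (s y : ℝ) : ℂ := Real.log y + if y < 0 then s * Real.pi * Complex.I else 0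

theorem tendsto_log_boundaryLog {s y : ℝ} (hs : s = 1 ∨ s = -1) (hy : y ≠ 0) {l : Filter ℝ}
    {f : ℝ → ℂ} (hf : Filter.Tendsto f l (𝓝 (y : ℂ))) (him : ∀ᶠ τ in l, 0 < s * (f τ).im) :
    Filter.Tendsto (fun τ => Complex.log (f τ)) l (𝓝 (boundaryLog s y)) := by
  rcases lt_or_gt_of_ne hy with hneg | hpos
  · have hlog : ((Real.log ‖(y : ℂ)‖ : ℝ) : ℂ) = Real.log y := by
      rw [Complex.norm_real, Real.norm_eq_abs, Real.log_abs]
    unfold boundaryLog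
    rw [if_pos hneg]
    rcases hs with rfl | rfl
    · have h := Complex.tendsto_log_nhdsWithin_im_nonneg_of_re_neg_of_im_zero
        (z := (y : ℂ)) (by simpa using hneg) (by simp)
      rw [hlog] at h
      simpa [Function.comp_def] using h.comp (tendsto_nhdsWithin_iff.2 ⟨hf, him.mono fun τ h => by
        simpa using h.le⟩)
    · have h := Complex.tendsto_log_nhdsWithin_im_neg_of_re_neg_of_im_zero
        (z := (y : ℂ)) (by simpa using hneg) (by simp)
      rw [hlog] at h
      simpa [Function.comp_def, sub_eq_add_neg] using h.comp (tendsto_nhdsWithin_iff.2 ⟨hf, him.mono fun τ h => by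
        simpa using h⟩)
  · unfold boundaryLog
    rw [if_neg (not_lt.2 hpos.le), add_zero, Complex.ofReal_log hpos.le]
    exact (continuousAt_clog (Or.inl (by simpa using hpos))).tendsto.comp hf

/-- Near the singularity the bound uses only the real part, which for `f_j` on the scaled contours
does not depend on the scale. -/
theorem abs_log_norm_le {z : ℂ} (hz : z.re ≠ 0) :
    |Real.log ‖z‖| ≤ |Real.log z.re| + |z.re| + |z.im| := by
  have h1 := Complex.abs_re_le_norm z
  have h2 := Complex.norm_le_abs_re_add_abs_im z
  have h3 : 0 < |z.re| := abs_pos.2 hz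
  rcases le_or_gt 1 ‖z‖ with h | h
  · rw [abs_of_nonneg (Real.log_nonneg h)]
    have := Real.log_le_sub_one_of_pos (one_pos.trans_le h)
    have := abs_nonneg (Real.log z.re)
    linarith
  · have h4 : Real.log |z.re| ≤ Real.log ‖z‖ := Real.log_le_log h3 h1
    have h5 : Real.log ‖z‖ ≤ 0 := Real.log_nonpos (norm_nonneg _) h.le
    rw [Real.log_abs] at h4
    rw [abs_of_nonpos h5, abs_of_nonpos (h4.trans h5)]
    have := abs_nonneg z.im
    linarith

end BoundaryValues
end
end GaussPolyhedron

namespace GaussPolyhedron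
noncomputable section

/-! ### The limit of the contour towards the real space -/

section BoundaryIntegral

open MeasureTheory

variable {d n : ℕ} {F : Finset (Fin n)} {e : F ↪ Fin d} {u : Matrix (Fin d) (Fin d) ℝ} {ε : ℝ → ℝ}
  {p : Params ℝ d n} {m C : ℝ}

/-- The limit of the integrand when the contour approaches the real space. -/
def boundaryIntegrand (p : Params ℝ d n) (lam : F → ℤˣ) (x : Fin d → ℝ) : ℂ :=
  (gaussConst d * Real.exp (-(1 / 2) * ∑ i, x i ^ 2) : ℝ) *
    ∏ j : F, (-(boundaryLog ((lam j : ℤ) : ℝ) (linForm p x j) / (2 * Real.pi * Complex.I)))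

theorem ae_linForm_realPoint_ne_zero (hm : ∀ s, m ≤ ε s) (hm0 : 0 < m) (hC : ∀ s, ε s ≤ C)
    (hp : IsClose e u p m C) (lam : F → ℤˣ) :
    ∀ᵐ t, ∀ j : F, linForm p (realPoint u (signs e lam) t) j ≠ 0 := by
  refine Filter.eventually_all.2 fun j => ?_
  -- With vanishing coefficients the form would be constant and its imaginary part zero, against the
  -- lower bound.
  have hc : (fun k => frameCoeff u p j k * signs e lam k) ≠ 0 := by
    intro h
    have h1 := hp.le_abs_im hm hm0 hC lam one_pos 0 j
    have h2 : ∀ k, frameCoeff u p j k * (signs e lam k * ε (signs e lam k * (0 : Fin d → ℝ) k)) =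
        0 := fun k => by
      rw [← mul_assoc]
      have := congrFun h k
      simp only [Pi.zero_apply] at this
      rw [this, zero_mul]
    rw [im_linForm_shift] at h1
    simp only [h2, Finset.sum_const_zero, mul_zero, abs_zero] at h1
    linarith
  filter_upwards [ae_affine_ne_zero hc (p.2 j)] with t ht
  rw [linForm_realPoint]
  simpa only [mul_assoc] using ht

theorem norm_shift_sub_le (hm : ∀ s, m ≤ ε s) (hm0 : 0 < m) (hC : ∀ s, ε s ≤ C) (hε : IsHeight ε)
    (lam : F → ℤˣ) {τ : ℝ} (hτ : τ ∈ Set.Ioo (0 : ℝ) 2) (t : Fin d → ℝ) (k : Fin d) :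
    ‖shift (signs e lam) (lift e ε lam) τ t k - signs e lam k * t k‖ ≤ 2 * C := by
  rw [shift, add_sub_cancel_left, norm_mul, Complex.norm_real, Real.norm_eq_abs, abs_of_pos hτ.1,
    norm_lift hε]
  exact mul_le_mul hτ.2.le (hC _) (hm0.le.trans (hm _)) (by norm_num)

theorem abs_im_linForm_shift_le (hm : ∀ s, m ≤ ε s) (hm0 : 0 < m) (hC : ∀ s, ε s ≤ C)
    (p : Params ℝ d n) (lam : F → ℤˣ) {τ : ℝ} (hτ : τ ∈ Set.Ioo (0 : ℝ) 2) (t : Fin d → ℝ)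
    (j : Fin n) :
    |(linForm (toComplex p) (frameMap u (shift (signs e lam) (lift e ε lam) τ t)) j).im| ≤
      2 * C * ∑ j, ∑ k, |frameCoeff u p j k| := by
  rw [im_linForm_shift, abs_mul, abs_of_pos hτ.1, mul_assoc]
  refine mul_le_mul hτ.2.le ?_ (abs_nonneg _) (by norm_num)
  have hC0 : 0 ≤ C := hm0.le.trans ((hm 0).trans (hC 0))
  have h1 : ∑ k, |frameCoeff u p j k| ≤ ∑ j, ∑ k, |frameCoeff u p j k| :=
    Finset.single_le_sum (f := fun j => ∑ k, |frameCoeff u p j k|)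
      (fun _ _ => Finset.sum_nonneg fun _ _ => abs_nonneg _) (Finset.mem_univ j)
  refine (Finset.abs_sum_le_sum_abs _ _).trans (le_trans ?_ (mul_le_mul_of_nonneg_left h1 hC0))
  rw [Finset.mul_sum]
  refine Finset.sum_le_sum fun k _ => ?_
  rw [abs_mul, abs_mul, abs_signs, one_mul, mul_comm C, abs_of_pos (hm0.trans_le (hm _))]
  exact mul_le_mul_of_nonneg_left (hC _) (abs_nonneg _)

theorem exp_linear_sub_quadratic_le (M : ℝ) (x : Fin d → ℝ) :
    Real.exp (M * ∑ i, |x i| - 1 / 2 * ∑ i, x i ^ 2) ≤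
      Real.exp (d * M ^ 2) * Real.exp (-(1 / 4) * ∑ i, x i ^ 2) := by
  rw [← Real.exp_add]
  refine Real.exp_le_exp.2 ?_
  have h1 : ∑ i, M * |x i| ≤ ∑ i, (M ^ 2 + 1 / 4 * x i ^ 2) :=
    Finset.sum_le_sum fun i _ => by nlinarith [sq_nonneg (M - 1 / 2 * |x i|), sq_abs (x i)]
  rw [← Finset.mul_sum, Finset.sum_add_distrib, ← Finset.mul_sum] at h1
  simp only [Finset.sum_const, Finset.card_univ, Fintype.card_fin, nsmul_eq_mul] at h1
  linarith

/-- The majorant must survive `τ → 0`, where the distance from the cut degenerates. The logarithms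
are therefore bounded by those of the real parts, which are finite almost everywhere and integrable
because the forms are independent. -/
theorem exists_bound_scaledIntegrand (hu : u.det ≠ 0) (hm : ∀ s, m ≤ ε s) (hm0 : 0 < m)
    (hC : ∀ s, ε s ≤ C) (hε : IsHeight ε) (hp : IsClose e u p m C) (hreg : p ∈ regularSet ℝ F)
    (lam : F → ℤˣ) : ∃ B : (Fin d → ℝ) → ℝ, Integrable B ∧ ∀ τ ∈ Set.Ioo (0 : ℝ) 2, ∀ᵐ t,
      ‖scaledIntegrand e u ε p lam τ t‖ ≤ B t := by
  have hC0 : 0 ≤ C := hm0.le.trans ((hm 0).trans (hC 0))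
  obtain ⟨R, hR⟩ := hε.deriv_bounded
  set M := (∑ k, ∑ i, |u⁻¹ k i|) * (2 * C) with hM
  set K := 2 * C * ∑ j, ∑ k, |frameCoeff u p j k| + Real.pi with hK
  have hK0 : 0 ≤ K := add_nonneg (by positivity) Real.pi_pos.le
  set A := gaussConst d * (Real.exp (d * M ^ 2) * Real.exp (d * M ^ 2)) * (3 * max 1 R) ^ d
  refine ⟨_, (integrable_comp_realPoint hu (abs_signs (e := e) lam)
    (integrable_gauss_mul_prod_log hreg (κ := 1 / 4) (by norm_num) hK0)).const_mul A,
    fun τ hτ => ?_⟩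
  filter_upwards [ae_linForm_realPoint_ne_zero hm hm0 hC hp lam] with t ht
  set x := realPoint u (signs e lam) t with hx
  have hg := gaussConst_pos d
  have h1 := (norm_exp_gauss_le (norm_frameMap_sub_realPoint_le (u := u)
    (norm_shift_sub_le hm hm0 hC hε (e := e) lam hτ t))).trans
    (mul_le_mul_of_nonneg_left (exp_linear_sub_quadratic_le _ _) (Real.exp_pos _).le)
  rw [← hM, ← hx] at h1
  have h2 : ∀ j : F, ‖-(Complex.log (linForm (toComplex p) (frameMap u
      (shift (signs e lam) (lift e ε lam) τ t)) j) / (2 * Real.pi * Complex.I))‖ ≤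
      |Real.log (linForm p x j)| + |linForm p x j| + K := by
    intro j
    refine (norm_neg_div_two_pi_I_le _).trans ((norm_log_le _).trans ?_)
    have h3 := abs_log_norm_le (z := linForm (toComplex p) (frameMap u
      (shift (signs e lam) (lift e ε lam) τ t)) j) (by rw [re_linForm_shift]; exact ht j)
    rw [re_linForm_shift] at h3
    linarith [abs_im_linForm_shift_le (u := u) (e := e) hm hm0 hC p lam hτ t j]
  have h4 : ∀ k, ‖rate (signs e lam) (lift e ε lam) τ k (t k)‖ ≤ 3 * max 1 R := fun k =>
    norm_rate_le (fun k => (abs_signs lam k).trans_le (le_max_left _ _))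
      (fun k s => (norm_deriv_lift hε lam k s).trans_le ((hR _).trans (le_max_right _ _))) hτ k _
  have h5 := Finset.prod_le_prod (s := Finset.univ) (fun _ _ => norm_nonneg _) fun j _ => h2 j
  have h6 := Finset.prod_le_prod (s := Finset.univ) (fun _ _ => norm_nonneg _) fun k _ => h4 k
  rw [Finset.prod_const, Finset.card_univ, Fintype.card_fin] at h6
  rw [scaledIntegrand, logIntegrand, ← Finset.prod_coe_sort F, norm_mul, norm_mul, norm_mul,
    norm_prod, norm_prod, Complex.norm_real, Real.norm_eq_abs, abs_of_pos hg]
  have h7 : (0 : ℝ) ≤ ∏ j : F, (|Real.log (linForm p x j)| + |linForm p x j| + K) :=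
    Finset.prod_nonneg fun j _ => by positivity
  calc _ ≤ gaussConst d * (Real.exp (d * M ^ 2) * (Real.exp (d * M ^ 2) *
        Real.exp (-(1 / 4) * ∑ i, x i ^ 2))) *
        (∏ j : F, (|Real.log (linForm p x j)| + |linForm p x j| + K)) * (3 * max 1 R) ^ d := by
        refine mul_le_mul (mul_le_mul (mul_le_mul_of_nonneg_left h1 hg.le) h5
          (Finset.prod_nonneg fun _ _ => norm_nonneg _) (by positivity)) h6
          (Finset.prod_nonneg fun _ _ => norm_nonneg _) (by positivity)
    _ = _ := by simp only [A]; ring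

theorem tendsto_scaledIntegrand (hm : ∀ s, m ≤ ε s) (hm0 : 0 < m) (hC : ∀ s, ε s ≤ C)
    (hp : IsClose e u p m C) (lam : F → ℤˣ) {t : Fin d → ℝ}
    (ht : ∀ j : F, linForm p (realPoint u (signs e lam) t) j ≠ 0) :
    Filter.Tendsto (fun τ => scaledIntegrand e u ε p lam τ t) (𝓝[>] 0)
      (𝓝 (boundaryIntegrand p lam (realPoint u (signs e lam) t) *
        (∏ k, signs e lam k : ℝ))) := by
  have hshift : Filter.Tendsto (fun τ => frameMap u (shift (signs e lam) (lift e ε lam) τ t))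
      (𝓝[>] 0) (𝓝 (fun i => ((realPoint u (signs e lam) t i : ℝ) : ℂ))) := by
    have h1 : Continuous fun τ : ℝ => frameMap u (shift (signs e lam) (lift e ε lam) τ t) := by
      refine (frameMap u).continuous.comp (continuous_pi fun k => ?_)
      unfold shift
      fun_prop
    have h2 := (h1.tendsto 0).mono_left (nhdsWithin_le_nhds (s := Set.Ioi 0))
    have h3 : shift (signs e lam) (lift e ε lam) 0 t =
        fun k => (signs e lam k : ℂ) * t k := by
      ext k; simp [shift]
    rw [h3] at h2
    convert h2 using 2
    ext i
    exact (frameMap_real _ _ i).symm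
  have hrate : ∀ k, Filter.Tendsto (fun τ => rate (signs e lam) (lift e ε lam) τ k (t k))
      (𝓝[>] 0) (𝓝 ((signs e lam k : ℝ) : ℂ)) := by
    intro k
    have h1 : Continuous fun τ : ℝ => rate (signs e lam) (lift e ε lam) τ k (t k) := by
      unfold rate
      fun_prop
    have h2 := (h1.tendsto 0).mono_left (nhdsWithin_le_nhds (s := Set.Ioi 0))
    simpa [rate] using h2
  have hlog : ∀ j : F, Filter.Tendsto (fun τ => Complex.log (linForm (toComplex p)
      (frameMap u (shift (signs e lam) (lift e ε lam) τ t)) j)) (𝓝[>] 0)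
      (𝓝 (boundaryLog ((lam j : ℤ) : ℝ) (linForm p (realPoint u (signs e lam) t) j))) := by
    intro j
    refine tendsto_log_boundaryLog ?_ (ht j) ?_ ?_
    · rw [← signs_apply (e := e)]
      exact signs_eq_or _ _
    · have h1 := (analyticAt_linForm p (j : Fin n) (fun i =>
        ((realPoint u (signs e lam) t i : ℝ) : ℂ))).continuousAt.tendsto.comp hshift
      have h2 : linForm (toComplex p) (fun i => ((realPoint u (signs e lam) t i : ℝ) : ℂ)) j =
          (linForm p (realPoint u (signs e lam) t) j : ℝ) := by
        simp [linForm, toComplex]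
      rw [h2] at h1
      exact h1
    · filter_upwards [self_mem_nhdsWithin] with τ hτ
      have hτ' : 0 < τ := hτ
      have := hp.le_signs_mul_im hm hm0 hC lam hτ' t j
      rw [signs_apply] at this
      exact lt_of_lt_of_le (by positivity) this
  unfold scaledIntegrand logIntegrand boundaryIntegrand
  simp only [← Finset.prod_coe_sort F]
  rw [Complex.ofReal_prod]
  refine Filter.Tendsto.mul (Filter.Tendsto.mul ?_ (tendsto_finsetProd _ fun j _ =>
    ((hlog j).div_const _).neg)) (tendsto_finsetProd _ fun k _ => hrate k)
  have h1 : Continuous fun z : Fin d → ℂ =>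
      (gaussConst d : ℂ) * Complex.exp (-(1 / 2) * ∑ i, z i ^ 2) := by fun_prop
  have h2 := (h1.tendsto _).comp hshift
  have h3 : ((gaussConst d * Real.exp (-(1 / 2) * ∑ i, realPoint u (signs e lam) t i ^ 2) : ℝ) :
      ℂ) = (gaussConst d : ℂ) * Complex.exp (-(1 / 2) *
        ∑ i, ((realPoint u (signs e lam) t i : ℝ) : ℂ) ^ 2) := by
    push_cast
    ring_nf
  rw [h3]
  exact h2

/-- The integral is constant in `τ`, so it equals its limit at `0`, computed by dominated
convergence; the real change of variables contributes `|det u|`. -/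
theorem integral_scaledIntegrand (hu : u.det ≠ 0) (hm : ∀ s, m ≤ ε s) (hm0 : 0 < m)
    (hC : ∀ s, ε s ≤ C) (hε : IsHeight ε) (hp : IsClose e u p m C) (hreg : p ∈ regularSet ℝ F)
    (lam : F → ℤˣ) : ∫ t, scaledIntegrand e u ε p lam 1 t =
      (∏ k, signs e lam k : ℝ) * (|u.det| : ℝ) * ∫ x, boundaryIntegrand p lam x := by
  obtain ⟨B, hB, hBd⟩ := exists_bound_scaledIntegrand hu hm hm0 hC hε hp hreg lam
  have hev : ∀ᶠ τ : ℝ in 𝓝[>] 0, τ ∈ Set.Ioo (0 : ℝ) 2 := Ioo_mem_nhdsGT two_pos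
  have h1 := tendsto_integral_filter_of_dominated_convergence B
    (hev.mono fun τ hτ =>
      (integrable_scaledIntegrand hu hm hm0 hC hε hp lam hτ).aestronglyMeasurable)
    (hev.mono fun τ hτ => hBd τ hτ) hB
    ((ae_linForm_realPoint_ne_zero hm hm0 hC hp lam).mono fun t ht =>
      tendsto_scaledIntegrand hm hm0 hC hp lam ht)
  have h2 : Filter.Tendsto (fun τ => ∫ t, scaledIntegrand e u ε p lam τ t) (𝓝[>] 0)
      (𝓝 (∫ t, scaledIntegrand e u ε p lam 1 t)) :=
    tendsto_const_nhds.congr' (hev.mono fun τ hτ =>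
      integral_scaledIntegrand_eq hu hm hm0 hC hε hp lam ⟨one_pos, one_lt_two⟩ hτ)
  rw [tendsto_nhds_unique h2 h1, integral_mul_const,
    integral_comp_realPoint hu (abs_signs lam) (boundaryIntegrand p lam)]
  ring

end BoundaryIntegral
end
end GaussPolyhedron

namespace GaussPolyhedron
noncomputable section

/-! ### Summation over the signs and the contour formula -/

section ContourFormula

open MeasureTheory

variable {d n : ℕ} {F : Finset (Fin n)} {e : F ↪ Fin d} {u : Matrix (Fin d) (Fin d) ℝ} {ε : ℝ → ℝ}
  {p : Params ℝ d n} {m C : ℝ}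

theorem measurable_boundaryLog (s : ℝ) : Measurable (boundaryLog s) := by
  unfold boundaryLog
  exact (Complex.measurable_ofReal.comp Real.measurable_log).add
    (Measurable.ite measurableSet_Iio measurable_const measurable_const)

theorem norm_boundaryLog_le {s : ℝ} (hs : |s| = 1) (y : ℝ) :
    ‖boundaryLog s y‖ ≤ |Real.log y| + Real.pi := by
  refine (norm_add_le _ _).trans (add_le_add ?_ ?_)
  · rw [Complex.norm_real, Real.norm_eq_abs]
  · split_ifs
    · simp [hs, abs_of_pos Real.pi_pos]
    · simpa using Real.pi_pos.le

theorem abs_units_cast (s : ℤˣ) : |((s : ℤ) : ℝ)| = 1 := by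
  rcases Int.units_eq_one_or s with rfl | rfl <;> simp

theorem integrable_boundaryIntegrand (hreg : p ∈ regularSet ℝ F) (lam : F → ℤˣ) :
    Integrable (boundaryIntegrand p lam) := by
  have hg := gaussConst_pos d
  refine ((integrable_gauss_mul_prod_log hreg (κ := 1 / 2) (by norm_num)
    Real.pi_pos.le).const_mul (gaussConst d)).mono' ?_ (Filter.Eventually.of_forall fun x => ?_)
  · refine Measurable.aestronglyMeasurable ?_
    unfold boundaryIntegrand
    refine Measurable.mul (by fun_prop) (Finset.measurable_prod _ fun j _ =>
      (Measurable.div_const ?_ _).neg)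
    exact (measurable_boundaryLog _).comp
      ((continuous_linForm (j : Fin n)).comp (Continuous.prodMk_right p)).measurable
  · have h1 : ∀ j : F, ‖-(boundaryLog ((lam j : ℤ) : ℝ) (linForm p x j) /
        (2 * Real.pi * Complex.I))‖ ≤ |Real.log (linForm p x j)| + |linForm p x j| + Real.pi :=
      fun j => by
        refine (norm_neg_div_two_pi_I_le _).trans ?_
        linarith [norm_boundaryLog_le (abs_units_cast (lam j)) (linForm p x j),
          abs_nonneg (linForm p x j)]
    have h2 := Finset.prod_le_prod (s := Finset.univ) (fun _ _ => norm_nonneg _) fun j _ => h1 j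
    rw [boundaryIntegrand, norm_mul, norm_prod, Complex.norm_real, Real.norm_eq_abs,
      abs_of_pos (mul_pos hg (Real.exp_pos _)), mul_assoc]
    refine mul_le_mul_of_nonneg_left ?_ hg.le
    exact mul_le_mul_of_nonneg_left h2 (Real.exp_pos _).le

/-- The jump of the logarithm gives the Heaviside function. -/
theorem sum_units_boundaryLog (y : ℝ) :
    ∑ s : ℤˣ, (((s : ℤ) : ℝ) : ℂ) *
      (-(boundaryLog ((s : ℤ) : ℝ) y / (2 * Real.pi * Complex.I))) =
      ((heaviside y - 1 : ℝ) : ℂ) := by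
  have hpi : (2 * Real.pi * Complex.I : ℂ) ≠ 0 := Complex.two_pi_I_ne_zero
  rw [UnitsInt.univ, Finset.sum_pair (by decide), heaviside_sub_one, boundaryLog, boundaryLog]
  simp only [Units.val_one, Int.cast_one, Units.val_neg, Int.cast_neg]
  split_ifs
  · push_cast
    field_simp
    ring
  · push_cast
    ring

/-- The sum over sign vectors factors into one two-term sum for each `j`, to which the jump of the
logarithm applies. -/
theorem sum_signs_boundaryIntegrand (p : Params ℝ d n) (F : Finset (Fin n)) (x : Fin d → ℝ) :
    ∑ lam : F → ℤˣ, ((∏ j, ((lam j : ℤ) : ℝ) : ℝ) : ℂ) * boundaryIntegrand p lam x =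
      ((gaussConst d * Real.exp (-(1 / 2) * ∑ i, x i ^ 2) *
        ∏ j ∈ F, (heaviside (linForm p x j) - 1) : ℝ) : ℂ) := by
  rw [← Finset.prod_coe_sort F, Complex.ofReal_mul, Complex.ofReal_prod]
  simp only [← sum_units_boundaryLog]
  rw [Finset.prod_univ_sum, Fintype.piFinset_univ, Finset.mul_sum]
  refine Finset.sum_congr rfl fun lam _ => ?_
  rw [boundaryIntegrand, Finset.prod_mul_distrib, Complex.ofReal_prod]
  ring

theorem phiF_eq_sum_boundaryIntegrand (hreg : p ∈ regularSet ℝ F) :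
    (phiF F p : ℂ) = ∑ lam : F → ℤˣ, ((∏ j, ((lam j : ℤ) : ℝ) : ℝ) : ℂ) *
      ∫ x, boundaryIntegrand p lam x := by
  rw [phiF, ← integral_complex_ofReal]
  simp only [← sum_signs_boundaryIntegrand]
  rw [integral_finsetSum _ fun lam _ => (integrable_boundaryIntegrand hreg lam).const_mul _]
  exact Finset.sum_congr rfl fun lam _ => integral_const_mul _ _

theorem sign_mul_det_inv_mul_abs {x : ℝ} (hx : x ≠ 0) : Real.sign x * x⁻¹ * |x| = 1 := by
  rcases lt_or_gt_of_ne hx with h | h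
  · rw [Real.sign_of_neg h, abs_of_neg h]; field_simp
  · rw [Real.sign_of_pos h, abs_of_pos h]; field_simp

/-- The contour integral formula near the parameter of the frame. -/
theorem phiF_eq_sum_contourIntegral (hu : u.det ≠ 0) (hm : ∀ s, m ≤ ε s) (hm0 : 0 < m)
    (hC : ∀ s, ε s ≤ C) (hε : IsHeight ε) (hp : IsClose e u p m C) (hreg : p ∈ regularSet ℝ F) :
    (phiF F p : ℂ) = (Real.sign u.det : ℂ) *
      ∑ lam : F → ℤˣ, contourIntegral (contour e u ε lam) (logIntegrand F (toComplex p)) := by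
  rw [phiF_eq_sum_boundaryIntegrand hreg, Finset.mul_sum]
  refine Finset.sum_congr rfl fun lam _ => ?_
  rw [contourIntegral_contour hε, integral_scaledIntegrand hu hm hm0 hC hε hp hreg,
    Matrix.det_nonsing_inv, Ring.inverse_eq_inv', prod_signs]
  have h : ((Real.sign u.det : ℝ) : ℂ) * ((u.det⁻¹ : ℝ) : ℂ) * ((|u.det| : ℝ) : ℂ) = 1 := by
    exact_mod_cast sign_mul_det_inv_mul_abs hu
  linear_combination (-(((∏ j, ((lam j : ℤ) : ℝ) : ℝ) : ℂ) * ∫ x, boundaryIntegrand p lam x)) * h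

theorem exists_contour_formula {p₀ : Params ℝ d n} (hp₀ : p₀ ∈ regularSet ℝ F)
    (hu : IsAdaptedFrame p₀.1 F e u) (hε : IsHeight ε) :
    ∃ V : Set (Params ℝ d n), IsOpen V ∧ IsConnected V ∧ p₀ ∈ V ∧ V ⊆ regularSet ℝ F ∧
      ∀ p ∈ V,
        (∀ (lam : F → ℤˣ) (t : Fin d → ℝ), ∀ j ∈ F,
          linForm (toComplex p) (contour e u ε lam t) j ∈ Complex.slitPlane) ∧
        (∀ lam : F → ℤˣ, MeasureTheory.Integrable
          (pullback (contour e u ε lam) (logIntegrand F (toComplex p)))) ∧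
        (phiF F p : ℂ) = (Real.sign u.det : ℂ) *
          ∑ lam : F → ℤˣ, contourIntegral (contour e u ε lam) (logIntegrand F (toComplex p)) := by
  obtain ⟨m, hm0, hm⟩ := hε.lower
  obtain ⟨C, hC⟩ := hε.upper
  have hdet := hu.det_ne_zero hp₀
  -- At `p₀` the frame coefficients are exactly Kronecker deltas, so closeness holds there and,
  -- being open, on a ball.
  obtain ⟨r, hr, hV⟩ := Metric.isOpen_iff.1 ((isOpen_isClose m C).inter (isOpen_regularSet F)) p₀
    ⟨isClose_self hu hdet hm0, hp₀⟩
  refine ⟨Metric.ball p₀ r, Metric.isOpen_ball,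
    ⟨⟨p₀, Metric.mem_ball_self hr⟩, (convex_ball p₀ r).isPreconnected⟩, Metric.mem_ball_self hr,
    fun p hp => (hV hp).2, fun p hp => ⟨fun lam t j hj => ?_, fun lam => ?_, ?_⟩⟩
  · rw [contour_eq]
    exact linForm_shift_mem_slitPlane hm hm0 hC (hV hp).1 lam one_pos t hj
  · exact integrable_pullback_contour hdet hm hm0 hC hε (hV hp).1 lam
  · exact phiF_eq_sum_contourIntegral hdet hm hm0 hC hε (hV hp).1 (hV hp).2

end ContourFormula
end
end GaussPolyhedron

/-! ### Assembly of the main theorem -/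

theorem mainTheorem6 (d n : ℕ) (hd : 0 < d) (hn : 0 < n) (p₀ : Params ℝ d n)
    (hbound : IsBoundingFamily p₀) (hgen : InGeneralPosition p₀) :
    (∀ F ∈ nerve p₀,
      p₀ ∈ regularSet ℝ F ∧
      (∃ (e : F ↪ Fin d) (u : Matrix (Fin d) (Fin d) ℝ), IsAdaptedFrame p₀.1 F e u) ∧
      ∀ (e : F ↪ Fin d) (u : Matrix (Fin d) (Fin d) ℝ), IsAdaptedFrame p₀.1 F e u →
      ∀ ε : ℝ → ℝ, IsHeight ε →
      u.det ≠ 0 ∧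
      (∀ lam : F → ℤˣ, ContDiff ℝ (⊤ : ℕ∞) (contour e u ε lam)) ∧
      ∃ V : Set (Params ℝ d n), IsOpen V ∧ IsConnected V ∧ p₀ ∈ V ∧ V ⊆ regularSet ℝ F ∧
        ∀ p ∈ V,
          (∀ (lam : F → ℤˣ) (t : Fin d → ℝ), ∀ j ∈ F,
            linForm (toComplex p) (contour e u ε lam t) j ∈ Complex.slitPlane) ∧
          (∀ lam : F → ℤˣ, MeasureTheory.Integrable
            (pullback (contour e u ε lam) (logIntegrand F (toComplex p)))) ∧
          (phiF F p : ℂ) = (Real.sign u.det : ℂ) *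
            ∑ lam : F → ℤˣ, contourIntegral (contour e u ε lam) (logIntegrand F (toComplex p))) ∧
    ∃ W : Set (Params ℝ d n), IsOpen W ∧ IsConnected W ∧ p₀ ∈ W ∧
      (∀ F ∈ nerve p₀, W ⊆ regularSet ℝ F) ∧
      AnalyticOnNhd ℝ phi W ∧
      ∀ γ : C(unitInterval, Params ℂ d n),
        (∀ t, ∀ F ∈ nerve p₀, γ t ∈ regularSet ℂ F) →
        ∀ p ∈ W, γ 0 = toComplex p →
        ∃ g : unitInterval → Params ℂ d n → ℂ, IsContinuationAlong γ g ∧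
          ∀ᶠ q in 𝓝 p, g 0 (toComplex q) = (phi q : ℂ) := by
  refine ⟨fun F hF => ?_, exists_analytic_continuation hgen⟩
  have hp₀ := mem_regularSet_of_mem_nerve hgen hF
  exact ⟨hp₀, exists_isAdaptedFrame hp₀, fun e u hu ε hε =>
    ⟨hu.det_ne_zero hp₀, contDiff_contour hε, exists_contour_formula hp₀ hu hε⟩⟩
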